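/- Let $a<b$, $J=[a,b]$, and let $f\in L^2(J)$ be real-valued. For a finite set $\Sigma\subset J$ let $u_\Sigma\in H^1_0((a,b)\setminus\Sigma)$ be the weak solution of $-u''=f$ in $(a,b)\setminus\Sigma$ with $u=0$ on $\Sigma\cup\{a,b\}$, that is, $\int_a^b u_\Sigma'\varphi'\,dx=\int_a^b f\varphi\,dx$ for all $\varphi\in H^1_0((a,b)\setminus\Sigma)$, and let $C(\Sigma)=\int_a^b f\,u_\Sigma\,dx$ be its compliance. Let $\mathcal P(J)$ be the set of Borel probability measures on $J$ with the weak* topology. For finite non-empty $\Sigma\subset J$ put $\mu_\Sigma=\frac1{\#\Sigma}\sum_{x\in\Sigma}\delta_x$ and, for $\mu\in\mathcal P(J)$, $$F_n(\mu)=\begin{cases}n^2\,C(\Sigma)&\text{if }\mu=\mu_\Sigma\text{ with }\#\Sigma\le n,\\+\infty&\text{otherwise.}\end{cases}$$ Then the functionals $F_n$ $\Gamma$-converge on $\mathcal P(J)$ to $$F(\mu)=\frac1{12}\int_J\frac{f^2}{\mu_a^2}\,dx ,$$ where $\mu_a$ is the density of the absolutely continuous part of $\mu$ with respect to Lebesgue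 measure and the integrand is understood to be $0$ where $f=0$ and $+\infty$ where $f\ne0=\mu_a$. That is, for every $\mu\in\mathcal P(J)$: $F(\mu)\le\liminf_n F_n(\mu_n)$ for every sequence $\mu_n\to\mu$, and $\limsup_nF_n(\mu_n)\le F(\mu)$ for some sequence $\mu_n\to\mu$. The same holds if the points are counted with multiplicity, that is, for the functionals equal to $n^2\,C(\{x_1,\dots,x_n\})$ if $\mu=\frac1n\sum_{i=1}^n\delta_{x_i}$ with $x_1,\dots,x_n\in J$ not necessarily distinct, and to $+\infty$ otherwise. Moreover, if $f$ is not almost everywhere $0$, then $F$ has a unique minimizer on $\mathcal P(J)$, namely $$\mu_{\mathrm{opt}}=c\,|f|^{2/3}\,dx,\qquad c=\Big(\int_J|f|^{2/3}\,dx\Big)^{-1}.$$ -/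

import Mathlib

open MeasureTheory Filter Topology
open scoped ENNReal

namespace DirichletPoints

/-- `Γ`-convergence of `F n : X → [0, +∞]` to `F`, in sequential form. On a first countable space,
such as the space of probability measures on a compact interval with the weak* topology, this is
the same as the definition through neighbourhoods. -/
def GammaConverges {X : Type*} [TopologicalSpace X] (F : ℕ → X → ℝ≥0∞) (G : X → ℝ≥0∞) : Prop :=
  ∀ x : X,
    (∀ y : ℕ → X, Tendsto y atTop (𝓝 x) → G x ≤ liminf (fun n => F n (y n)) atTop) ∧
    (∃ y : ℕ → X, Tendsto y atTop (𝓝 x) ∧ limsup (fun n => F n (y n)) atTop ≤ G x)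

/-- `φ ∈ C_c^∞(U)`. -/
def IsTestFunction (U : Set ℝ) (φ : ℝ → ℝ) : Prop :=
  ContDiff ℝ ((⊤ : ℕ∞) : WithTop ℕ∞) φ ∧ HasCompactSupport φ ∧ tsupport φ ⊆ U

/-- `u ∈ H₀¹(U)`, with weak derivative `u'`: the pair `(u, u')` is the limit in `L²(U) × L²(U)` of
pairs `(φ, φ')` with `φ ∈ C_c^∞(U)`. -/
def MemH10 (U : Set ℝ) (u u' : ℝ → ℝ) : Prop :=
  MemLp u 2 (volume.restrict U) ∧ MemLp u' 2 (volume.restrict U) ∧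
  ∃ φ : ℕ → ℝ → ℝ, (∀ k, IsTestFunction U (φ k)) ∧
    Tendsto (fun k => eLpNorm (fun x => u x - φ k x) 2 (volume.restrict U)) atTop (𝓝 0) ∧
    Tendsto (fun k => eLpNorm (fun x => u' x - deriv (φ k) x) 2 (volume.restrict U)) atTop (𝓝 0)

/-- `u`, with weak derivative `u'`, is the weak solution in `H₀¹(U)` of `-u'' = f` in `U`,
`u = 0` on `∂U`. -/
def IsWeakSolution (U : Set ℝ) (f u u' : ℝ → ℝ) : Prop :=
  MemH10 U u u' ∧
  ∀ φ φ' : ℝ → ℝ, MemH10 U φ φ' → ∫ x in U, u' x * φ' x = ∫ x in U, f x * φ x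

/-- The number `∫ f u` does not depend on the weak solution. -/
theorem IsWeakSolution.integral_eq {U : Set ℝ} {f u u' v v' : ℝ → ℝ}
    (hu : IsWeakSolution U f u u') (hv : IsWeakSolution U f v v') :
    ∫ x in U, f x * u x = ∫ x in U, f x * v x := by
  rw [← hu.2 v v' hv.1, ← hv.2 u u' hu.1]
  simp only [mul_comm]

/-- It is also the energy `∫ (u')²`, hence nonnegative. -/
theorem IsWeakSolution.integral_eq_energy {U : Set ℝ} {f u u' : ℝ → ℝ}
    (hu : IsWeakSolution U f u u') :
    ∫ x in U, f x * u x = ∫ x in U, u' x ^ 2 := by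
  rw [← hu.2 u u' hu.1]
  simp only [sq]

/-- The compliance `∫_U f u`, with `u` the weak solution of `-u'' = f` in `U`, `u = 0` on `∂U`.
The infimum only serves to select the common value of `∫_U f u`. -/
noncomputable def compliance (U : Set ℝ) (f : ℝ → ℝ) : ℝ≥0∞ :=
  ⨅ (u : ℝ → ℝ) (u' : ℝ → ℝ) (_ : IsWeakSolution U f u u'), ENNReal.ofReal (∫ x in U, f x * u x)

theorem IsWeakSolution.compliance_eq {U : Set ℝ} {f u u' : ℝ → ℝ}
    (hu : IsWeakSolution U f u u') :
    compliance U f = ENNReal.ofReal (∫ x in U, f x * u x) := by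
  refine le_antisymm (iInf_le_of_le u (iInf_le_of_le u' (iInf_le_of_le hu le_rfl))) ?_
  refine le_iInf fun v => le_iInf fun v' => le_iInf fun hv => ?_
  rw [hu.integral_eq hv]

/-- The compliance of `(a, b) \ S`, where `S ⊆ [a, b]` is a set of Dirichlet points. -/
noncomputable def pointCompliance (a b : ℝ) (f : ℝ → ℝ) (S : Set (Set.Icc a b)) : ℝ≥0∞ :=
  compliance (Set.Ioo a b \ (Subtype.val '' S)) f

/-- `F_n(μ) = n² · compliance of (a, b) \ S` if `μ = μ_S`, the uniform probability measure on a
finite set `S ⊆ [a, b]` with at most `n` elements, and `F_n(μ) = +∞` if there is no such `S`.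
(The set `S` is unique if it exists: it is the support of `μ`.) -/
noncomputable def pointFunctional (a b : ℝ) (f : ℝ → ℝ) (n : ℕ)
    (μ : ProbabilityMeasure (Set.Icc a b)) : ℝ≥0∞ :=
  ⨅ (S : Finset (Set.Icc a b))
    (_ : S.card ≤ n ∧
      (μ : Measure (Set.Icc a b)) = (S.card : ℝ≥0∞)⁻¹ • ∑ x ∈ S, Measure.dirac x),
    (n : ℝ≥0∞) ^ 2 * pointCompliance a b f (S : Set (Set.Icc a b))

/-- The variant of `pointFunctional` in which the points are counted with multiplicity:
`F_n(μ) = n² · compliance of (a, b) \ {x₁, …, xₙ}` if `μ = n⁻¹ (δ_{x₁} + … + δ_{xₙ})` for some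
points `x₁, …, xₙ ∈ [a, b]`, not necessarily distinct, and `F_n(μ) = +∞` otherwise. -/
noncomputable def multiPointFunctional (a b : ℝ) (f : ℝ → ℝ) (n : ℕ)
    (μ : ProbabilityMeasure (Set.Icc a b)) : ℝ≥0∞ :=
  ⨅ (x : Fin n → Set.Icc a b)
    (_ : (μ : Measure (Set.Icc a b)) = (n : ℝ≥0∞)⁻¹ • ∑ i, Measure.dirac (x i)),
    (n : ℝ≥0∞) ^ 2 * pointCompliance a b f (Set.range x)

/-- A probability measure on `[a, b]`, seen as a measure on `ℝ`. -/
noncomputable def toReal {a b : ℝ} (μ : ProbabilityMeasure (Set.Icc a b)) : Measure ℝ :=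
  (μ : Measure (Set.Icc a b)).map Subtype.val

/-- `F(μ) = (1/12) ∫_J f² / μ_a²`, where `μ_a` is the density of the absolutely continuous part of
`μ`. In `[0, +∞]` one has `t / 0 = +∞` for `t ≠ 0` and `0 / 0 = 0`, so that the integrand is `0`
where `f = 0`. -/
noncomputable def limitFunctional (a b : ℝ) (f : ℝ → ℝ)
    (μ : ProbabilityMeasure (Set.Icc a b)) : ℝ≥0∞ :=
  (1 / 12) * ∫⁻ x in Set.Icc a b, ENNReal.ofReal (f x ^ 2) / ((toReal μ).rnDeriv volume x) ^ 2

end DirichletPoints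

/-!
Removing the points of `Σ` decouples the Dirichlet problem, so the compliance is a sum over the gaps
of `Σ`, and a gap of length `ℓ` on which `f` is nearly a constant `c` contributes `c² ℓ³ / 12`.
On a cell of length `h` that holds `N` points, convexity of the cube makes equal gaps the cheapest:
`n²` times the contribution is at least about `(c² / 12) h / (N / (n h))²`, which is `f² / (12 μ²)`
integrated over the cell.

For the lower bound, the division points of a uniform partition are added to `Σ`. This only
decreases the compliance and does not change the asymptotic number of points; refining the
partition, Lebesgue differentiation and Fatou's lemma turn the sum over the cells into `F(μ)`.
For the upper bound, each cell receives equidistributed points in proportion to its mass. This is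
enough when the density of `μ` is bounded below, and mixing `μ` with the uniform measure reduces
the general case to that one. Both ways of counting the points lie between two functionals for
which these bounds are proved, so they have the same limit.

With `t = |f|^(2/3)` and `C = ∫ t`, Young's inequality `t³ / ρ² + 2 C³ ρ ≥ 3 C² t`, with equality
only for `C ρ = t`, identifies the minimizer.
-/

namespace DirichletPoints

section LTwo

variable {α : Type*} [MeasurableSpace α] {μ : Measure α} {h k : α → ℝ}

theorem eLpNorm_two_eq_ofReal_sqrt (hh : MemLp h 2 μ) :
    eLpNorm h 2 μ = ENNReal.ofReal (√(∫ x, h x ^ 2 ∂μ)) := by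
  rw [hh.eLpNorm_eq_integral_rpow_norm two_ne_zero ENNReal.ofNat_ne_top, Real.sqrt_eq_rpow]
  simp

theorem abs_integral_mul_le_sqrt_mul_sqrt (hh : MemLp h 2 μ) (hk : MemLp k 2 μ) :
    |∫ x, h x * k x ∂μ| ≤ √(∫ x, h x ^ 2 ∂μ) * √(∫ x, k x ^ 2 ∂μ) := by
  refine abs_integral_le_integral_abs.trans ?_
  have := integral_mul_norm_le_Lp_mul_Lq (μ := μ) (f := h) (g := k) Real.HolderConjugate.two_two
    (by simpa using hh) (by simpa using hk)
  simpa [abs_mul, Real.sqrt_eq_rpow] using this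

theorem integral_mul_sq_le (hh : MemLp h 2 μ) (hk : MemLp k 2 μ) :
    (∫ x, h x * k x ∂μ) ^ 2 ≤ (∫ x, h x ^ 2 ∂μ) * ∫ x, k x ^ 2 ∂μ := by
  have hh0 : 0 ≤ ∫ x, h x ^ 2 ∂μ := integral_nonneg fun _ => sq_nonneg _
  have hk0 : 0 ≤ ∫ x, k x ^ 2 ∂μ := integral_nonneg fun _ => sq_nonneg _
  rw [← sq_abs, ← Real.sq_sqrt hh0, ← Real.sq_sqrt hk0, ← mul_pow]
  exact pow_le_pow_left₀ (abs_nonneg _) (abs_integral_mul_le_sqrt_mul_sqrt hh hk) 2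

theorem tendsto_integral_mul_of_tendsto_eLpNorm {k' : ℕ → α → ℝ} (hh : MemLp h 2 μ)
    (hk : MemLp k 2 μ) (hk' : ∀ n, MemLp (k' n) 2 μ)
    (hlim : Tendsto (fun n => eLpNorm (fun x => k x - k' n x) 2 μ) atTop (𝓝 0)) :
    Tendsto (fun n => ∫ x, h x * k' n x ∂μ) atTop (𝓝 (∫ x, h x * k x ∂μ)) := by
  have hsqrt : Tendsto (fun n => √(∫ x, (k x - k' n x) ^ 2 ∂μ)) atTop (𝓝 0) := by
    refine ((ENNReal.tendsto_toReal ENNReal.zero_ne_top).comp hlim).congr fun n => ?_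
    change (eLpNorm (k - k' n) 2 μ).toReal = _
    rw [eLpNorm_two_eq_ofReal_sqrt (hk.sub (hk' n)), ENNReal.toReal_ofReal (Real.sqrt_nonneg _)]
    rfl
  rw [tendsto_iff_dist_tendsto_zero]
  refine squeeze_zero (fun _ => dist_nonneg) (fun n => ?_)
    (by simpa using hsqrt.const_mul (√(∫ x, h x ^ 2 ∂μ)))
  have hhk : Integrable (fun x => h x * k x) μ := hh.integrable_mul hk
  have hhk' : Integrable (fun x => h x * k' n x) μ := hh.integrable_mul (hk' n)
  rw [dist_comm, Real.dist_eq, ← integral_sub hhk hhk']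
  simpa [mul_sub] using abs_integral_mul_le_sqrt_mul_sqrt hh (hk.sub (hk' n))

end LTwo

section TestFunction

variable {U V : Set ℝ} {φ ψ : ℝ → ℝ}

theorem IsTestFunction.memLp (hφ : IsTestFunction U φ) (μ : Measure ℝ)
    [IsFiniteMeasureOnCompacts μ] : MemLp φ 2 μ :=
  hφ.1.continuous.memLp_of_hasCompactSupport hφ.2.1

theorem IsTestFunction.memLp_deriv (hφ : IsTestFunction U φ) (μ : Measure ℝ)
    [IsFiniteMeasureOnCompacts μ] : MemLp (deriv φ) 2 μ :=
  (contDiff_infty_iff_deriv.1 hφ.1).2.continuous.memLp_of_hasCompactSupport hφ.2.1.deriv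

theorem IsTestFunction.mono (hφ : IsTestFunction U φ) (hUV : U ⊆ V) : IsTestFunction V φ :=
  ⟨hφ.1, hφ.2.1, hφ.2.2.trans hUV⟩

theorem isTestFunction_zero (U : Set ℝ) : IsTestFunction U 0 :=
  ⟨contDiff_const, HasCompactSupport.zero, by simp [tsupport]⟩

theorem IsTestFunction.add (hφ : IsTestFunction U φ) (hψ : IsTestFunction U ψ) :
    IsTestFunction U (φ + ψ) :=
  ⟨hφ.1.add hψ.1, hφ.2.1.add hψ.2.1,
    (tsupport_add φ ψ).trans (Set.union_subset hφ.2.2 hψ.2.2)⟩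

theorem IsTestFunction.const_mul (c : ℝ) (hφ : IsTestFunction U φ) :
    IsTestFunction U (fun x => c * φ x) :=
  ⟨contDiff_const.mul hφ.1, hφ.2.1.mul_left,
    (closure_mono (Function.support_mul_subset_right _ φ)).trans hφ.2.2⟩

theorem IsTestFunction.eq_zero_of_notMem (hφ : IsTestFunction U φ) {x : ℝ} (hx : x ∉ U) :
    φ x = 0 :=
  image_eq_zero_of_notMem_tsupport fun h => hx (hφ.2.2 h)

theorem IsTestFunction.deriv_eq_zero_of_notMem (hφ : IsTestFunction U φ) {x : ℝ} (hx : x ∉ U) :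
    deriv φ x = 0 :=
  image_eq_zero_of_notMem_tsupport fun h => hx (hφ.2.2 (tsupport_deriv_subset h))

theorem IsTestFunction.indicator_eventuallyEq_zero {ι : Type*} {W : ι → Set ℝ}
    (hφ : IsTestFunction (⋃ i, W i) φ) (hW : ∀ i, IsOpen (W i))
    (hd : Pairwise (Function.onFun Disjoint W)) {i : ι} {x : ℝ} (hx : x ∉ W i) :
    (W i).indicator φ =ᶠ[𝓝 x] 0 := by
  by_cases hxφ : x ∈ tsupport φ
  · obtain ⟨j, hxj⟩ := Set.mem_iUnion.1 (hφ.2.2 hxφ)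
    have hij : Disjoint (W i) (W j) := hd fun h => hx (h ▸ hxj)
    filter_upwards [(hW j).mem_nhds hxj] with y hy
    exact Set.indicator_of_notMem (hij.notMem_of_mem_right hy) φ
  · filter_upwards [notMem_tsupport_iff_eventuallyEq.1 hxφ] with y hy
    exact Set.indicator_apply_eq_zero.2 fun _ => hy

theorem IsTestFunction.indicator {ι : Type*} {W : ι → Set ℝ}
    (hφ : IsTestFunction (⋃ i, W i) φ) (hW : ∀ i, IsOpen (W i))
    (hd : Pairwise (Function.onFun Disjoint W)) (i : ι) :
    IsTestFunction (W i) ((W i).indicator φ) := by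
  have hsupp : tsupport ((W i).indicator φ) ⊆ W i := fun x hx => by
    by_contra hxi
    exact notMem_tsupport_iff_eventuallyEq.2 (hφ.indicator_eventuallyEq_zero hW hd hxi) hx
  refine ⟨contDiff_iff_contDiffAt.2 fun x => ?_, ?_, hsupp⟩
  · by_cases hxi : x ∈ W i
    · exact hφ.1.contDiffAt.congr_of_eventuallyEq
        ((Set.eqOn_indicator (s := W i)).eventuallyEq_of_mem ((hW i).mem_nhds hxi))
    · exact contDiffAt_const.congr_of_eventuallyEq (hφ.indicator_eventuallyEq_zero hW hd hxi)
  · exact hφ.2.1.of_isClosed_subset (isClosed_tsupport _)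
      (closure_mono (Set.support_indicator.subset.trans Set.inter_subset_right))

theorem exists_isTestFunction_eLpNorm_sub_le (hU : IsOpen U) (hU' : volume U ≠ ∞) {g : ℝ → ℝ}
    (hg : MemLp g 2 (volume.restrict U)) {ε : ℝ} (hε : 0 < ε) :
    ∃ φ, IsTestFunction U φ ∧
      eLpNorm (fun x => g x - φ x) 2 (volume.restrict U) ≤ ENNReal.ofReal ε := by
  obtain ⟨δ, hδ, hgδ⟩ := hg.eLpNorm_indicator_le one_le_two ENNReal.ofNat_ne_top (half_pos hε)
  obtain ⟨h, -, hhs, hgh⟩ := hg.exist_eLpNorm_sub_le ENNReal.ofNat_ne_top one_le_two (half_pos hε)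
  obtain ⟨K, hKU, hK, hKδ⟩ := hU.measurableSet.exists_isCompact_sdiff_lt hU'
    (ENNReal.ofReal_pos.2 hδ).ne'
  obtain ⟨L, hL, hKL, hLU⟩ := exists_compact_between hK hU hKU
  obtain ⟨χ, hχK, hχL, hχ⟩ := exists_contMDiffMap_one_nhds_of_subset_interior
    (n := (⊤ : ℕ∞)) (modelWithCornersSelf ℝ ℝ) hK.isClosed hKL
  have hχs : ContDiff ℝ ((⊤ : ℕ∞) : WithTop ℕ∞) χ := χ.contMDiff.contDiff
  have hχh : tsupport (fun x => χ x * h x) ⊆ L :=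
    closure_minimal (fun x hx => by_contra fun hxL => hx (by simp [hχL x hxL])) hL.isClosed
  have hnear : eLpNorm (fun x => (1 - χ x) * g x) 2 (volume.restrict U)
      ≤ ENNReal.ofReal (ε / 2) := by
    have hKm : MeasurableSet Kᶜ := hK.measurableSet.compl
    refine (eLpNorm_mono fun x => ?_).trans (hgδ Kᶜ hKm ?_)
    · by_cases hx : x ∈ K
      · simp [hχK.self_of_nhdsSet x hx]
      · rw [Set.indicator_of_mem hx, norm_mul, Real.norm_of_nonneg (by linarith [(hχ x).2])]
        exact mul_le_of_le_one_left (norm_nonneg _) (by linarith [(hχ x).1])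
    · rw [Measure.restrict_apply hKm, Set.inter_comm, ← Set.sdiff_eq]
      exact hKδ.le
  have hfar : eLpNorm (fun x => χ x * (g - h) x) 2 (volume.restrict U)
      ≤ ENNReal.ofReal (ε / 2) := by
    refine (eLpNorm_mono fun x => ?_).trans hgh
    rw [norm_mul, Real.norm_of_nonneg (hχ x).1]
    exact mul_le_of_le_one_left (norm_nonneg _) (hχ x).2
  refine ⟨fun x => χ x * h x,
    ⟨hχs.mul hhs, hL.of_isClosed_subset (isClosed_tsupport _) hχh, hχh.trans hLU⟩, ?_⟩
  have hsplit : (fun x => g x - χ x * h x)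
      = (fun x => (1 - χ x) * g x) + fun x => χ x * (g - h) x := by
    ext x; simp only [Pi.add_apply, Pi.sub_apply]; ring
  rw [hsplit, ← add_halves ε, ENNReal.ofReal_add (half_pos hε).le (half_pos hε).le]
  refine (eLpNorm_add_le ?_ ?_ one_le_two).trans (add_le_add hnear hfar)
  · exact (continuous_const.sub hχs.continuous).aestronglyMeasurable.mul hg.1
  · exact hχs.continuous.aestronglyMeasurable.mul (hg.1.sub hhs.continuous.aestronglyMeasurable)

theorem exists_seq_isTestFunction_tendsto (hU : IsOpen U) (hU' : volume U ≠ ∞) {g : ℝ → ℝ}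
    (hg : MemLp g 2 (volume.restrict U)) :
    ∃ φ : ℕ → ℝ → ℝ, (∀ k, IsTestFunction U (φ k)) ∧
      Tendsto (fun k => eLpNorm (fun x => g x - φ k x) 2 (volume.restrict U)) atTop (𝓝 0) := by
  choose φ hφ hφg using fun k : ℕ =>
    exists_isTestFunction_eLpNorm_sub_le hU hU' hg (Nat.one_div_pos_of_nat (α := ℝ) (n := k))
  refine ⟨φ, hφ, tendsto_of_tendsto_of_tendsto_of_le_of_le tendsto_const_nhds ?_
    (fun _ => zero_le) hφg⟩
  simpa using ENNReal.tendsto_ofReal tendsto_one_div_add_atTop_nhds_zero_nat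

end TestFunction

section Interval

variable {p q : ℝ}

theorem IsTestFunction.exists_Icc (hpq : p < q) {ψ : ℝ → ℝ} (hψ : IsTestFunction (Set.Ioo p q) ψ) :
    ∃ p' q', p < p' ∧ q' < q ∧ tsupport ψ ⊆ Set.Icc p' q' := by
  rcases (tsupport ψ).eq_empty_or_nonempty with h | h
  · exact ⟨(p + q) / 2, (p + q) / 2, by linarith, by linarith, by simp [h]⟩
  · have hK : IsCompact (tsupport ψ) := hψ.2.1
    have hmin := hψ.2.2 (hK.sInf_mem h)
    have hmax := hψ.2.2 (hK.sSup_mem h)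
    exact ⟨_, _, hmin.1, hmax.2,
      fun x hx => ⟨csInf_le hK.bddBelow hx, le_csSup hK.bddAbove hx⟩⟩

theorem IsTestFunction.hasDerivAt_primitive {U : Set ℝ} {ψ : ℝ → ℝ} (hψ : IsTestFunction U ψ)
    (x : ℝ) : HasDerivAt (fun x => ∫ y in p..x, ψ y) (ψ x) x :=
  hψ.1.continuous.integral_hasStrictDerivAt p x |>.hasDerivAt

theorem IsTestFunction.primitive (hpq : p < q) {ψ : ℝ → ℝ} (hψ : IsTestFunction (Set.Ioo p q) ψ)
    (hψ0 : ∫ x in p..q, ψ x = 0) : IsTestFunction (Set.Ioo p q) (fun x => ∫ y in p..x, ψ y) := by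
  obtain ⟨p', q', hp, hq, hsupp⟩ := hψ.exists_Icc hpq
  have hzero : ∀ y ∉ Set.Icc p' q', ψ y = 0 := fun y hy =>
    image_eq_zero_of_notMem_tsupport fun h => hy (hsupp h)
  have hsub : tsupport (fun x => ∫ y in p..x, ψ y) ⊆ Set.Icc p' q' := by
    refine closure_minimal (fun x hx => by_contra fun hxI => hx ?_) isClosed_Icc
    rcases lt_or_ge x p' with hxp | hxp
    · refine intervalIntegral.integral_zero_ae (ae_of_all _ fun y hy => hzero y fun h => ?_)
      exact (hy.2.trans_lt (max_lt hp hxp)).not_ge h.1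
    · have hxq : q' < x := not_le.1 fun h => hxI ⟨hxp, h⟩
      have hint : ∀ r s, IntervalIntegrable ψ volume r s :=
        hψ.1.continuous.intervalIntegrable
      change ∫ y in p..x, ψ y = 0
      rw [← intervalIntegral.integral_add_adjacent_intervals (hint p q) (hint q x), hψ0, zero_add]
      refine intervalIntegral.integral_zero_ae (ae_of_all _ fun y hy => hzero y fun h => ?_)
      exact ((lt_min hq hxq).trans hy.1).not_ge h.2
  refine ⟨contDiff_infty_iff_deriv.2 ⟨fun x => (hψ.hasDerivAt_primitive x).differentiableAt, ?_⟩,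
    isCompact_Icc.of_isClosed_subset (isClosed_tsupport _) hsub,
    hsub.trans (Set.Icc_subset_Ioo hp hq)⟩
  rw [show deriv (fun x => ∫ y in p..x, ψ y) = ψ from
    funext fun x => (hψ.hasDerivAt_primitive x).deriv]
  exact hψ.1

theorem exists_isTestFunction_integral_eq_one (hpq : p < q) :
    ∃ κ, IsTestFunction (Set.Ioo p q) κ ∧ ∫ x in p..q, κ x = 1 := by
  let κ : ContDiffBump ((p + q) / 2) := ⟨(q - p) / 8, (q - p) / 4, by linarith, by linarith⟩
  have hsupp : tsupport (κ.normed volume) ⊆ Set.Ioo p q := by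
    rw [κ.tsupport_normed_eq, Real.closedBall_eq_Icc]
    exact Set.Icc_subset_Ioo (by simp only [κ]; linarith) (by simp only [κ]; linarith)
  refine ⟨κ.normed volume, ⟨κ.contDiff_normed, κ.hasCompactSupport_normed, hsupp⟩, ?_⟩
  rw [intervalIntegral.integral_eq_integral_of_support_subset, κ.integral_normed]
  exact (subset_tsupport _).trans (hsupp.trans Set.Ioo_subset_Ioc_self)

theorem intervalIntegrable_of_memLp_Ioo (hpq : p ≤ q) {g : ℝ → ℝ}
    (hg : MemLp g 2 (volume.restrict (Set.Ioo p q))) : IntervalIntegrable g volume p q :=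
  (intervalIntegrable_iff_integrableOn_Ioo_of_le hpq).2 (hg.integrable one_le_two)

theorem eLpNorm_primitive_le {g : ℝ → ℝ}
    (hg : AEStronglyMeasurable g (volume.restrict (Set.Ioo p q))) :
    eLpNorm (fun x => ∫ y in p..x, g y) 2 (volume.restrict (Set.Ioo p q))
      ≤ eLpNorm g 2 (volume.restrict (Set.Ioo p q)) * ENNReal.ofReal (q - p) := by
  have hvol : volume.restrict (Set.Ioo p q) Set.univ = ENNReal.ofReal (q - p) := by simp
  have hbound : ∀ x ∈ Set.Ioo p q, ‖∫ y in p..x, g y‖ₑ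
      ≤ eLpNorm g 2 (volume.restrict (Set.Ioo p q)) * ENNReal.ofReal (q - p) ^ (1 / 2 : ℝ) := by
    intro x hx
    calc ‖∫ y in p..x, g y‖ₑ ≤ ∫⁻ y in Set.Ioc p x, ‖g y‖ₑ := by
          rw [intervalIntegral.integral_of_le hx.1.le]
          exact enorm_integral_le_lintegral_enorm _
      _ ≤ ∫⁻ y in Set.Ioo p q, ‖g y‖ₑ :=
          lintegral_mono_set (Set.Ioc_subset_Ioo_right hx.2)
      _ = eLpNorm g 1 (volume.restrict (Set.Ioo p q)) := eLpNorm_one_eq_lintegral_enorm.symm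
      _ ≤ _ := by
          refine (eLpNorm_le_eLpNorm_mul_rpow_measure_univ one_le_two hg).trans_eq ?_
          rw [hvol]
          norm_num
  refine (eLpNorm_le_of_ae_enorm_bound
    ((ae_restrict_mem measurableSet_Ioo).mono hbound)).trans_eq ?_
  rw [hvol, smul_eq_mul, mul_assoc, ← ENNReal.rpow_add_of_nonneg] <;> norm_num

theorem continuousOn_primitive (hpq : p ≤ q) {g : ℝ → ℝ} (hg : IntervalIntegrable g volume p q) :
    ContinuousOn (fun x => ∫ y in p..x, g y) (Set.Icc p q) := by
  have := intervalIntegral.continuousOn_primitive_interval (μ := volume) (f := g) (a := p) (b := q)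
    (by rw [Set.uIcc_of_le hpq, integrableOn_Icc_iff_integrableOn_Ioc]; exact hg.1)
  rwa [Set.uIcc_of_le hpq] at this

theorem memLp_of_continuousOn_Icc {g : ℝ → ℝ} (hg : ContinuousOn g (Set.Icc p q)) :
    MemLp g 2 (volume.restrict (Set.Ioo p q)) := by
  obtain ⟨C, hC⟩ := isCompact_Icc.exists_bound_of_continuousOn hg
  refine MemLp.of_bound
    ((hg.mono Set.Ioo_subset_Icc_self).aestronglyMeasurable measurableSet_Ioo) C ?_
  exact (ae_restrict_mem measurableSet_Ioo).mono fun x hx => hC x (Set.Ioo_subset_Icc_self hx)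

theorem exists_seq_isTestFunction_integral_eq_zero (hpq : p < q) {g : ℝ → ℝ}
    (hg : MemLp g 2 (volume.restrict (Set.Ioo p q))) (hg0 : ∫ x in p..q, g x = 0) :
    ∃ ψ : ℕ → ℝ → ℝ, (∀ k, IsTestFunction (Set.Ioo p q) (ψ k) ∧ ∫ x in p..q, ψ k x = 0) ∧
      Tendsto (fun k => eLpNorm (fun x => g x - ψ k x) 2 (volume.restrict (Set.Ioo p q)))
        atTop (𝓝 0) := by
  obtain ⟨κ, hκ, hκ1⟩ := exists_isTestFunction_integral_eq_one hpq
  obtain ⟨ψ, hψ, hgψ⟩ := exists_seq_isTestFunction_tendsto isOpen_Ioo (by simp) hg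
  have hκL := hκ.memLp (volume.restrict (Set.Ioo p q))
  have hψL := fun k => (hψ k).memLp (volume.restrict (Set.Ioo p q))
  have hii : ∀ {h}, MemLp h 2 (volume.restrict (Set.Ioo p q)) → IntervalIntegrable h volume p q :=
    fun hh => intervalIntegrable_of_memLp_Ioo hpq.le hh
  have hmean : Tendsto (fun k => ∫ x in p..q, ψ k x) atTop (𝓝 0) := by
    have := tendsto_integral_mul_of_tendsto_eLpNorm (memLp_const (1 : ℝ)) hg hψL hgψ
    simpa only [one_mul, ← integral_Ioc_eq_integral_Ioo, ← intervalIntegral.integral_of_le hpq.le,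
      hg0] using this
  refine ⟨fun k x => ψ k x + -(∫ y in p..q, ψ k y) * κ x,
    fun k => ⟨(hψ k).add (hκ.const_mul _), ?_⟩, ?_⟩
  · rw [intervalIntegral.integral_add (hii (hψL k)) ((hii hκL).const_mul _),
      intervalIntegral.integral_const_mul, hκ1]
    ring
  have hlim : Tendsto (fun k => eLpNorm (fun x => g x - ψ k x) 2 (volume.restrict (Set.Ioo p q))
      + ‖∫ y in p..q, ψ k y‖ₑ * eLpNorm κ 2 (volume.restrict (Set.Ioo p q))) atTop (𝓝 0) := by
    have hmean' := hmean.enorm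
    rw [enorm_zero] at hmean'
    simpa using hgψ.add (ENNReal.Tendsto.mul_const hmean' (Or.inr hκL.2.ne))
  refine tendsto_of_tendsto_of_tendsto_of_le_of_le tendsto_const_nhds hlim (fun _ => zero_le)
    fun k => ?_
  have hsplit : (fun x => g x - (ψ k x + -(∫ y in p..q, ψ k y) * κ x))
      = (fun x => g x - ψ k x) + (∫ y in p..q, ψ k y) • κ := by
    ext x; simp only [Pi.add_apply, Pi.smul_apply, smul_eq_mul]; ring
  simp only [hsplit]
  refine (eLpNorm_add_le (hg.sub (hψL k)).1 (hκL.1.const_smul _) one_le_two).trans ?_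
  exact add_le_add_right (eLpNorm_const_smul _ _ _ _).le _

theorem memH10_primitive (hpq : p < q) {g : ℝ → ℝ}
    (hg : MemLp g 2 (volume.restrict (Set.Ioo p q))) (hg0 : ∫ x in p..q, g x = 0) :
    MemH10 (Set.Ioo p q) (fun x => ∫ y in p..x, g y) g := by
  obtain ⟨ψ, hψ, hgψ⟩ := exists_seq_isTestFunction_integral_eq_zero hpq hg hg0
  have hgi := intervalIntegrable_of_memLp_Ioo hpq.le hg
  refine ⟨memLp_of_continuousOn_Icc (continuousOn_primitive hpq.le hgi), hg,
    fun k x => ∫ y in p..x, ψ k y, fun k => (hψ k).1.primitive hpq (hψ k).2, ?_, ?_⟩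
  · have hlim := ENNReal.Tendsto.mul_const (b := ENNReal.ofReal (q - p)) hgψ
      (Or.inr ENNReal.ofReal_ne_top)
    rw [zero_mul] at hlim
    refine tendsto_of_tendsto_of_tendsto_of_le_of_le tendsto_const_nhds hlim (fun _ => zero_le)
      fun k => (eLpNorm_congr_ae ?_).trans_le
        (eLpNorm_primitive_le (hg.sub ((hψ k).1.memLp _)).1)
    filter_upwards [ae_restrict_mem measurableSet_Ioo] with x hx
    refine (intervalIntegral.integral_sub (hgi.mono_set ?_)
      ((hψ k).1.1.continuous.intervalIntegrable _ _)).symm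
    rw [Set.uIcc_of_le hx.1.le, Set.uIcc_of_le hpq.le]
    exact Set.Icc_subset_Icc_right hx.2.le
  · simpa only [((hψ _).1.hasDerivAt_primitive _).deriv] using hgψ

end Interval

section WeakSolution

variable {U V : Set ℝ} {f u u' v v' φ : ℝ → ℝ}

theorem isWeakSolution_of_isTestFunction (hf : MemLp f 2 (volume.restrict U)) (hu : MemH10 U u u')
    (h : ∀ φ, IsTestFunction U φ → ∫ x in U, u' x * deriv φ x = ∫ x in U, f x * φ x) :
    IsWeakSolution U f u u' := by
  refine ⟨hu, fun v v' ⟨hv, hv', φ, hφ, hvφ, hv'φ⟩ => ?_⟩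
  refine tendsto_nhds_unique
    (tendsto_integral_mul_of_tendsto_eLpNorm hu.2.1 hv' (fun n => (hφ n).memLp_deriv _) hv'φ) ?_
  simp only [h _ (hφ _)]
  exact tendsto_integral_mul_of_tendsto_eLpNorm hf hv (fun n => (hφ n).memLp _) hvφ

theorem IsTestFunction.memH10 (hφ : IsTestFunction U φ) : MemH10 U φ (deriv φ) :=
  ⟨hφ.memLp _, hφ.memLp_deriv _, fun _ => φ, fun _ => hφ, by simp, by simp⟩

theorem memH10_zero (U : Set ℝ) : MemH10 U 0 0 := by
  simpa [Pi.zero_def] using! (isTestFunction_zero U).memH10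

theorem MemH10.add (hu : MemH10 U u u') (hv : MemH10 U v v') :
    MemH10 U (u + v) (u' + v') := by
  obtain ⟨hu1, hu2, φ, hφ, hφ1, hφ2⟩ := hu
  obtain ⟨hv1, hv2, ψ, hψ, hψ1, hψ2⟩ := hv
  refine ⟨hu1.add hv1, hu2.add hv2, fun k => φ k + ψ k, fun k => (hφ k).add (hψ k), ?_, ?_⟩
  · refine tendsto_of_tendsto_of_tendsto_of_le_of_le tendsto_const_nhds
      (by simpa using hφ1.add hψ1) (fun _ => zero_le) fun k => ?_
    refine le_trans (le_of_eq ?_) (eLpNorm_add_le (hu1.sub ((hφ k).memLp _)).1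
      (hv1.sub ((hψ k).memLp _)).1 one_le_two)
    exact congrArg (eLpNorm · _ _) (funext fun x => add_sub_add_comm (u x) (v x) (φ k x) (ψ k x))
  · refine tendsto_of_tendsto_of_tendsto_of_le_of_le tendsto_const_nhds
      (by simpa using hφ2.add hψ2) (fun _ => zero_le) fun k => ?_
    refine le_trans (le_of_eq ?_) (eLpNorm_add_le (hu2.sub ((hφ k).memLp_deriv _)).1
      (hv2.sub ((hψ k).memLp_deriv _)).1 one_le_two)
    congr 1
    ext x
    rw [deriv_add ((hφ k).1.differentiable (by simp) x) ((hψ k).1.differentiable (by simp) x)]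
    exact add_sub_add_comm ..

theorem MemH10.sum {ι : Type*} (s : Finset ι) {u u' : ι → ℝ → ℝ}
    (h : ∀ i ∈ s, MemH10 U (u i) (u' i)) : MemH10 U (∑ i ∈ s, u i) (∑ i ∈ s, u' i) := by
  classical
  induction s using Finset.induction_on with
  | empty => exact memH10_zero U
  | insert i s hi ih =>
    simp only [Finset.sum_insert hi]
    exact (h i (Finset.mem_insert_self i s)).add
      (ih fun j hj => h j (Finset.mem_insert_of_mem hj))

theorem MemH10.indicator (hU : MeasurableSet U) (hUV : U ⊆ V) (hu : MemH10 U u u') :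
    MemH10 V (U.indicator u) (U.indicator u') := by
  obtain ⟨hu1, hu2, φ, hφ, hφ1, hφ2⟩ := hu
  have hres : (volume.restrict V).restrict U = volume.restrict U :=
    Measure.restrict_restrict_of_subset hUV
  have hnorm : ∀ w g : ℝ → ℝ, (∀ x ∉ U, g x = 0) →
      eLpNorm (fun x => U.indicator w x - g x) 2 (volume.restrict V)
        = eLpNorm (fun x => w x - g x) 2 (volume.restrict U) := by
    intro w g hg
    rw [← hres, ← eLpNorm_indicator_eq_eLpNorm_restrict hU]
    congr 1
    ext x
    by_cases hx : x ∈ U <;> simp [hx, hg]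
  refine ⟨(memLp_indicator_iff_restrict hU).2 (hres.symm ▸ hu1),
    (memLp_indicator_iff_restrict hU).2 (hres.symm ▸ hu2), φ, fun k => (hφ k).mono hUV, ?_, ?_⟩
  · simpa only [hnorm _ _ fun _ => (hφ _).eq_zero_of_notMem] using hφ1
  · simpa only [hnorm _ _ fun _ => (hφ _).deriv_eq_zero_of_notMem] using hφ2

theorem sum_indicator_apply_of_mem {ι : Type*} [Fintype ι] {W : ι → Set ℝ} {u : ι → ℝ → ℝ}
    (hd : Pairwise (Function.onFun Disjoint W)) {i : ι} {x : ℝ} (hx : x ∈ W i) :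
    (∑ j, (W j).indicator (u j)) x = u i x := by
  rw [Finset.sum_apply, Finset.sum_eq_single i, Set.indicator_of_mem hx]
  · exact fun j _ hj => Set.indicator_of_notMem ((hd hj).notMem_of_mem_right hx) _
  · simp

theorem isWeakSolution_iUnion {ι : Type*} [Fintype ι] {W : ι → Set ℝ} {u u' : ι → ℝ → ℝ}
    (hW : ∀ i, IsOpen (W i)) (hd : Pairwise (Function.onFun Disjoint W))
    (hf : MemLp f 2 (volume.restrict (⋃ i, W i))) (hu : ∀ i, IsWeakSolution (W i) f (u i) (u' i)) :
    IsWeakSolution (⋃ i, W i) f (∑ i, (W i).indicator (u i)) (∑ i, (W i).indicator (u' i)) := by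
  have hWm : ∀ i, MeasurableSet (W i) := fun i => (hW i).measurableSet
  have hmem : MemH10 (⋃ i, W i) (∑ i, (W i).indicator (u i)) (∑ i, (W i).indicator (u' i)) :=
    MemH10.sum _ fun i _ => (hu i).1.indicator (hWm i) (Set.subset_iUnion W i)
  refine isWeakSolution_of_isTestFunction hf hmem fun φ hφ => ?_
  have hint : IntegrableOn (fun x => (∑ i, (W i).indicator (u' i)) x * deriv φ x) (⋃ i, W i) :=
    hmem.2.1.integrable_mul (hφ.memLp_deriv _)
  have hint' : IntegrableOn (fun x => f x * φ x) (⋃ i, W i) := hf.integrable_mul (hφ.memLp _)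
  rw [integral_iUnion_fintype hWm hd fun i => hint.mono_set (Set.subset_iUnion W i),
    integral_iUnion_fintype hWm hd fun i => hint'.mono_set (Set.subset_iUnion W i)]
  refine Finset.sum_congr rfl fun i _ => ?_
  have hφi := hφ.indicator hW hd i
  calc ∫ x in W i, (∑ j, (W j).indicator (u' j)) x * deriv φ x
      = ∫ x in W i, u' i x * deriv ((W i).indicator φ) x := by
        refine setIntegral_congr_fun (hWm i) fun x hx => ?_
        rw [((Set.eqOn_indicator (s := W i)).eventuallyEq_of_mem ((hW i).mem_nhds hx)).deriv_eq]
        rw [sum_indicator_apply_of_mem hd hx]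
    _ = ∫ x in W i, f x * (W i).indicator φ x := (hu i).2 _ _ hφi.memH10
    _ = ∫ x in W i, f x * φ x :=
        setIntegral_congr_fun (hWm i) fun x hx => by rw [Set.indicator_of_mem hx]

theorem compliance_iUnion {ι : Type*} [Fintype ι] {W : ι → Set ℝ}
    (hW : ∀ i, IsOpen (W i)) (hd : Pairwise (Function.onFun Disjoint W))
    (hf : MemLp f 2 (volume.restrict (⋃ i, W i)))
    (hsol : ∀ i, ∃ u u', IsWeakSolution (W i) f u u') :
    compliance (⋃ i, W i) f = ∑ i, compliance (W i) f := by
  choose u u' hu using hsol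
  have hsum := isWeakSolution_iUnion hW hd hf hu
  have hint : IntegrableOn (fun x => f x * (∑ i, (W i).indicator (u i)) x) (⋃ i, W i) :=
    hf.integrable_mul hsum.1.1
  have hnonneg : ∀ i, 0 ≤ ∫ x in W i, f x * u i x := fun i =>
    (hu i).integral_eq_energy ▸ integral_nonneg fun _ => sq_nonneg _
  rw [hsum.compliance_eq, integral_iUnion_fintype (fun i => (hW i).measurableSet) hd fun i =>
    hint.mono_set (Set.subset_iUnion W i)]
  simp only [(hu _).compliance_eq]
  rw [← ENNReal.ofReal_sum_of_nonneg fun i _ => hnonneg i]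
  refine congrArg _ (Finset.sum_congr rfl fun i _ => ?_)
  refine setIntegral_congr_fun (hW i).measurableSet fun x hx => ?_
  rw [sum_indicator_apply_of_mem hd hx]

theorem MemH10.mono (hu : MemH10 U u u') (hUV : U ⊆ V) (hUV' : U =ᵐ[volume] V) :
    MemH10 V u u' := by
  rw [MemH10, ← Measure.restrict_congr_set hUV']
  obtain ⟨hu1, hu2, φ, hφ, hφ1, hφ2⟩ := hu
  exact ⟨hu1, hu2, φ, fun k => (hφ k).mono hUV, hφ1, hφ2⟩

theorem compliance_mono (hUV : U ⊆ V) (hUV' : U =ᵐ[volume] V) (hv : IsWeakSolution U f v v') :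
    compliance U f ≤ compliance V f := by
  refine le_iInf fun u => le_iInf fun u' => le_iInf fun hu => ?_
  rw [hv.compliance_eq, hu.integral_eq_energy, ← Measure.restrict_congr_set hUV',
    hv.integral_eq_energy]
  refine ENNReal.ofReal_le_ofReal (not_lt.1 fun hlt => ?_)
  have hpair : ∫ x in U, u' x * v' x = ∫ x in U, v' x ^ 2 := by
    rw [Measure.restrict_congr_set hUV', hu.2 v v' (hv.1.mono hUV hUV'),
      ← Measure.restrict_congr_set hUV', hv.integral_eq_energy]
  have hu' : MemLp u' 2 (volume.restrict U) := Measure.restrict_congr_set hUV' ▸ hu.1.2.1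
  have hCS := integral_mul_sq_le hu' hv.1.2.1
  have hpos : 0 ≤ ∫ x in U, u' x ^ 2 := integral_nonneg fun _ => sq_nonneg _
  rw [hpair] at hCS
  nlinarith

end WeakSolution

section Gap

variable {f : ℝ → ℝ} {p q : ℝ}

/-- The mean over `(p, q)` of the primitive of `f` vanishing at `p`. -/
noncomputable def gapMean (f : ℝ → ℝ) (p q : ℝ) : ℝ :=
  (q - p)⁻¹ * ∫ x in p..q, ∫ y in p..x, f y

/-- The derivative on `(p, q)` of the solution of `-u'' = f`, `u(p) = u(q) = 0`. -/
noncomputable def gapSlope (f : ℝ → ℝ) (p q x : ℝ) : ℝ :=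
  gapMean f p q - ∫ y in p..x, f y

/-- The energy `∫ (u')²` of the solution of `-u'' = f`, `u(p) = u(q) = 0`, that is, the compliance
of the gap `(p, q)`. -/
noncomputable def gapEnergy (f : ℝ → ℝ) (p q : ℝ) : ℝ :=
  ∫ x in p..q, gapSlope f p q x ^ 2

theorem gapEnergy_nonneg (hpq : p ≤ q) : 0 ≤ gapEnergy f p q :=
  intervalIntegral.integral_nonneg hpq fun _ _ => sq_nonneg _

theorem continuousOn_gapSlope (hpq : p ≤ q) (hf : IntervalIntegrable f volume p q) :
    ContinuousOn (gapSlope f p q) (Set.Icc p q) :=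
  continuousOn_const.sub (continuousOn_primitive hpq hf)

theorem integral_gapSlope (hpq : p < q) (hf : IntervalIntegrable f volume p q) :
    ∫ x in p..q, gapSlope f p q x = 0 := by
  have hne : q - p ≠ 0 := (sub_pos.2 hpq).ne'
  simp only [gapSlope, gapMean]
  rw [intervalIntegral.integral_sub (by simp)
    ((continuousOn_primitive hpq.le hf).intervalIntegrable_of_Icc hpq.le),
    intervalIntegral.integral_const, smul_eq_mul]
  field_simp
  ring

theorem integral_gapSlope_mul_deriv (hpq : p ≤ q) (hf : IntervalIntegrable f volume p q)
    {φ : ℝ → ℝ} (hφ : ContDiff ℝ 1 φ) (hp : φ p = 0) (hq : φ q = 0) :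
    ∫ x in p..q, gapSlope f p q x * deriv φ x = ∫ x in p..q, f x * φ x := by
  have hφ' : Continuous (deriv φ) := hφ.continuous_deriv le_rfl
  have hparts := (hf.absolutelyContinuousOnInterval_intervalIntegral (c := p) (by simp)
    ).integral_mul_deriv_eq_deriv_mul hφ.contDiffOn.absolutelyContinuousOnInterval
  have hderiv : ∫ x in p..q, deriv (fun x => ∫ y in p..x, f y) x * φ x
      = ∫ x in p..q, f x * φ x := by
    refine intervalIntegral.integral_congr_ae ?_
    filter_upwards [hf.ae_hasDerivAt_integral] with x hx hxpq
    rw [(hx (Set.uIoc_subset_uIcc hxpq) p (by simp)).deriv]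
  have hconst : ∫ x in p..q, deriv φ x = 0 := by
    rw [intervalIntegral.integral_deriv_eq_sub
      (fun x _ => (hφ.differentiable (by simp)) x) (hφ'.intervalIntegrable _ _), hp, hq, sub_zero]
  rw [hderiv, hp, hq] at hparts
  have hcont : ContinuousOn (fun x => (∫ y in p..x, f y) * deriv φ x) (Set.Icc p q) :=
    (continuousOn_primitive hpq hf).mul hφ'.continuousOn
  simp only [gapSlope, sub_mul]
  rw [intervalIntegral.integral_sub ((hφ'.intervalIntegrable _ _).const_mul _)
    (hcont.intervalIntegrable_of_Icc hpq), intervalIntegral.integral_const_mul, hconst, hparts]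
  ring

theorem isWeakSolution_primitive_gapSlope (hpq : p < q)
    (hf : MemLp f 2 (volume.restrict (Set.Ioo p q))) :
    IsWeakSolution (Set.Ioo p q) f (fun x => ∫ y in p..x, gapSlope f p q y) (gapSlope f p q) := by
  have hfi := intervalIntegrable_of_memLp_Ioo hpq.le hf
  have hslope := memLp_of_continuousOn_Icc (continuousOn_gapSlope hpq.le hfi)
  refine isWeakSolution_of_isTestFunction hf
    (memH10_primitive hpq hslope (integral_gapSlope hpq hfi)) fun φ hφ => ?_
  rw [← integral_Ioc_eq_integral_Ioo, ← integral_Ioc_eq_integral_Ioo,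
    ← intervalIntegral.integral_of_le hpq.le, ← intervalIntegral.integral_of_le hpq.le]
  exact integral_gapSlope_mul_deriv hpq.le hfi (hφ.1.of_le (by simp))
    (hφ.eq_zero_of_notMem (by simp)) (hφ.eq_zero_of_notMem (by simp))

theorem compliance_Ioo (hpq : p < q) (hf : MemLp f 2 (volume.restrict (Set.Ioo p q))) :
    compliance (Set.Ioo p q) f = ENNReal.ofReal (gapEnergy f p q) := by
  have hsol := isWeakSolution_primitive_gapSlope hpq hf
  rw [hsol.compliance_eq, hsol.integral_eq_energy, gapEnergy,
    intervalIntegral.integral_of_le hpq.le,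
    integral_Ioc_eq_integral_Ioo]

end Gap

section GapEstimates

variable {f g : ℝ → ℝ} {p q c θ : ℝ}

theorem sq_le_one_add_mul_sq_add (hθ : 0 < θ) (x y : ℝ) :
    x ^ 2 ≤ (1 + θ) * y ^ 2 + (1 + θ⁻¹) * (x - y) ^ 2 := by
  have hsq : (1 + θ) * y ^ 2 + (1 + θ⁻¹) * (x - y) ^ 2 - x ^ 2 = θ⁻¹ * (θ * y - (x - y)) ^ 2 := by
    field_simp
    ring
  linarith [mul_nonneg (inv_nonneg.2 hθ.le) (sq_nonneg (θ * y - (x - y)))]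

theorem integral_sq_le_one_add_mul_add (hpq : p ≤ q)
    (hf : MemLp f 2 (volume.restrict (Set.Ioo p q)))
    (hg : MemLp g 2 (volume.restrict (Set.Ioo p q))) (hθ : 0 < θ) :
    ∫ x in p..q, f x ^ 2
      ≤ (1 + θ) * (∫ x in p..q, g x ^ 2) + (1 + θ⁻¹) * ∫ x in p..q, (f x - g x) ^ 2 := by
  have hint : ∀ {h : ℝ → ℝ}, MemLp h 2 (volume.restrict (Set.Ioo p q)) →
      IntervalIntegrable (fun x => h x ^ 2) volume p q := fun hh =>
    (intervalIntegrable_iff_integrableOn_Ioo_of_le hpq).2 hh.integrable_sq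
  have hg2 := (hint hg).const_mul (1 + θ)
  have hfg2 : IntervalIntegrable (fun x => (1 + θ⁻¹) * (f x - g x) ^ 2) volume p q :=
    (hint (hf.sub hg)).const_mul _
  rw [← intervalIntegral.integral_const_mul, ← intervalIntegral.integral_const_mul,
    ← intervalIntegral.integral_add hg2 hfg2]
  exact intervalIntegral.integral_mono_on hpq (hint hf) (hg2.add hfg2)
    fun x _ => sq_le_one_add_mul_sq_add hθ _ _

theorem integral_sq_le_of_const (hpq : p ≤ q) (hf : MemLp f 2 (volume.restrict (Set.Ioo p q)))
    (c : ℝ) (hθ : 0 < θ) :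
    ∫ x in p..q, f x ^ 2
      ≤ (1 + θ) * (c ^ 2 * (q - p)) + (1 + θ⁻¹) * ∫ x in p..q, (f x - c) ^ 2 := by
  simpa [mul_comm (q - p)] using integral_sq_le_one_add_mul_add hpq hf (memLp_const c) hθ

theorem const_sq_mul_le_integral_sq (hpq : p ≤ q) (hf : MemLp f 2 (volume.restrict (Set.Ioo p q)))
    (c : ℝ) (hθ : 0 < θ) :
    c ^ 2 * (q - p)
      ≤ (1 + θ) * (∫ x in p..q, f x ^ 2) + (1 + θ⁻¹) * ∫ x in p..q, (f x - c) ^ 2 := by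
  simpa [mul_comm (q - p), sub_sq_comm c] using
    integral_sq_le_one_add_mul_add hpq (memLp_const c) hf hθ

theorem integral_primitive_sq_le (hpq : p < q) (hg : MemLp g 2 (volume.restrict (Set.Ioo p q))) :
    ∫ x in Set.Ioo p q, (∫ y in p..x, g y) ^ 2 ≤ (q - p) ^ 2 * ∫ x in Set.Ioo p q, g x ^ 2 := by
  have hprim : MemLp (fun x => ∫ y in p..x, g y) 2 (volume.restrict (Set.Ioo p q)) :=
    memLp_of_continuousOn_Icc
      (continuousOn_primitive hpq.le (intervalIntegrable_of_memLp_Ioo hpq.le hg))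
  have hle := eLpNorm_primitive_le hg.1
  rw [eLpNorm_two_eq_ofReal_sqrt hprim, eLpNorm_two_eq_ofReal_sqrt hg,
    ← ENNReal.ofReal_mul (Real.sqrt_nonneg _), ENNReal.ofReal_le_ofReal_iff
      (mul_nonneg (Real.sqrt_nonneg _) (sub_pos.2 hpq).le), Real.sqrt_le_iff, mul_pow,
    Real.sq_sqrt (integral_nonneg fun _ => sq_nonneg _)] at hle
  exact hle.2.trans_eq (mul_comm _ _)

theorem gapEnergy_le_sq_mul (hpq : p < q) (hf : MemLp f 2 (volume.restrict (Set.Ioo p q))) :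
    gapEnergy f p q ≤ (q - p) ^ 2 * ∫ x in p..q, f x ^ 2 := by
  have hsol := isWeakSolution_primitive_gapSlope hpq hf
  have hE : gapEnergy f p q = ∫ x in Set.Ioo p q, gapSlope f p q x ^ 2 := by
    rw [gapEnergy, intervalIntegral.integral_of_le hpq.le, integral_Ioc_eq_integral_Ioo]
  have hCS := integral_mul_sq_le hf hsol.1.1
  have hpoincare := integral_primitive_sq_le hpq hsol.1.2.1
  rw [hsol.integral_eq_energy, ← hE] at hCS
  rw [← hE] at hpoincare
  rw [intervalIntegral.integral_of_le hpq.le, integral_Ioc_eq_integral_Ioo]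
  have hf0 : 0 ≤ ∫ x in Set.Ioo p q, f x ^ 2 := integral_nonneg fun _ => sq_nonneg _
  have hbound := hCS.trans (mul_le_mul_of_nonneg_left hpoincare hf0)
  by_contra! hlt
  nlinarith [mul_nonneg (sq_nonneg (q - p)) hf0]

theorem gapSlope_sub (hpq : p ≤ q) (hf : IntervalIntegrable f volume p q)
    (hg : IntervalIntegrable g volume p q) {x : ℝ} (hx : x ∈ Set.Icc p q) :
    gapSlope (fun y => f y - g y) p q x = gapSlope f p q x - gapSlope g p q x := by
  have hprim : ∀ x ∈ Set.uIcc p q,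
      ∫ y in p..x, (f y - g y) = (∫ y in p..x, f y) - ∫ y in p..x, g y := fun x hx =>
    intervalIntegral.integral_sub (hf.mono_set (Set.uIcc_subset_uIcc_left hx))
      (hg.mono_set (Set.uIcc_subset_uIcc_left hx))
  have hmean : gapMean (fun y => f y - g y) p q = gapMean f p q - gapMean g p q := by
    rw [gapMean, intervalIntegral.integral_congr hprim, intervalIntegral.integral_sub
      ((continuousOn_primitive hpq hf).intervalIntegrable_of_Icc hpq)
      ((continuousOn_primitive hpq hg).intervalIntegrable_of_Icc hpq), mul_sub]
    rfl
  rw [gapSlope, hmean, hprim x (Set.uIcc_of_le hpq ▸ hx), gapSlope, gapSlope]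
  ring

theorem gapEnergy_le_add (hpq : p ≤ q) (hf : IntervalIntegrable f volume p q)
    (hg : IntervalIntegrable g volume p q) (hθ : 0 < θ) :
    gapEnergy f p q ≤
      (1 + θ) * gapEnergy g p q + (1 + θ⁻¹) * gapEnergy (fun y => f y - g y) p q := by
  have hsub : gapEnergy (fun y => f y - g y) p q
      = ∫ x in p..q, (gapSlope f p q x - gapSlope g p q x) ^ 2 :=
    intervalIntegral.integral_congr fun x hx => by
      simp only [gapSlope_sub hpq hf hg (Set.uIcc_of_le hpq ▸ hx)]
  rw [hsub]
  exact integral_sq_le_one_add_mul_add hpq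
    (memLp_of_continuousOn_Icc (continuousOn_gapSlope hpq hf))
    (memLp_of_continuousOn_Icc (continuousOn_gapSlope hpq hg)) hθ

theorem gapSlope_const (hpq : p < q) (c x : ℝ) :
    gapSlope (fun _ => c) p q x = c * ((p + q) / 2 - x) := by
  have hprim : ∫ x in p..q, (x - p) * c = (q - p) ^ 2 / 2 * c := by
    rw [intervalIntegral.integral_mul_const, intervalIntegral.integral_sub (by simp) (by simp),
      integral_id, intervalIntegral.integral_const, smul_eq_mul]
    ring
  simp only [gapSlope, gapMean, intervalIntegral.integral_const, smul_eq_mul, hprim]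
  field_simp [sub_ne_zero.2 hpq.ne']
  ring

theorem gapEnergy_const (hpq : p < q) (c : ℝ) :
    gapEnergy (fun _ => c) p q = c ^ 2 * (q - p) ^ 3 / 12 := by
  have hderiv : ∀ x, HasDerivAt (fun x => -(c ^ 2 * ((p + q) / 2 - x) ^ 3 / 3))
      ((c * ((p + q) / 2 - x)) ^ 2) x := fun x => by
    refine ((((((hasDerivAt_id x).const_sub ((p + q) / 2)).pow 3).const_mul
      (c ^ 2)).div_const 3).neg).congr_deriv ?_
    simp only [id_eq, Nat.cast_ofNat]
    ring
  simp only [gapEnergy, gapSlope_const hpq]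
  rw [intervalIntegral.integral_eq_sub_of_hasDerivAt (fun x _ => hderiv x)
    (Continuous.intervalIntegrable (by fun_prop) _ _)]
  ring

theorem gapEnergy_le_of_const (hpq : p < q) (hf : MemLp f 2 (volume.restrict (Set.Ioo p q)))
    (c : ℝ) (hθ : 0 < θ) :
    gapEnergy f p q ≤ (1 + θ) * (c ^ 2 * (q - p) ^ 3 / 12) +
      (1 + θ⁻¹) * ((q - p) ^ 2 * ∫ x in p..q, (f x - c) ^ 2) := by
  have hfi := intervalIntegrable_of_memLp_Ioo hpq.le hf
  rw [← gapEnergy_const hpq]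
  refine (gapEnergy_le_add (g := fun _ => c) hpq.le hfi (by simp) hθ).trans ?_
  gcongr
  exact gapEnergy_le_sq_mul hpq (hf.sub (memLp_const c))

theorem const_le_gapEnergy (hpq : p < q) (hf : MemLp f 2 (volume.restrict (Set.Ioo p q)))
    (c : ℝ) (hθ : 0 < θ) :
    c ^ 2 * (q - p) ^ 3 / 12 ≤ (1 + θ) * gapEnergy f p q +
      (1 + θ⁻¹) * ((q - p) ^ 2 * ∫ x in p..q, (f x - c) ^ 2) := by
  have hfi := intervalIntegrable_of_memLp_Ioo hpq.le hf
  rw [← gapEnergy_const hpq]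
  refine (gapEnergy_le_add (f := fun _ => c) hpq.le (by simp) hfi hθ).trans ?_
  simp only [sub_sq_comm _ c]
  gcongr
  exact gapEnergy_le_sq_mul hpq ((memLp_const c).sub hf)

end GapEstimates

/-- `p = t 0 < t 1 < ⋯ < t N = q`; the values `t i` with `i > N` are irrelevant. -/
structure IsPartition (p q : ℝ) (N : ℕ) (t : ℕ → ℝ) : Prop where
  strictMonoOn : StrictMonoOn t (Set.Iic N)
  left : t 0 = p
  right : t N = q

section Partition

variable {p q : ℝ} {N : ℕ} {t : ℕ → ℝ} {f : ℝ → ℝ}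

theorem IsPartition.lt_succ (ht : IsPartition p q N t) {i : ℕ} (hi : i < N) : t i < t (i + 1) :=
  ht.strictMonoOn hi.le (Nat.succ_le_of_lt hi) i.lt_succ_self

theorem IsPartition.le_of_le (ht : IsPartition p q N t) {i j : ℕ} (hij : i ≤ j) (hj : j ≤ N) :
    t i ≤ t j :=
  ht.strictMonoOn.monotoneOn (hij.trans hj) hj hij

theorem IsPartition.mem_Icc (ht : IsPartition p q N t) {i : ℕ} (hi : i ≤ N) :
    t i ∈ Set.Icc p q :=
  ⟨ht.left ▸ ht.le_of_le i.zero_le hi, ht.right ▸ ht.le_of_le hi le_rfl⟩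

theorem IsPartition.Ioo_subset (ht : IsPartition p q N t) {i : ℕ} (hi : i < N) :
    Set.Ioo (t i) (t (i + 1)) ⊆ Set.Ioo p q :=
  Set.Ioo_subset_Ioo (ht.mem_Icc hi.le).1 (ht.mem_Icc hi).2

theorem IsPartition.exists_le_lt (ht : IsPartition p q N t) {x : ℝ} (hx : x ∈ Set.Ico p q) :
    ∃ i < N, t i ≤ x ∧ x < t (i + 1) := by
  classical
  have hex : ∃ i, x < t i := ⟨N, ht.right ▸ hx.2⟩
  obtain ⟨i, hi⟩ : ∃ i, Nat.find hex = i + 1 := Nat.exists_eq_succ_of_ne_zero fun h =>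
    hx.1.not_gt (ht.left ▸ h ▸ Nat.find_spec hex)
  have hiN : i + 1 ≤ N := hi ▸ Nat.find_min' hex (ht.right ▸ hx.2)
  exact ⟨i, hiN, not_lt.1 (Nat.find_min hex (hi ▸ i.lt_succ_self)),
    hi ▸ Nat.find_spec hex⟩

theorem IsPartition.Ioo_sdiff (ht : IsPartition p q N t) :
    Set.Ioo p q \ t '' Set.Iic N = ⋃ i : Fin N, Set.Ioo (t i) (t (i + 1)) := by
  refine Set.Subset.antisymm (fun x ⟨hx, hxt⟩ => ?_) (Set.iUnion_subset fun i x hx => ?_)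
  · obtain ⟨i, hi, hle, hlt⟩ := ht.exists_le_lt (Set.Ioo_subset_Ico_self hx)
    exact Set.mem_iUnion.2 ⟨⟨i, hi⟩, lt_of_le_of_ne hle fun h => hxt ⟨i, hi.le, h⟩, hlt⟩
  · refine ⟨ht.Ioo_subset i.2 hx, ?_⟩
    rintro ⟨j, hj, rfl⟩
    rcases le_or_gt j i with h | h
    · exact (ht.le_of_le h i.2.le).not_gt hx.1
    · exact (ht.le_of_le (Nat.succ_le_of_lt h) hj).not_gt hx.2

theorem IsPartition.pairwise_disjoint (ht : IsPartition p q N t) :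
    Pairwise (Function.onFun Disjoint fun i : Fin N => Set.Ioo (t i) (t (i + 1))) := by
  refine (pairwise_disjoint_on _).2 fun i j hij => Set.disjoint_left.2 fun x hxi hxj => ?_
  exact (ht.le_of_le (Nat.succ_le_of_lt hij) j.2.le).not_gt (hxj.1.trans hxi.2)

theorem IsPartition.exists_isWeakSolution (ht : IsPartition p q N t)
    (hf : MemLp f 2 (volume.restrict (Set.Ioo p q))) (i : Fin N) :
    ∃ u u', IsWeakSolution (Set.Ioo (t i) (t (i + 1))) f u u' :=
  ⟨_, _, isWeakSolution_primitive_gapSlope (ht.lt_succ i.2)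
    (hf.mono_measure (Measure.restrict_mono (ht.Ioo_subset i.2) le_rfl))⟩

theorem IsPartition.compliance_sdiff (ht : IsPartition p q N t)
    (hf : MemLp f 2 (volume.restrict (Set.Ioo p q))) :
    compliance (Set.Ioo p q \ t '' Set.Iic N) f
      = ENNReal.ofReal (∑ i ∈ Finset.range N, gapEnergy f (t i) (t (i + 1))) := by
  rw [ht.Ioo_sdiff, compliance_iUnion (fun i => isOpen_Ioo) ht.pairwise_disjoint
      (hf.mono_measure (Measure.restrict_mono (ht.Ioo_sdiff ▸ Set.sdiff_subset) le_rfl))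
      (ht.exists_isWeakSolution hf),
    ← Fin.sum_univ_eq_sum_range (fun i => gapEnergy f (t i) (t (i + 1))),
    ENNReal.ofReal_sum_of_nonneg fun i _ => gapEnergy_nonneg (ht.lt_succ i.2).le]
  exact Finset.sum_congr rfl fun i _ => compliance_Ioo (ht.lt_succ i.2)
    (hf.mono_measure (Measure.restrict_mono (ht.Ioo_subset i.2) le_rfl))

theorem exists_isPartition_image_eq (hpq : p < q) (S : Finset ℝ) (hS : ∀ x ∈ S, x ∈ Set.Ioo p q) :
    ∃ t, IsPartition p q (S.card + 1) t ∧ t '' Set.Iic (S.card + 1) = insert p (insert q ↑S) := by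
  classical
  have hp : p ∉ insert q S := fun h => (Finset.mem_insert.1 h).elim hpq.ne fun h => (hS p h).1.false
  have hcard : (insert p (insert q S)).card = S.card + 2 := by
    rw [Finset.card_insert_of_notMem hp, Finset.card_insert_of_notMem fun h => (hS q h).2.false]
  have hIcc : ∀ x ∈ insert p (insert q S), x ∈ Set.Icc p q := by
    simp only [Finset.forall_mem_insert, Set.left_mem_Icc, Set.right_mem_Icc, hpq.le, true_and]
    exact fun x hx => Set.Ioo_subset_Icc_self (hS x hx)
  let e := (insert p (insert q S)).orderEmbOfFin hcard
  have hval : ∀ i ≤ S.card + 1, ((Fin.ofNat (S.card + 2) i : Fin (S.card + 2)) : ℕ) = i :=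
    fun i hi => Nat.mod_eq_of_lt (by omega)
  have hrange : (fun i => e (Fin.ofNat _ i)) '' Set.Iic (S.card + 1) = insert p (insert q ↑S) := by
    rw [← Finset.coe_insert, ← Finset.coe_insert, ← Finset.range_orderEmbOfFin _ hcard]
    refine Set.Subset.antisymm (Set.image_subset_iff.2 fun i _ => ⟨_, rfl⟩) ?_
    rintro _ ⟨i, rfl⟩
    exact ⟨i, Nat.le_of_lt_succ i.2, congrArg e (Fin.ext (hval i (Nat.le_of_lt_succ i.2)))⟩
  refine ⟨fun i => e (Fin.ofNat _ i), ⟨fun i hi j hj hij => ?_, ?_, ?_⟩, hrange⟩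
  · exact e.strictMono (Fin.lt_def.2 (by rwa [hval i hi, hval j hj]))
  · refine (Finset.orderEmbOfFin_zero hcard (by omega)).trans (le_antisymm ?_ ?_)
    · exact Finset.min'_le _ _ (Finset.mem_insert_self _ _)
    · exact Finset.le_min' _ _ _ fun x hx => (hIcc x hx).1
  · refine Eq.trans (congrArg e (Fin.ext ?_))
      ((Finset.orderEmbOfFin_last hcard (by omega)).trans (le_antisymm ?_ ?_))
    · exact hval _ le_rfl
    · exact Finset.max'_le _ _ _ fun x hx => (hIcc x hx).2
    · exact Finset.le_max' _ _ (Finset.mem_insert_of_mem (Finset.mem_insert_self _ _))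

theorem exists_isWeakSolution_Ioo_sdiff (hpq : p < q) {S : Set ℝ} (hS : S.Finite)
    (hf : MemLp f 2 (volume.restrict (Set.Ioo p q))) :
    ∃ u u', IsWeakSolution (Set.Ioo p q \ S) f u u' := by
  obtain ⟨N, t, ht, himage⟩ : ∃ N t, IsPartition p q N t ∧
      t '' Set.Iic N = insert p (insert q (S ∩ Set.Ioo p q)) := by
    obtain ⟨t, ht, himage⟩ := exists_isPartition_image_eq hpq
      (hS.inter_of_left (Set.Ioo p q)).toFinset (by simp +contextual)
    exact ⟨_, t, ht, by rwa [Set.Finite.coe_toFinset] at himage⟩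
  have hdiff : Set.Ioo p q \ S = Set.Ioo p q \ t '' Set.Iic N := by
    rw [himage]
    exact Set.ext fun x => and_congr_right fun hx => not_congr <| by
      simp [hx.1.ne', hx.2.ne, hx.1, hx.2]
  choose u u' hu using ht.exists_isWeakSolution hf
  rw [hdiff, ht.Ioo_sdiff]
  exact ⟨_, _, isWeakSolution_iUnion (fun i => isOpen_Ioo) ht.pairwise_disjoint
    (hf.mono_measure (Measure.restrict_mono (ht.Ioo_sdiff ▸ Set.sdiff_subset) le_rfl)) hu⟩

/-- The points `p + i (q - p) / m` dividing `[p, q]` into `m` intervals of equal length. -/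
noncomputable def equipartition (p q : ℝ) (m i : ℕ) : ℝ :=
  p + i * ((q - p) / m)

theorem equipartition_succ_sub (p q : ℝ) (m i : ℕ) :
    equipartition p q m (i + 1) - equipartition p q m i = (q - p) / m := by
  simp only [equipartition, Nat.cast_succ]
  ring

theorem isPartition_equipartition (hpq : p < q) {m : ℕ} (hm : m ≠ 0) :
    IsPartition p q m (equipartition p q m) := by
  have hm' : (0 : ℝ) < m := Nat.cast_pos.2 (Nat.pos_of_ne_zero hm)
  refine ⟨fun i _ j _ hij => ?_, by simp [equipartition], ?_⟩
  · exact add_lt_add_right (mul_lt_mul_of_pos_right (Nat.cast_lt.2 hij)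
      (div_pos (sub_pos.2 hpq) hm')) p
  · simp only [equipartition]
    field_simp
    ring

end Partition

section CellEstimates

variable {p q θ δ : ℝ} {N : ℕ} {t : ℕ → ℝ} {f : ℝ → ℝ}

theorem IsPartition.sum_length (ht : IsPartition p q N t) :
    ∑ i ∈ Finset.range N, (t (i + 1) - t i) = q - p := by
  rw [Finset.sum_range_sub, ht.left, ht.right]

theorem IsPartition.sum_integral (ht : IsPartition p q N t) {g : ℝ → ℝ}
    (hg : IntervalIntegrable g volume p q) :
    ∑ i ∈ Finset.range N, ∫ x in t i..t (i + 1), g x = ∫ x in p..q, g x := by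
  rw [intervalIntegral.sum_integral_adjacent_intervals fun i hi => hg.mono_set ?_,
    ht.left, ht.right]
  exact Set.uIcc_subset_uIcc (Set.Icc_subset_uIcc (ht.mem_Icc hi.le))
    (Set.Icc_subset_uIcc (ht.mem_Icc hi))

theorem IsPartition.pow_three_div_sq_le (ht : IsPartition p q N t) :
    (q - p) ^ 3 / N ^ 2 ≤ ∑ i ∈ Finset.range N, (t (i + 1) - t i) ^ 3 := by
  have hpow := pow_sum_div_card_le_sum_pow (s := Finset.range N) (f := fun i => t (i + 1) - t i)
    (fun i hi => (sub_pos.2 (ht.lt_succ (Finset.mem_range.1 hi))).le) 2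
  rwa [ht.sum_length, Finset.card_range] at hpow

theorem IsPartition.sum_sq_mul_integral_le (ht : IsPartition p q N t) {δ : ℝ}
    (hδ : ∀ i < N, t (i + 1) - t i ≤ δ) {g : ℝ → ℝ} (hg0 : ∀ x, 0 ≤ g x)
    (hg : IntervalIntegrable g volume p q) :
    ∑ i ∈ Finset.range N, (t (i + 1) - t i) ^ 2 * ∫ x in t i..t (i + 1), g x
      ≤ δ ^ 2 * ∫ x in p..q, g x := by
  rw [← ht.sum_integral hg, Finset.mul_sum]
  refine Finset.sum_le_sum fun i hi => ?_
  have hlt := ht.lt_succ (Finset.mem_range.1 hi)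
  gcongr
  · exact intervalIntegral.integral_nonneg hlt.le fun x _ => hg0 x
  · exact hδ i (Finset.mem_range.1 hi)

theorem intervalIntegrable_sub_const_sq (hpq : p ≤ q)
    (hf : MemLp f 2 (volume.restrict (Set.Ioo p q))) (c : ℝ) :
    IntervalIntegrable (fun x => (f x - c) ^ 2) volume p q :=
  (intervalIntegrable_iff_integrableOn_Ioo_of_le hpq).2 (hf.sub (memLp_const c)).integrable_sq

theorem IsPartition.const_le_sum_gapEnergy (ht : IsPartition p q N t) (hpq : p ≤ q)
    (hf : MemLp f 2 (volume.restrict (Set.Ioo p q))) (c : ℝ) (hθ : 0 < θ)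
    (hδ : ∀ i < N, t (i + 1) - t i ≤ δ) :
    c ^ 2 * ((q - p) ^ 3 / N ^ 2) / 12
      ≤ (1 + θ) * ∑ i ∈ Finset.range N, gapEnergy f (t i) (t (i + 1)) +
        (1 + θ⁻¹) * (δ ^ 2 * ∫ x in p..q, (f x - c) ^ 2) := by
  have hterm : ∀ i ∈ Finset.range N, _ := fun i hi =>
    const_le_gapEnergy (ht.lt_succ (Finset.mem_range.1 hi)) (hf.mono_measure (Measure.restrict_mono
      (ht.Ioo_subset (Finset.mem_range.1 hi)) le_rfl)) c hθ
  have hsum := Finset.sum_le_sum hterm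
  rw [← Finset.sum_div, ← Finset.mul_sum, Finset.sum_add_distrib, ← Finset.mul_sum,
    ← Finset.mul_sum] at hsum
  refine (le_trans ?_ hsum).trans ?_
  · gcongr
    exact ht.pow_three_div_sq_le
  · gcongr
    exact ht.sum_sq_mul_integral_le hδ (fun x => sq_nonneg _)
      (intervalIntegrable_sub_const_sq hpq hf c)

theorem exists_isPartition_of_finite (hpq : p < q) {S : Set ℝ} (hS : S.Finite) {m : ℕ}
    (hm : m ≠ 0) :
    ∃ N t, IsPartition p q N t ∧ N ≤ (S ∩ Set.Ioo p q).ncard + m ∧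
      S ∩ Set.Ioo p q ⊆ t '' Set.Iic N ∧ ∀ i < N, t (i + 1) - t i ≤ (q - p) / m := by
  classical
  have hgrid := isPartition_equipartition hpq hm
  set T := (hS.inter_of_left (Set.Ioo p q)).toFinset ∪
    (Finset.Ioo 0 m).image (equipartition p q m) with hT
  obtain ⟨t, ht, himage⟩ := exists_isPartition_image_eq hpq T fun x hx => by
    simp only [hT, Finset.mem_union, Set.Finite.mem_toFinset, Finset.mem_image,
      Finset.mem_Ioo] at hx
    obtain hx | ⟨i, ⟨h0, him⟩, rfl⟩ := hx
    · exact hx.2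
    · exact ⟨hgrid.left.symm.trans_lt (hgrid.strictMonoOn (Nat.zero_le m) him.le h0),
        (hgrid.strictMonoOn him.le Set.self_mem_Iic him).trans_eq hgrid.right⟩
  have hmem : ∀ j ≤ m, equipartition p q m j ∈ t '' Set.Iic (T.card + 1) := fun j hj => by
    rw [himage]
    rcases Nat.eq_zero_or_pos j with rfl | h0
    · exact .inl hgrid.left
    rcases hj.eq_or_lt with rfl | hjm
    · exact .inr (.inl hgrid.right)
    · refine .inr (.inr (Finset.mem_coe.2 (Finset.mem_union_right _ ?_)))
      exact Finset.mem_image_of_mem _ (Finset.mem_Ioo.2 ⟨h0, hjm⟩)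
  refine ⟨T.card + 1, t, ht, ?_, fun x hx => ?_, fun i hi => ?_⟩
  · have hcard := (Finset.card_union_le (hS.inter_of_left (Set.Ioo p q)).toFinset
      ((Finset.Ioo 0 m).image (equipartition p q m))).trans
        (add_le_add_right Finset.card_image_le _)
    rw [Nat.card_Ioo, ← Set.ncard_eq_toFinset_card _ (hS.inter_of_left _), ← hT] at hcard
    omega
  · rw [himage]
    exact .inr (.inr (Finset.mem_coe.2
      (Finset.mem_union_left _ ((Set.Finite.mem_toFinset _).2 hx))))
  · have hti : t i ∈ Set.Ico p q :=
      ⟨(ht.mem_Icc hi.le).1, (ht.lt_succ hi).trans_le (ht.mem_Icc hi).2⟩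
    obtain ⟨j, hj, hle, hlt⟩ := hgrid.exists_le_lt hti
    have hnext : t (i + 1) ≤ equipartition p q m (j + 1) := by
      by_contra! h
      have hgap := ht.Ioo_sdiff.symm.subset (Set.mem_iUnion.2 ⟨⟨i, hi⟩, hlt, h⟩)
      exact hgap.2 (hmem _ hj)
    exact (sub_le_sub hnext hle).trans_eq (equipartition_succ_sub p q m j)

theorem const_le_compliance_Ioo_sdiff (hpq : p < q)
    (hf : MemLp f 2 (volume.restrict (Set.Ioo p q))) (c : ℝ) (hθ : 0 < θ) {S : Set ℝ}
    (hS : S.Finite) {m : ℕ} (hm : m ≠ 0) :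
    ENNReal.ofReal (c ^ 2 * ((q - p) ^ 3 / ((S ∩ Set.Ioo p q).ncard + m) ^ 2) / 12)
      ≤ ENNReal.ofReal (1 + θ) * compliance (Set.Ioo p q \ S) f +
        ENNReal.ofReal ((1 + θ⁻¹) * (((q - p) / m) ^ 2 * ∫ x in p..q, (f x - c) ^ 2)) := by
  obtain ⟨N, t, ht, hN, hSt, hmesh⟩ := exists_isPartition_of_finite hpq hS hm
  have hsubset : Set.Ioo p q \ t '' Set.Iic N ⊆ Set.Ioo p q \ S :=
    fun x hx => ⟨hx.1, fun hxS => hx.2 (hSt ⟨hxS, hx.1⟩)⟩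
  have hae : ∀ {T : Set ℝ}, T.Finite → (Set.Ioo p q \ T : Set ℝ) =ᵐ[volume] Set.Ioo p q :=
    fun hT => sdiff_null_ae_eq_self (hT.measure_zero _)
  obtain ⟨v, v', hv⟩ := exists_isWeakSolution_Ioo_sdiff hpq ((Set.finite_Iic N).image t) hf
  have hmono := compliance_mono hsubset
    ((hae ((Set.finite_Iic N).image t)).trans (hae hS).symm) hv
  rw [ht.compliance_sdiff hf] at hmono
  refine le_trans ?_ (add_le_add_left (mul_le_mul_right hmono _) _)
  rw [← ENNReal.ofReal_mul (by positivity), ← ENNReal.ofReal_add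
    (mul_nonneg (by positivity) (Finset.sum_nonneg fun i hi =>
      gapEnergy_nonneg (ht.lt_succ (Finset.mem_range.1 hi)).le))
    (by have := intervalIntegral.integral_nonneg (μ := volume) hpq.le fun x _ => sq_nonneg (f x - c)
        positivity)]
  refine ENNReal.ofReal_le_ofReal (le_trans ?_
    (ht.const_le_sum_gapEnergy hpq.le hf c hθ hmesh))
  have hN0 : 0 < N := Nat.pos_of_ne_zero fun h =>
    hpq.ne (ht.left.symm.trans ((congrArg t h.symm).trans ht.right))
  have hN' : (N : ℝ) ≤ (S ∩ Set.Ioo p q).ncard + m := by exact_mod_cast hN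
  have : (0 : ℝ) < N := Nat.cast_pos.2 hN0
  have := sub_pos.2 hpq
  gcongr

end CellEstimates

section StepApproximation

variable {a b ω : ℝ} {f : ℝ → ℝ}

theorem exists_continuous_integral_sub_sq_le (hab : a ≤ b)
    (hf : MemLp f 2 (volume.restrict (Set.Ioo a b))) (hω : 0 < ω) :
    ∃ g : ℝ → ℝ, Continuous g ∧ ∫ x in a..b, (f x - g x) ^ 2 ≤ ω := by
  obtain ⟨g, -, hle, hg, hgm⟩ := hf.exists_hasCompactSupport_eLpNorm_sub_le ENNReal.ofNat_ne_top
    (ENNReal.ofReal_pos.2 (Real.sqrt_pos.2 hω)).ne'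
  refine ⟨g, hg, ?_⟩
  rw [eLpNorm_two_eq_ofReal_sqrt (hf.sub hgm), ENNReal.ofReal_le_ofReal_iff (Real.sqrt_nonneg _),
    Real.sqrt_le_sqrt_iff hω.le] at hle
  rwa [intervalIntegral.integral_of_le hab, integral_Ioc_eq_integral_Ioo]

theorem exists_forall_abs_sub_equipartition_le (hab : a < b) {g : ℝ → ℝ} (hg : Continuous g)
    {η : ℝ} (hη : 0 < η) :
    ∀ᶠ M : ℕ in atTop, ∀ i < M,
      ∀ x ∈ Set.Icc (equipartition a b M i) (equipartition a b M (i + 1)),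
        |g x - g (equipartition a b M i)| ≤ η := by
  obtain ⟨δ, hδ, huc⟩ := Metric.uniformContinuousOn_iff.1
    (isCompact_Icc.uniformContinuousOn_of_continuous (s := Set.Icc a b) hg.continuousOn) η hη
  have hmesh : Tendsto (fun M : ℕ => (b - a) / M) atTop (𝓝 0) :=
    tendsto_const_div_atTop_nhds_zero_nat _
  filter_upwards [hmesh.eventually_lt_const hδ, eventually_ne_atTop 0] with M hM hM0 i hi x hx
  have ht := isPartition_equipartition hab hM0
  have hIcc : Set.Icc (equipartition a b M i) (equipartition a b M (i + 1)) ⊆ Set.Icc a b :=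
    Set.Icc_subset_Icc (ht.mem_Icc hi.le).1 (ht.mem_Icc hi).2
  refine (huc x (hIcc hx) _ (hIcc (Set.left_mem_Icc.2 (ht.lt_succ hi).le)) ?_).le
  rw [Real.dist_eq, abs_of_nonneg (sub_nonneg.2 hx.1)]
  linarith [equipartition_succ_sub a b M i, hx.2]

theorem eventually_exists_sum_integral_sub_sq_le (hab : a < b)
    (hf : MemLp f 2 (volume.restrict (Set.Ioo a b))) (hω : 0 < ω) :
    ∀ᶠ M : ℕ in atTop, ∃ c : ℕ → ℝ, ∑ i ∈ Finset.range M,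
      ∫ x in equipartition a b M i..equipartition a b M (i + 1), (f x - c i) ^ 2 ≤ ω := by
  obtain ⟨g, hg, hfg⟩ := exists_continuous_integral_sub_sq_le hab.le hf (by positivity : 0 < ω / 4)
  have hba := sub_pos.2 hab
  have hη : 0 < √(ω / (4 * (b - a))) := Real.sqrt_pos.2 (by positivity)
  filter_upwards [exists_forall_abs_sub_equipartition_le hab hg hη, eventually_ne_atTop 0]
    with M hosc hM0
  set t := equipartition a b M
  have ht : IsPartition a b M t := isPartition_equipartition hab hM0
  have hgm : MemLp g 2 (volume.restrict (Set.Ioo a b)) := memLp_of_continuousOn_Icc hg.continuousOn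
  have hfgi : IntervalIntegrable (fun x => (f x - g x) ^ 2) volume a b :=
    (intervalIntegrable_iff_integrableOn_Ioo_of_le hab.le).2 (hf.sub hgm).integrable_sq
  refine ⟨fun i => g (t i), ?_⟩
  calc ∑ i ∈ Finset.range M, ∫ x in t i..t (i + 1), (f x - g (t i)) ^ 2
      ≤ ∑ i ∈ Finset.range M, ∫ x in t i..t (i + 1), (2 * (f x - g x) ^ 2 + ω / (2 * (b - a))) := by
        refine Finset.sum_le_sum fun i hi => ?_
        have hi := Finset.mem_range.1 hi
        have hmono : volume.restrict (Set.Ioo (t i) (t (i + 1))) ≤ volume.restrict (Set.Ioo a b) :=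
          Measure.restrict_mono (ht.Ioo_subset hi) le_rfl
        refine intervalIntegral.integral_mono_on (ht.lt_succ hi).le
          (intervalIntegrable_sub_const_sq (ht.lt_succ hi).le (hf.mono_measure hmono) _)
          (((intervalIntegrable_iff_integrableOn_Ioo_of_le (ht.lt_succ hi).le).2
            ((hf.sub hgm).mono_measure hmono).integrable_sq |>.const_mul 2).add (by simp))
          fun x hx => ?_
        have hsq := sq_le_sq' (neg_le_of_abs_le (hosc i hi x hx)) (le_of_abs_le (hosc i hi x hx))
        rw [Real.sq_sqrt (by positivity)] at hsq
        have : ω / (2 * (b - a)) = 2 * (ω / (4 * (b - a))) := by field_simp; norm_num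
        nlinarith [sq_nonneg ((f x - g x) - (g x - g (t i)))]
    _ = 2 * (∫ x in a..b, (f x - g x) ^ 2) + ω / 2 := by
        rw [ht.sum_integral ((hfgi.const_mul 2).add (by simp)), intervalIntegral.integral_add
          (hfgi.const_mul 2) (by simp), intervalIntegral.integral_const_mul,
          intervalIntegral.integral_const, smul_eq_mul]
        field_simp
    _ ≤ ω := by linarith

end StepApproximation

section CellLowerBound

variable {p q c θ n d R : ℝ} {m : ℕ} {f : ℝ → ℝ} {S : Set ℝ}

theorem integral_sq_div_sq_le (hpq : p < q) (hf : MemLp f 2 (volume.restrict (Set.Ioo p q)))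
    (c : ℝ) (hθ : 0 < θ) {k m : ℝ} (hk : 0 ≤ k) (hm : 0 < m) (hn : 0 < n)
    (hd : k + m ≤ n * (q - p) * d) (hR : n * (q - p) ≤ R * m) :
    (∫ x in p..q, f x ^ 2) / d ^ 2
      ≤ 12 * (1 + θ) * n ^ 2 * (c ^ 2 * ((q - p) ^ 3 / (k + m) ^ 2) / 12) +
        (1 + θ⁻¹) * R ^ 2 * ∫ x in p..q, (f x - c) ^ 2 := by
  have := sub_pos.2 hpq
  have hd0 : 0 < d := pos_of_mul_pos_right (lt_of_lt_of_le (by positivity) hd) (by positivity)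
  have hconst : 1 / d ^ 2 ≤ n ^ 2 * (q - p) ^ 2 / (k + m) ^ 2 := by
    rw [div_le_div_iff₀ (by positivity) (by positivity), one_mul, ← mul_pow, ← mul_pow]
    gcongr
  have herr : 1 / d ^ 2 ≤ R ^ 2 := by
    rw [div_le_iff₀ (by positivity), ← mul_pow]
    refine one_le_pow₀ (le_of_mul_le_mul_right ?_ hm)
    nlinarith
  have hE : 0 ≤ ∫ x in p..q, (f x - c) ^ 2 :=
    intervalIntegral.integral_nonneg hpq.le fun x _ => sq_nonneg _
  calc (∫ x in p..q, f x ^ 2) / d ^ 2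
      ≤ ((1 + θ) * (c ^ 2 * (q - p)) + (1 + θ⁻¹) * ∫ x in p..q, (f x - c) ^ 2) / d ^ 2 := by
        gcongr
        exact integral_sq_le_of_const hpq.le hf c hθ
    _ = (1 + θ) * (c ^ 2 * (q - p)) * (1 / d ^ 2) +
          (1 + θ⁻¹) * (1 / d ^ 2) * ∫ x in p..q, (f x - c) ^ 2 := by ring
    _ ≤ (1 + θ) * (c ^ 2 * (q - p)) * (n ^ 2 * (q - p) ^ 2 / (k + m) ^ 2) +
          (1 + θ⁻¹) * R ^ 2 * ∫ x in p..q, (f x - c) ^ 2 := by gcongr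
    _ = _ := by ring

theorem setLIntegral_ofReal_sq_div (hpq : p ≤ q) (hf : MemLp f 2 (volume.restrict (Set.Ioo p q)))
    (hd : 0 < d) :
    ∫⁻ x in Set.Ioo p q, ENNReal.ofReal (f x ^ 2) / ENNReal.ofReal d ^ 2
      = ENNReal.ofReal ((∫ x in p..q, f x ^ 2) / d ^ 2) := by
  rw [intervalIntegral.integral_of_le hpq, integral_Ioc_eq_integral_Ioo, ← integral_div,
    ofReal_integral_eq_lintegral_ofReal (hf.integrable_sq.div_const _)
      (.of_forall fun x => by positivity)]
  refine lintegral_congr fun x => ?_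
  rw [ENNReal.ofReal_div_of_pos (by positivity), ENNReal.ofReal_pow hd.le]

theorem setLIntegral_sq_div_le_compliance (hpq : p < q)
    (hf : MemLp f 2 (volume.restrict (Set.Ioo p q))) (c : ℝ) (hθ : 0 < θ) (hS : S.Finite)
    (hm : m ≠ 0) (hn : 0 < n) (hd : (S ∩ Set.Ioo p q).ncard + m ≤ n * (q - p) * d)
    (hR : n * (q - p) ≤ R * m) :
    ∫⁻ x in Set.Ioo p q, ENNReal.ofReal (f x ^ 2) / ENNReal.ofReal d ^ 2
      ≤ ENNReal.ofReal (12 * (1 + θ) ^ 2 * n ^ 2) * compliance (Set.Ioo p q \ S) f +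
        ENNReal.ofReal ((1 + θ⁻¹) * (13 + 12 * θ) * R ^ 2 * ∫ x in p..q, (f x - c) ^ 2) := by
  have := sub_pos.2 hpq
  have hm0 : (0 : ℝ) < m := Nat.cast_pos.2 (Nat.pos_of_ne_zero hm)
  have hd0 : 0 < d := pos_of_mul_pos_right (lt_of_lt_of_le (by positivity) hd) (by positivity)
  have hE : 0 ≤ ∫ x in p..q, (f x - c) ^ 2 :=
    intervalIntegral.integral_nonneg hpq.le fun x _ => sq_nonneg _
  have hmesh : n ^ 2 * ((q - p) / m) ^ 2 ≤ R ^ 2 := by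
    rw [← mul_pow, mul_div]
    gcongr
    rwa [div_le_iff₀ hm0]
  have hcell := const_le_compliance_Ioo_sdiff hpq hf c hθ hS hm
  set κ : ℝ := 12 * (1 + θ) * n ^ 2
  set A := c ^ 2 * ((q - p) ^ 3 / ((S ∩ Set.Ioo p q).ncard + m : ℝ) ^ 2) / 12
  set E := ∫ x in p..q, (f x - c) ^ 2
  calc _ = ENNReal.ofReal ((∫ x in p..q, f x ^ 2) / d ^ 2) :=
        setLIntegral_ofReal_sq_div hpq.le hf hd0
    _ ≤ ENNReal.ofReal (κ * A + (1 + θ⁻¹) * R ^ 2 * E) := ENNReal.ofReal_le_ofReal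
        (integral_sq_div_sq_le hpq hf c hθ (Nat.cast_nonneg _) hm0 hn hd hR)
    _ = ENNReal.ofReal κ * ENNReal.ofReal A + ENNReal.ofReal ((1 + θ⁻¹) * R ^ 2 * E) := by
        rw [ENNReal.ofReal_add (by positivity) (by positivity), ENNReal.ofReal_mul (by positivity)]
    _ ≤ ENNReal.ofReal κ * (ENNReal.ofReal (1 + θ) * compliance (Set.Ioo p q \ S) f +
          ENNReal.ofReal ((1 + θ⁻¹) * (((q - p) / m) ^ 2 * E))) +
          ENNReal.ofReal ((1 + θ⁻¹) * R ^ 2 * E) := by gcongr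
    _ = ENNReal.ofReal (12 * (1 + θ) ^ 2 * n ^ 2) * compliance (Set.Ioo p q \ S) f +
          ENNReal.ofReal
            ((1 + θ⁻¹) * (12 * (1 + θ) * (n ^ 2 * ((q - p) / m) ^ 2) + R ^ 2) * E) := by
        rw [mul_add, ← mul_assoc, ← ENNReal.ofReal_mul (by positivity),
          ← ENNReal.ofReal_mul (by positivity), add_assoc, ← ENNReal.ofReal_add (by positivity)
          (by positivity)]
        congr 3 <;> ring
    _ ≤ _ := by
        have hcoef :
            12 * (1 + θ) * (n ^ 2 * ((q - p) / m) ^ 2) + R ^ 2 ≤ (13 + 12 * θ) * R ^ 2 := by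
          linarith [mul_le_mul_of_nonneg_left hmesh (by positivity : 0 ≤ 12 * (1 + θ))]
        rw [mul_assoc (1 + θ⁻¹) (13 + 12 * θ)]
        gcongr _ + ENNReal.ofReal (_ * ?_ * E)

end CellLowerBound

section Cells

variable {p q : ℝ} {N : ℕ} {t : ℕ → ℝ} {f : ℝ → ℝ} {S : Set ℝ}

theorem IsPartition.sum_compliance_sdiff (ht : IsPartition p q N t)
    (hf : MemLp f 2 (volume.restrict (Set.Ioo p q))) (hS : S.Finite) :
    ∑ i ∈ Finset.range N, compliance (Set.Ioo (t i) (t (i + 1)) \ S) f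
      = compliance (Set.Ioo p q \ (S ∪ t '' Set.Iic N)) f := by
  have hunion : Set.Ioo p q \ (S ∪ t '' Set.Iic N)
      = ⋃ i : Fin N, Set.Ioo (t i) (t (i + 1)) \ S := by
    rw [← Set.iUnion_sdiff, ← ht.Ioo_sdiff, Set.sdiff_sdiff, Set.union_comm]
  rw [hunion, compliance_iUnion (fun i => isOpen_Ioo.sdiff hS.isClosed)
    (fun i j hij => (ht.pairwise_disjoint hij).mono Set.sdiff_subset Set.sdiff_subset)
    (hf.mono_measure (Measure.restrict_mono (hunion ▸ Set.sdiff_subset) le_rfl))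
    fun i => exists_isWeakSolution_Ioo_sdiff (ht.lt_succ i.2) hS
      (hf.mono_measure (Measure.restrict_mono (ht.Ioo_subset i.2) le_rfl))]
  exact (Fin.sum_univ_eq_sum_range (fun i => compliance (Set.Ioo (t i) (t (i + 1)) \ S) f) N).symm

theorem IsPartition.sum_compliance_sdiff_le (ht : IsPartition p q N t) (hpq : p < q)
    (hf : MemLp f 2 (volume.restrict (Set.Ioo p q))) (hS : S.Finite) :
    ∑ i ∈ Finset.range N, compliance (Set.Ioo (t i) (t (i + 1)) \ S) f
      ≤ compliance (Set.Ioo p q \ S) f := by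
  have hgrid := (Set.finite_Iic N).image t
  obtain ⟨u, u', hu⟩ := exists_isWeakSolution_Ioo_sdiff hpq (hS.union hgrid) hf
  rw [ht.sum_compliance_sdiff hf hS]
  refine compliance_mono (Set.sdiff_subset_sdiff_right Set.subset_union_left) ?_ hu
  exact (sdiff_null_ae_eq_self ((hS.union hgrid).measure_zero _)).trans
    (sdiff_null_ae_eq_self (hS.measure_zero _)).symm

end Cells

section ToReal

variable {a b : ℝ}

theorem toReal_apply (μ : ProbabilityMeasure (Set.Icc a b)) {s : Set ℝ} (hs : MeasurableSet s) :
    toReal μ s = (μ : Measure (Set.Icc a b)) (Subtype.val ⁻¹' s) :=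
  Measure.map_apply measurable_subtype_coe hs

instance (μ : ProbabilityMeasure (Set.Icc a b)) : IsProbabilityMeasure (toReal μ) :=
  Measure.isProbabilityMeasure_map measurable_subtype_coe.aemeasurable

theorem eventually_toReal_lt {y : ℕ → ProbabilityMeasure (Set.Icc a b)}
    {μ : ProbabilityMeasure (Set.Icc a b)} (hy : Tendsto y atTop (𝓝 μ)) {K : Set ℝ}
    (hK : IsClosed K) {r : ℝ≥0∞} (hr : toReal μ K < r) : ∀ᶠ n in atTop, toReal (y n) K < r := by
  simp only [toReal_apply _ hK.measurableSet] at hr ⊢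
  exact eventually_lt_of_limsup_lt
    ((ProbabilityMeasure.limsup_measure_closed_le_of_tendsto hy
      (hK.preimage continuous_subtype_val)).trans_lt hr)

end ToReal

/-- `n² · compliance of (a, b) \ S`, minimized over the finite sets `S ⊆ [a, b]` with at most
`n μ(A)` points in every Borel set `A`. It minorizes both `pointFunctional` and
`multiPointFunctional`, and already satisfies the lower bound of the `Γ`-limit. -/
noncomputable def sparseFunctional (a b : ℝ) (f : ℝ → ℝ) (n : ℕ)
    (μ : ProbabilityMeasure (Set.Icc a b)) : ℝ≥0∞ :=
  ⨅ (S : Finset (Set.Icc a b))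
    (_ : ∑ x ∈ S, Measure.dirac x ≤ (n : ℝ≥0∞) • (μ : Measure (Set.Icc a b))),
    (n : ℝ≥0∞) ^ 2 * pointCompliance a b f (S : Set (Set.Icc a b))

section Sparse

variable {a b : ℝ} {f : ℝ → ℝ} {n : ℕ} {μ : ProbabilityMeasure (Set.Icc a b)}

theorem sparseFunctional_le_pointFunctional :
    sparseFunctional a b f n μ ≤ pointFunctional a b f n μ := by
  refine le_iInf₂ fun S hS => iInf₂_le S ?_
  rw [hS.2, smul_smul]
  rcases S.eq_empty_or_nonempty with rfl | hne
  · simp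
  · have hcard : 1 ≤ (n : ℝ≥0∞) * (S.card : ℝ≥0∞)⁻¹ := by
      rw [← ENNReal.mul_inv_cancel (Nat.cast_ne_zero.2 hne.card_ne_zero) (ENNReal.natCast_ne_top _)]
      gcongr
      exact hS.1
    exact Measure.le_iff.2 fun A _ => le_mul_of_one_le_left zero_le hcard

theorem sparseFunctional_le_multiPointFunctional :
    sparseFunctional a b f n μ ≤ multiPointFunctional a b f n μ := by
  classical
  refine le_iInf₂ fun x hx => (iInf₂_le (Finset.univ.image x) ?_).trans_eq (by simp)
  have himage : ∑ z ∈ Finset.univ.image x, Measure.dirac z ≤ ∑ i, Measure.dirac (x i) :=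
    Finset.sum_image_le_of_nonneg fun _ _ => Measure.zero_le _
  rcases Nat.eq_zero_or_pos n with rfl | hn
  · simp
  · rwa [hx, smul_smul, ENNReal.mul_inv_cancel (Nat.cast_ne_zero.2 hn.ne')
      (ENNReal.natCast_ne_top _), one_smul]

theorem ncard_inter_le_mul_toReal {S : Finset (Set.Icc a b)}
    (hS : ∑ x ∈ S, Measure.dirac x ≤ (n : ℝ≥0∞) • (μ : Measure (Set.Icc a b))) {A : Set ℝ}
    (hA : MeasurableSet A) :
    (((Subtype.val '' (S : Set (Set.Icc a b))) ∩ A).ncard : ℝ) ≤ n * (toReal μ).real A := by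
  classical
  have hcard : ((Subtype.val '' (S : Set (Set.Icc a b))) ∩ A).ncard
      = {x ∈ S | x.1 ∈ A}.card := by
    rw [← Set.image_inter_preimage, Set.ncard_image_of_injective _ Subtype.val_injective,
      ← Set.ncard_coe_finset, Finset.coe_filter]
    rfl
  have hle : ({x ∈ S | x.1 ∈ A}.card : ℝ≥0∞) ≤ n * toReal μ A := by
    refine Eq.trans_le ?_ ((hS (Subtype.val ⁻¹' A)).trans_eq ?_)
    · simp [Measure.dirac_apply' _ (measurable_subtype_coe hA), Set.indicator_apply]
    · rw [Measure.smul_apply, smul_eq_mul, toReal_apply μ hA]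
  have hfin := ENNReal.toReal_mono
    (ENNReal.mul_ne_top (ENNReal.natCast_ne_top n) (measure_ne_top _ A)) hle
  rwa [ENNReal.toReal_mul, ENNReal.toReal_natCast, ENNReal.toReal_natCast, ← hcard] at hfin

end Sparse

theorem ae_tendsto_measure_Icc_div (ν : Measure ℝ) [IsLocallyFiniteMeasure ν] :
    ∀ᵐ x, ∀ p q : ℕ → ℝ, (∀ k, p k < q k) → (∀ k, x ∈ Set.Icc (p k) (q k)) →
      Tendsto (fun k => q k - p k) atTop (𝓝 0) →
      Tendsto (fun k => ν (Set.Icc (p k) (q k)) / ENNReal.ofReal (q k - p k)) atTop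
        (𝓝 (ν.rnDeriv volume x)) := by
  filter_upwards [(IsUnifLocDoublingMeasure.vitaliFamily volume 1).ae_tendsto_rnDeriv ν]
    with x hx p q hpq hxpq hlim
  have hradius : Tendsto (fun k => (q k - p k) / 2) atTop (𝓝[>] 0) :=
    tendsto_nhdsWithin_iff.2 ⟨by simpa using hlim.div_const 2,
      .of_forall fun k => half_pos (sub_pos.2 (hpq k))⟩
  have hball : ∀ k, Metric.closedBall ((p k + q k) / 2) ((q k - p k) / 2) = Set.Icc (p k) (q k) :=
    fun k => by rw [Real.closedBall_eq_Icc]; congr 1 <;> ring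
  have hfilter := IsUnifLocDoublingMeasure.tendsto_closedBall_filterAt volume (K := 1) (x := x)
    (fun k => (p k + q k) / 2) _ hradius (.of_forall fun k => by rw [one_mul, hball]; exact hxpq k)
  refine (hx.comp hfilter).congr fun k => ?_
  simp only [Function.comp_apply, hball, Real.volume_Icc]

theorem le_const_mul_liminf_add {ι : Type*} {l : Filter ι} {F : ι → ℝ≥0∞} {A c e : ℝ≥0∞}
    (hc : c ≠ 0) (hc' : c ≠ ∞) (h : ∀ᶠ i in l, A ≤ c * F i + e) : A ≤ c * liminf F l + e := by
  rw [← tsub_le_iff_right, ← ENNReal.div_le_iff' hc hc']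
  refine le_liminf_of_le (by isBoundedDefault) (h.mono fun i hi => ?_)
  rwa [ENNReal.div_le_iff' hc hc', tsub_le_iff_right]

section Liminf

variable {a b ε θ : ℝ} {f : ℝ → ℝ} {M : ℕ} {μ : ProbabilityMeasure (Set.Icc a b)}
  {y : ℕ → ProbabilityMeasure (Set.Icc a b)}

theorem eventually_ncard_inter_add_ceil_le (hy : Tendsto y atTop (𝓝 μ)) {K A : Set ℝ}
    (hK : IsClosed K) (hA : MeasurableSet A) (hAK : A ⊆ K) {η : ℝ} (hη : 0 < η) :
    ∀ᶠ n : ℕ in atTop, ∀ S : Finset (Set.Icc a b),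
      ∑ x ∈ S, Measure.dirac x ≤ (n : ℝ≥0∞) • (y n : Measure (Set.Icc a b)) →
      (((Subtype.val '' (S : Set (Set.Icc a b))) ∩ A).ncard : ℝ) + ⌈n * η / 3⌉₊
        ≤ n * ((toReal μ).real K + η) := by
  have hlt : toReal μ K < toReal μ K + ENNReal.ofReal (η / 3) :=
    ENNReal.lt_add_right (measure_ne_top _ _) (ENNReal.ofReal_pos.2 (by positivity)).ne'
  filter_upwards [eventually_toReal_lt hy hK hlt,
    (tendsto_natCast_atTop_atTop (R := ℝ)).eventually_ge_atTop (3 / η)] with n hn hn' S hS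
  have hmass : (toReal (y n)).real K ≤ (toReal μ).real K + η / 3 := by
    have h := ENNReal.toReal_mono (by finiteness) hn.le
    rwa [ENNReal.toReal_add (measure_ne_top _ _) ENNReal.ofReal_ne_top,
      ENNReal.toReal_ofReal (by positivity)] at h
  have hceil : (⌈n * η / 3⌉₊ : ℝ) ≤ n * η / 3 + 1 := (Nat.ceil_lt_add_one (by positivity)).le
  have hone : 1 ≤ n * η / 3 := by
    rw [div_le_iff₀ hη] at hn'
    linarith
  calc (((Subtype.val '' (S : Set (Set.Icc a b))) ∩ A).ncard : ℝ) + ⌈n * η / 3⌉₊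
      ≤ n * (toReal (y n)).real A + (n * η / 3 + 1) :=
        add_le_add (ncard_inter_le_mul_toReal hS hA) hceil
    _ ≤ n * ((toReal μ).real K + η / 3) + (n * η / 3 + n * η / 3) := by
        gcongr
        exact (measureReal_mono hAK).trans hmass
    _ = n * ((toReal μ).real K + η) := by ring

/-- The contribution of the `i`-th cell of the equipartition of `[a, b]` into `M` cells to
`∫ f² / ρ²`, where `ρ` is `ε` plus the mean density of `ν` on that cell. -/
noncomputable def cellFunctional (a b : ℝ) (f : ℝ → ℝ) (ν : Measure ℝ) (ε : ℝ) (M i : ℕ) (x : ℝ) :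
    ℝ≥0∞ :=
  (Set.Ioo (equipartition a b M i) (equipartition a b M (i + 1))).indicator (fun x =>
    ENNReal.ofReal (f x ^ 2) /
      (ν (Set.Icc (equipartition a b M i) (equipartition a b M (i + 1))) /
        ENNReal.ofReal (equipartition a b M (i + 1) - equipartition a b M i) +
        ENNReal.ofReal ε) ^ 2) x

theorem lintegral_cellFunctional_le (hab : a < b) (hf : MemLp f 2 (volume.restrict (Set.Ioo a b)))
    {i m n : ℕ} (hi : i < M) (hn : 0 < n) (hε : 0 < ε) (hθ : 0 < θ) (c : ℝ) {S : Set ℝ}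
    (hS : S.Finite) (hm : n * (ε * ((b - a) / M)) / 3 ≤ m)
    (hcount : ((S ∩ Set.Ioo (equipartition a b M i) (equipartition a b M (i + 1))).ncard : ℝ) + m
      ≤ n * ((toReal μ).real (Set.Icc (equipartition a b M i) (equipartition a b M (i + 1))) +
        ε * ((b - a) / M))) :
    ∫⁻ x, cellFunctional a b f (toReal μ) ε M i x ≤ ENNReal.ofReal (12 * (1 + θ) ^ 2 * n ^ 2) *
        compliance (Set.Ioo (equipartition a b M i) (equipartition a b M (i + 1)) \ S) f +
      ENNReal.ofReal ((1 + θ⁻¹) * (13 + 12 * θ) * (3 / ε) ^ 2 *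
        ∫ x in equipartition a b M i..equipartition a b M (i + 1), (f x - c) ^ 2) := by
  have hM : M ≠ 0 := i.zero_le.trans_lt hi |>.ne'
  have ht := isPartition_equipartition hab hM
  have hlen := equipartition_succ_sub a b M i
  have hlen0 := sub_pos.2 (ht.lt_succ hi)
  rw [← hlen] at hm hcount
  have hn' : (0 : ℝ) < n := Nat.cast_pos.2 hn
  have hm0 : m ≠ 0 := fun h => by
    rw [h, Nat.cast_zero] at hm
    exact (lt_of_lt_of_le (by positivity) hm).false
  set p := equipartition a b M i
  set q := equipartition a b M (i + 1)
  have hdensity : toReal μ (Set.Icc p q) / ENNReal.ofReal (q - p) + ENNReal.ofReal ε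
      = ENNReal.ofReal ((toReal μ).real (Set.Icc p q) / (q - p) + ε) := by
    rw [ENNReal.ofReal_add (by positivity) hε.le, ENNReal.ofReal_div_of_pos hlen0,
      ofReal_measureReal]
  simp only [cellFunctional]
  rw [lintegral_indicator measurableSet_Ioo, hdensity]
  refine setLIntegral_sq_div_le_compliance (ht.lt_succ hi) (hf.mono_measure
    (Measure.restrict_mono (ht.Ioo_subset hi) le_rfl)) c hθ hS hm0 hn' (hcount.trans_eq ?_) ?_
  · field_simp
    rfl
  · rw [div_mul_eq_mul_div, le_div_iff₀ hε]
    linarith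

theorem eventually_sum_lintegral_cellFunctional_le (hab : a < b)
    (hf : MemLp f 2 (volume.restrict (Set.Ioo a b))) (hy : Tendsto y atTop (𝓝 μ)) (hM : M ≠ 0)
    (hε : 0 < ε) (hθ : 0 < θ) (c : ℕ → ℝ) :
    ∀ᶠ n in atTop, ∑ i ∈ Finset.range M, ∫⁻ x, cellFunctional a b f (toReal μ) ε M i x
      ≤ ENNReal.ofReal (12 * (1 + θ) ^ 2) * sparseFunctional a b f n (y n) +
        ENNReal.ofReal ((1 + θ⁻¹) * (13 + 12 * θ) * (3 / ε) ^ 2 * ∑ i ∈ Finset.range M,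
          ∫ x in equipartition a b M i..equipartition a b M (i + 1), (f x - c i) ^ 2) := by
  have ht := isPartition_equipartition hab hM
  have hℓ : 0 < (b - a) / M := div_pos (sub_pos.2 hab) (Nat.cast_pos.2 (Nat.pos_of_ne_zero hM))
  have hcount : ∀ᶠ n in atTop, ∀ i ∈ Set.Iio M, _ := (Set.finite_Iio M).eventually_all.2 fun i _ =>
    eventually_ncard_inter_add_ceil_le hy isClosed_Icc measurableSet_Ioo
      (Set.Ioo_subset_Icc_self (a := equipartition a b M i) (b := equipartition a b M (i + 1)))
      (mul_pos hε hℓ)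
  have hc0 : ENNReal.ofReal (12 * (1 + θ) ^ 2) ≠ 0 := (ENNReal.ofReal_pos.2 (by positivity)).ne'
  filter_upwards [hcount, eventually_gt_atTop 0] with n hn hn0
  rw [← tsub_le_iff_right, ← ENNReal.div_le_iff' hc0 ENNReal.ofReal_ne_top]
  refine le_iInf₂ fun S hS => ?_
  rw [ENNReal.div_le_iff' hc0 ENNReal.ofReal_ne_top, tsub_le_iff_right]
  have hSfin : (Subtype.val '' (S : Set (Set.Icc a b))).Finite := S.finite_toSet.image _
  refine (Finset.sum_le_sum fun i hi => lintegral_cellFunctional_le hab hf (Finset.mem_range.1 hi)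
    hn0 hε hθ (c i) hSfin (Nat.le_ceil _) (hn i (Finset.mem_range.1 hi) S hS)).trans ?_
  rw [Finset.sum_add_distrib, ← Finset.mul_sum, ← ENNReal.ofReal_sum_of_nonneg fun i hi =>
      mul_nonneg (by positivity) (intervalIntegral.integral_nonneg
        (ht.lt_succ (Finset.mem_range.1 hi)).le fun x _ => sq_nonneg _), ← Finset.mul_sum]
  gcongr ?_ + _
  rw [ENNReal.ofReal_mul (by positivity), mul_assoc, ENNReal.ofReal_pow (Nat.cast_nonneg n),
    ENNReal.ofReal_natCast]
  gcongr
  exact ht.sum_compliance_sdiff_le hab hf hSfin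

theorem aemeasurable_cellFunctional {ν κ : Measure ℝ} (hf : AEMeasurable f κ) (i : ℕ) :
    AEMeasurable (cellFunctional a b f ν ε M i) κ :=
  ((hf.pow_const 2).ennreal_ofReal.div_const _).indicator measurableSet_Ioo

theorem sum_cellFunctional_eq (hab : a < b) {ν : Measure ℝ} {i : ℕ} (hi : i < M) {x : ℝ}
    (hx : x ∈ Set.Ioo (equipartition a b M i) (equipartition a b M (i + 1))) :
    ∑ j ∈ Finset.range M, cellFunctional a b f ν ε M j x = ENNReal.ofReal (f x ^ 2) /
      (ν (Set.Icc (equipartition a b M i) (equipartition a b M (i + 1))) /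
        ENNReal.ofReal (equipartition a b M (i + 1) - equipartition a b M i) +
        ENNReal.ofReal ε) ^ 2 := by
  have ht := isPartition_equipartition hab (i.zero_le.trans_lt hi).ne'
  simp only [cellFunctional]
  rw [Finset.sum_eq_single_of_mem i (Finset.mem_range.2 hi) fun j hj hji =>
    Set.indicator_of_notMem (fun hxj => ?_) _]
  · exact Set.indicator_of_mem hx _
  · exact Set.disjoint_left.1 (ht.pairwise_disjoint (i := ⟨j, Finset.mem_range.1 hj⟩) (j := ⟨i, hi⟩)
      (Fin.ne_of_val_ne hji)) hxj hx

theorem ae_tendsto_sum_cellFunctional (hab : a < b) (f : ℝ → ℝ) (ν : Measure ℝ)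
    [IsLocallyFiniteMeasure ν] {ε : ℕ → ℝ} {ε₀ : ℝ} (hε : Tendsto ε atTop (𝓝 ε₀)) {M : ℕ → ℕ}
    (hM : Tendsto M atTop atTop) (hM0 : ∀ k, M k ≠ 0) :
    ∀ᵐ x ∂volume.restrict (Set.Icc a b),
      Tendsto (fun k => ∑ i ∈ Finset.range (M k), cellFunctional a b f ν (ε k) (M k) i x) atTop
        (𝓝 (ENNReal.ofReal (f x ^ 2) / (ν.rnDeriv volume x + ENNReal.ofReal ε₀) ^ 2)) := by
  have hgrid : (Set.range fun z : ℕ × ℕ => equipartition a b (M z.1) z.2).Countable :=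
    Set.countable_range _
  rw [← restrict_Ioo_eq_restrict_Icc]
  filter_upwards [ae_restrict_mem measurableSet_Ioo, ae_restrict_of_ae (hgrid.ae_notMem volume),
    ae_restrict_of_ae (ae_tendsto_measure_Icc_div ν)] with x hx hxgrid hxρ
  choose j hjM hjx hxj using fun k =>
    (isPartition_equipartition hab (hM0 k)).exists_le_lt (Set.Ioo_subset_Ico_self hx)
  have hmem : ∀ k, x ∈ Set.Ioo (equipartition a b (M k) (j k))
      (equipartition a b (M k) (j k + 1)) :=
    fun k => ⟨(hjx k).lt_of_ne fun h => hxgrid ⟨(k, j k), h⟩, hxj k⟩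
  simp only [sum_cellFunctional_eq hab (hjM _) (hmem _)]
  rcases eq_or_ne (f x) 0 with hfx | hfx
  · simp [hfx]
  have hlen : Tendsto (fun k => equipartition a b (M k) (j k + 1) - equipartition a b (M k) (j k))
      atTop (𝓝 0) := by
    simp only [equipartition_succ_sub]
    exact (tendsto_const_nhds.div_atTop tendsto_natCast_atTop_atTop).comp hM
  have hdensity := (hxρ _ _ (fun k => (hmem k).1.trans (hmem k).2)
    (fun k => Set.Ioo_subset_Icc_self (hmem k)) hlen).add (ENNReal.tendsto_ofReal hε)
  exact ENNReal.Tendsto.div tendsto_const_nhds (.inl (ENNReal.ofReal_pos.2 (by positivity)).ne')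
    (ENNReal.Tendsto.pow hdensity) (.inr ENNReal.ofReal_ne_top)

theorem eventually_sum_lintegral_cellFunctional_le_liminf (hab : a < b)
    (hf : MemLp f 2 (volume.restrict (Set.Ioo a b))) (hy : Tendsto y atTop (𝓝 μ)) (hε : 0 < ε) :
    ∀ᶠ M in atTop, ∑ i ∈ Finset.range M, ∫⁻ x, cellFunctional a b f (toReal μ) ε M i x
      ≤ ENNReal.ofReal (12 * (1 + ε) ^ 2) *
          liminf (fun n => sparseFunctional a b f n (y n)) atTop +
        ENNReal.ofReal (9 * ε * (1 + ε) * (13 + 12 * ε)) := by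
  have hω : 0 < ε ^ 4 := by positivity
  filter_upwards [eventually_exists_sum_integral_sub_sq_le hab hf hω, eventually_ne_atTop 0]
    with M ⟨c, hc⟩ hM
  refine le_const_mul_liminf_add (ENNReal.ofReal_pos.2 (by positivity)).ne' ENNReal.ofReal_ne_top ?_
  filter_upwards [eventually_sum_lintegral_cellFunctional_le hab hf hy hM hε hε c] with n hn
  refine hn.trans (add_le_add le_rfl (ENNReal.ofReal_le_ofReal ?_))
  calc _ ≤ (1 + ε⁻¹) * (13 + 12 * ε) * (3 / ε) ^ 2 * ε ^ 4 := by gcongr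
    _ = 9 * ε * (1 + ε) * (13 + 12 * ε) := by
        field_simp
        ring

theorem limitFunctional_le_liminf_sparseFunctional (hab : a < b)
    (hf : MemLp f 2 (volume.restrict (Set.Icc a b))) (hy : Tendsto y atTop (𝓝 μ)) :
    limitFunctional a b f μ ≤ liminf (fun n => sparseFunctional a b f n (y n)) atTop := by
  set L := liminf (fun n => sparseFunctional a b f n (y n)) atTop
  let ε : ℕ → ℝ := fun k => 1 / ((k : ℝ) + 1)
  have hε : Tendsto ε atTop (𝓝 0) := tendsto_one_div_add_atTop_nhds_zero_nat
  have hfmeas := hf.1.aemeasurable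
  rw [← restrict_Ioo_eq_restrict_Icc] at hf
  choose M hM hkM using fun k => ((eventually_sum_lintegral_cellFunctional_le_liminf hab hf hy
    (Nat.one_div_pos_of_nat (α := ℝ) (n := k))).and (eventually_gt_atTop k)).exists
  have hbound : Tendsto (fun k => ENNReal.ofReal (12 * (1 + ε k) ^ 2) * L +
      ENNReal.ofReal (9 * ε k * (1 + ε k) * (13 + 12 * ε k))) atTop (𝓝 (12 * L)) := by
    have hc : Tendsto (fun k => ENNReal.ofReal (12 * (1 + ε k) ^ 2)) atTop (𝓝 12) := by
      simpa using ENNReal.tendsto_ofReal (((hε.const_add 1).pow 2).const_mul 12)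
    have he : Tendsto (fun k => ENNReal.ofReal (9 * ε k * (1 + ε k) * (13 + 12 * ε k))) atTop
        (𝓝 0) := by
      simpa using ENNReal.tendsto_ofReal
        (((hε.const_mul 9).mul (hε.const_add 1)).mul ((hε.const_mul 12).const_add 13))
    simpa using (ENNReal.Tendsto.mul_const hc (.inl (by simp))).add he
  have hmeas (k : ℕ) : ∀ i ∈ Finset.range (M k), AEMeasurable
      (cellFunctional a b f (toReal μ) (ε k) (M k) i) (volume.restrict (Set.Icc a b)) := fun i _ =>
    aemeasurable_cellFunctional hfmeas i
  have hfatou : ∫⁻ x in Set.Icc a b, ENNReal.ofReal (f x ^ 2) / (toReal μ).rnDeriv volume x ^ 2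
      ≤ 12 * L := by
    have hlim := ae_tendsto_sum_cellFunctional hab f (toReal μ) hε
      (tendsto_atTop_mono (fun k => (hkM k).le) tendsto_id) fun k => (hkM k).ne_bot
    refine (lintegral_congr_ae (hlim.mono fun x hx => ?_)).trans_le
      ((lintegral_liminf_le' (u := atTop) fun k =>
        Finset.aemeasurable_fun_sum _ (hmeas k)).trans ?_)
    · rw [hx.liminf_eq, ENNReal.ofReal_zero, add_zero]
    rw [← hbound.liminf_eq]
    refine liminf_le_liminf (.of_forall fun k => le_trans ?_ (hM k))
    rw [lintegral_finsetSum' _ (hmeas k)]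
    exact Finset.sum_le_sum fun i _ => setLIntegral_le_lintegral _ _
  rw [limitFunctional, one_div]
  rwa [← ENNReal.div_eq_inv_mul, ENNReal.div_le_iff' (by simp) (by simp)]

end Liminf

section UpperEnergy

variable {p q θ η : ℝ} {f : ℝ → ℝ}

theorem gapEnergy_le_sq_mul_integral_add (hpq : p < q)
    (hf : MemLp f 2 (volume.restrict (Set.Ioo p q))) (c : ℝ) (hθ : 0 < θ) :
    gapEnergy f p q ≤ (q - p) ^ 2 * ((1 + θ) ^ 2 * ((∫ x in p..q, f x ^ 2) / 12) +
      (1 + θ⁻¹) * ((13 + θ) / 12) * ∫ x in p..q, (f x - c) ^ 2) := by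
  have hconst := mul_le_mul_of_nonneg_left (const_sq_mul_le_integral_sq hpq.le hf c hθ)
    (by positivity : 0 ≤ (1 + θ) * ((q - p) ^ 2 / 12))
  refine (gapEnergy_le_of_const hpq hf c hθ).trans ?_
  linarith

theorem eventually_sq_mul_sum_gapEnergy_le (hpq : p < q)
    (hf : MemLp f 2 (volume.restrict (Set.Ioo p q))) (hη : 0 < η) :
    ∀ᶠ m : ℕ in atTop, (m : ℝ) ^ 2 * ∑ i ∈ Finset.range m,
        gapEnergy f (equipartition p q m i) (equipartition p q m (i + 1))
      ≤ (q - p) ^ 2 * ((∫ x in p..q, f x ^ 2) / 12 + η) := by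
  set I := ∫ x in p..q, f x ^ 2 with hI
  obtain ⟨θ, hθI, hθ⟩ : ∃ θ : ℝ, (1 + θ) ^ 2 * (I / 12) < I / 12 + η / 2 ∧ 0 < θ := by
    have hlim : Tendsto (fun θ : ℝ => (1 + θ) ^ 2 * (I / 12)) (𝓝[>] 0) (𝓝 (I / 12)) :=
      (Continuous.tendsto' (by fun_prop) _ _ (by simp)).mono_left nhdsWithin_le_nhds
    exact ((hlim.eventually_lt_const (by linarith)).and self_mem_nhdsWithin).exists
  set K := (1 + θ⁻¹) * ((13 + θ) / 12)
  have hK : 0 < K := by positivity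
  filter_upwards [eventually_exists_sum_integral_sub_sq_le hpq hf
    (by positivity : 0 < η / (2 * K)), eventually_ne_atTop 0] with m ⟨c, hc⟩ hm
  have ht := isPartition_equipartition hpq hm
  have hfi : IntervalIntegrable (fun x => f x ^ 2) volume p q :=
    (intervalIntegrable_iff_integrableOn_Ioo_of_le hpq.le).2 hf.integrable_sq
  have hsum := Finset.sum_le_sum fun i (hi : i ∈ Finset.range m) =>
    gapEnergy_le_sq_mul_integral_add (ht.lt_succ (Finset.mem_range.1 hi)) (hf.mono_measure
      (Measure.restrict_mono (ht.Ioo_subset (Finset.mem_range.1 hi)) le_rfl)) (c i) hθ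
  simp only [equipartition_succ_sub] at hsum
  rw [← Finset.mul_sum, Finset.sum_add_distrib, ← Finset.mul_sum, ← Finset.mul_sum,
    ← Finset.sum_div, ht.sum_integral hfi, ← hI] at hsum
  have hm' : (m : ℝ) ≠ 0 := Nat.cast_ne_zero.2 hm
  calc _ ≤ (m : ℝ) ^ 2 * (((q - p) / m) ^ 2 * ((1 + θ) ^ 2 * (I / 12) + K * (η / (2 * K)))) := by
        refine mul_le_mul_of_nonneg_left (hsum.trans ?_) (sq_nonneg _)
        gcongr
    _ = (q - p) ^ 2 * ((1 + θ) ^ 2 * (I / 12) + η / 2) := by field_simp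
    _ ≤ (q - p) ^ 2 * (I / 12 + η) := by
        exact mul_le_mul_of_nonneg_left (by linarith) (sq_nonneg _)

theorem eventually_sq_mul_sum_gapEnergy_le_div (hpq : p < q)
    (hf : MemLp f 2 (volume.restrict (Set.Ioo p q))) (hη : 0 < η) {m : ℕ → ℕ} {w : ℝ} (hw : 0 < w)
    (hm : Tendsto (fun n => (m n / n : ℝ)) atTop (𝓝 w)) :
    ∀ᶠ n : ℕ in atTop, (n : ℝ) ^ 2 * ∑ i ∈ Finset.range (m n),
        gapEnergy f (equipartition p q (m n) i) (equipartition p q (m n) (i + 1))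
      ≤ (q - p) ^ 2 * ((∫ x in p..q, f x ^ 2) / 12 + η) / (m n / n) ^ 2 := by
  have hm_top : Tendsto m atTop atTop :=
    (tendsto_natCast_atTop_iff (R := ℝ)).1 <|
      (hm.pos_mul_atTop hw tendsto_natCast_atTop_atTop).congr' <| by
        filter_upwards [eventually_ne_atTop 0] with n hn
        field_simp
  filter_upwards [hm_top.eventually (eventually_sq_mul_sum_gapEnergy_le hpq hf hη),
    hm.eventually_const_lt hw] with n hle hpos
  rw [le_div_iff₀ (pow_pos hpos 2)]
  refine Eq.trans_le ?_ hle
  have hn0 : (n : ℝ) ≠ 0 := fun h => by simp [h] at hpos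
  field_simp

theorem eventually_sum_gapEnergy_lt {M : ℕ} {t : ℕ → ℝ} (ht : IsPartition p q M t)
    (hf : MemLp f 2 (volume.restrict (Set.Ioo p q))) {m : ℕ → ℕ → ℕ} {w : ℕ → ℝ}
    (hw : ∀ j < M, 0 < w j) (hm : ∀ j < M, Tendsto (fun n => (m n j / n : ℝ)) atTop (𝓝 (w j)))
    {C : ℝ} (hC : ∑ j ∈ Finset.range M,
      (t (j + 1) - t j) ^ 2 * ((∫ x in t j..t (j + 1), f x ^ 2) / 12) / w j ^ 2 < C) :
    ∀ᶠ n : ℕ in atTop, (n : ℝ) ^ 2 * ∑ j ∈ Finset.range M, ∑ i ∈ Finset.range (m n j),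
      gapEnergy f (equipartition (t j) (t (j + 1)) (m n j) i)
        (equipartition (t j) (t (j + 1)) (m n j) (i + 1)) < C := by
  set A : ℕ → ℝ → ℝ := fun j η =>
    (t (j + 1) - t j) ^ 2 * ((∫ x in t j..t (j + 1), f x ^ 2) / 12 + η)
  obtain ⟨η, hηC, hη⟩ : ∃ η : ℝ, ∑ j ∈ Finset.range M, A j η / w j ^ 2 < C ∧ 0 < η := by
    have hlim : Tendsto (fun η => ∑ j ∈ Finset.range M, A j η / w j ^ 2) (𝓝[>] 0)
        (𝓝 (∑ j ∈ Finset.range M, A j 0 / w j ^ 2)) :=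
      (Continuous.tendsto (by fun_prop) _).mono_left nhdsWithin_le_nhds
    refine ((hlim.eventually_lt_const ?_).and self_mem_nhdsWithin).exists
    simpa only [A, add_zero] using hC
  have hlim : Tendsto (fun n : ℕ => ∑ j ∈ Finset.range M, A j η / (m n j / n : ℝ) ^ 2) atTop
      (𝓝 (∑ j ∈ Finset.range M, A j η / w j ^ 2)) :=
    tendsto_finsetSum _ fun j hj => tendsto_const_nhds.div ((hm j (Finset.mem_range.1 hj)).pow 2)
      (pow_pos (hw j (Finset.mem_range.1 hj)) 2).ne'
  have hcell : ∀ᶠ n in atTop, ∀ j ∈ Set.Iio M, _ := (Set.finite_Iio M).eventually_all.2 fun j hj =>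
    eventually_sq_mul_sum_gapEnergy_le_div (ht.lt_succ hj) (hf.mono_measure
      (Measure.restrict_mono (ht.Ioo_subset hj) le_rfl)) hη (hw j hj) (hm j hj)
  filter_upwards [hlim.eventually_lt_const hηC, hcell] with n hn hcell
  rw [Finset.mul_sum]
  exact (Finset.sum_le_sum fun j hj => hcell j (Finset.mem_range.1 hj)).trans_lt hn

end UpperEnergy

theorem exists_sum_eq_tendsto_div {M : ℕ} {w : ℕ → ℝ} (hw : ∀ j, 0 ≤ w j)
    (hw1 : ∑ j ∈ Finset.range M, w j = 1) :
    ∃ m : ℕ → ℕ → ℕ, (∀ n, ∑ j ∈ Finset.range M, m n j = n) ∧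
      ∀ j, Tendsto (fun n => (m n j / n : ℝ)) atTop (𝓝 (w j)) := by
  set W : ℕ → ℝ := fun j => ∑ i ∈ Finset.range j, w i
  have hW : Monotone W := monotone_nat_of_le_succ fun j => by
    simp only [W, Finset.sum_range_succ]
    linarith [hw j]
  have hW0 : ∀ j, 0 ≤ W j := fun j => Finset.sum_nonneg fun i _ => hw i
  have hfloor : ∀ n : ℕ, Monotone fun j => ⌊W j * n⌋₊ := fun n i j hij =>
    Nat.floor_mono (mul_le_mul_of_nonneg_right (hW hij) n.cast_nonneg)
  refine ⟨fun n j => ⌊W (j + 1) * n⌋₊ - ⌊W j * n⌋₊, fun n => ?_, fun j => ?_⟩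
  · rw [Finset.sum_range_tsub (hfloor n)]
    simp [W, hw1]
  · have hlim : ∀ j, Tendsto (fun n : ℕ => (⌊W j * n⌋₊ / n : ℝ)) atTop (𝓝 (W j)) := fun j =>
      (tendsto_nat_floor_mul_div_atTop (hW0 j)).comp tendsto_natCast_atTop_atTop
    convert (hlim (j + 1)).sub (hlim j) using 2 with n
    · rw [Nat.cast_sub (hfloor n j.le_succ), sub_div]
    · simp [W, Finset.sum_range_succ]

/-- The index `i < N` of the cell `[t i, t (i + 1))` containing `x`, the last cell being closed
on the right. -/
noncomputable def cellIndex (t : ℕ → ℝ) (N : ℕ) (x : ℝ) : ℕ :=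
  open scoped Classical in Nat.findGreatest (fun i => t i ≤ x) (N - 1)

section CellIndex

variable {a b x : ℝ} {N i : ℕ} {t : ℕ → ℝ}

theorem measurable_cellIndex : Measurable (cellIndex t N) := by
  classical
  exact measurable_findGreatest fun _ _ => measurableSet_Ici

theorem cellIndex_lt (hN : N ≠ 0) : cellIndex t N x < N :=
  (Nat.findGreatest_le _).trans_lt (Nat.sub_one_lt hN)

theorem IsPartition.cellIndex_eq (ht : IsPartition a b N t) (hi : i < N)
    (hx : x ∈ Set.Ico (t i) (t (i + 1))) : cellIndex t N x = i := by
  classical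
  refine Nat.findGreatest_eq_iff.2 ⟨Nat.le_sub_one_of_lt hi, fun _ => hx.1, fun j hij hj hle => ?_⟩
  exact (hle.trans_lt hx.2).not_ge (ht.le_of_le hij (by omega))

theorem IsPartition.mem_Icc_cellIndex (ht : IsPartition a b N t) (hN : N ≠ 0)
    (hx : x ∈ Set.Icc a b) : x ∈ Set.Icc (t (cellIndex t N x)) (t (cellIndex t N x + 1)) := by
  classical
  refine ⟨Nat.findGreatest_spec (P := fun i => t i ≤ x) (Nat.zero_le _) (ht.left.trans_le hx.1), ?_⟩
  rcases (Nat.succ_le_of_lt (cellIndex_lt hN)).lt_or_eq with h | h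
  · exact (not_le.1 (Nat.findGreatest_is_greatest (P := fun i => t i ≤ x)
      (Nat.lt_succ_self (cellIndex t N x)) (Nat.le_sub_one_of_lt h))).le
  · exact hx.2.trans_eq (ht.right.symm.trans (congrArg t h.symm))

end CellIndex

/-- The points dividing the `j`-th cell of the partition `t` into `m j` intervals of equal length,
left end included and right end excluded, for all `j < N`. -/
noncomputable def refinedGrid (t : ℕ → ℝ) (N : ℕ) (m : ℕ → ℕ) : Finset ℝ :=
  open scoped Classical in (Finset.range N).biUnion fun j =>
    (Finset.range (m j)).image (equipartition (t j) (t (j + 1)) (m j))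

section RefinedGrid

variable {a b : ℝ} {N j : ℕ} {t : ℕ → ℝ} {m : ℕ → ℕ} {f : ℝ → ℝ}

theorem IsPartition.equipartition_mem_Ico (ht : IsPartition a b N t) (hj : j < N) {i : ℕ}
    (hi : i < m j) :
    equipartition (t j) (t (j + 1)) (m j) i ∈ Set.Ico (t j) (t (j + 1)) := by
  have he := isPartition_equipartition (ht.lt_succ hj) (i.zero_le.trans_lt hi).ne'
  exact ⟨(he.mem_Icc hi.le).1, (he.lt_succ hi).trans_le (he.mem_Icc hi).2⟩

theorem IsPartition.refinedGrid_subset (ht : IsPartition a b N t) :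
    (refinedGrid t N m : Set ℝ) ⊆ Set.Icc a b := by
  intro x hx
  simp only [refinedGrid, Finset.mem_coe, Finset.mem_biUnion, Finset.mem_range,
    Finset.mem_image] at hx
  obtain ⟨j, hj, i, hi, rfl⟩ := hx
  exact Set.Icc_subset_Icc (ht.mem_Icc hj.le).1 (ht.mem_Icc hj).2
    (Set.Ico_subset_Icc_self (ht.equipartition_mem_Ico hj hi))

theorem IsPartition.filter_refinedGrid (ht : IsPartition a b N t) (hj : j < N) :
    {x ∈ refinedGrid t N m | cellIndex t N x = j}
      = open scoped Classical in
        (Finset.range (m j)).image (equipartition (t j) (t (j + 1)) (m j)) := by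
  classical
  ext x
  simp only [refinedGrid, Finset.mem_filter, Finset.mem_biUnion, Finset.mem_range,
    Finset.mem_image]
  constructor
  · rintro ⟨⟨k, hk, i, hi, rfl⟩, rfl⟩
    have hindex := ht.cellIndex_eq hk (ht.equipartition_mem_Ico hk hi)
    rw [hindex]
    exact ⟨i, hi, rfl⟩
  · rintro ⟨i, hi, rfl⟩
    exact ⟨⟨j, hj, i, hi, rfl⟩, ht.cellIndex_eq hj (ht.equipartition_mem_Ico hj hi)⟩

theorem IsPartition.card_filter_refinedGrid (ht : IsPartition a b N t) (hj : j < N) :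
    {x ∈ refinedGrid t N m | cellIndex t N x = j}.card = m j := by
  classical
  rw [ht.filter_refinedGrid hj, Finset.card_image_of_injOn, Finset.card_range]
  intro i hi k hk hik
  have hm : m j ≠ 0 := (i.zero_le.trans_lt (Finset.mem_range.1 hi)).ne'
  exact (isPartition_equipartition (ht.lt_succ hj) hm).strictMonoOn.injOn
    (Finset.mem_range.1 hi).le (Finset.mem_range.1 hk).le hik

theorem IsPartition.Ioo_sdiff_refinedGrid (ht : IsPartition a b N t) (hj : j < N) (hm : m j ≠ 0) :
    Set.Ioo (t j) (t (j + 1)) \ refinedGrid t N m = Set.Ioo (t j) (t (j + 1)) \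
      equipartition (t j) (t (j + 1)) (m j) '' Set.Iic (m j) := by
  have he := isPartition_equipartition (ht.lt_succ hj) hm
  refine Set.ext fun x => and_congr_right fun hx => not_congr ?_
  have hindex := ht.cellIndex_eq hj (Set.Ioo_subset_Ico_self hx)
  have hfilter : x ∈ refinedGrid t N m ↔ x ∈ {x ∈ refinedGrid t N m | cellIndex t N x = j} := by
    simp [hindex]
  rw [Finset.mem_coe, hfilter, ht.filter_refinedGrid hj]
  simp only [Finset.mem_image, Finset.mem_range]
  constructor
  · rintro ⟨i, hi, rfl⟩
    exact ⟨i, hi.le, rfl⟩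
  · rintro ⟨i, hi, rfl⟩
    exact ⟨i, (show i ≤ m j from hi).lt_of_ne fun h => hx.2.ne (h ▸ he.right), rfl⟩

theorem IsPartition.Ioo_sdiff_refinedGrid_union (ht : IsPartition a b N t)
    (hm : ∀ j < N, m j ≠ 0) :
    Set.Ioo a b \ (refinedGrid t N m ∪ t '' Set.Iic N) = Set.Ioo a b \ refinedGrid t N m := by
  refine Set.ext fun x => and_congr_right fun hx => not_congr ⟨?_, .inl⟩
  rintro (hmem | ⟨j, hj, rfl⟩)
  · exact hmem
  have hjN : j < N := (show j ≤ N from hj).lt_of_ne fun h => hx.2.ne (h ▸ ht.right)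
  simp only [refinedGrid, Finset.mem_coe, Finset.mem_biUnion, Finset.mem_range, Finset.mem_image]
  exact ⟨j, hjN, 0, Nat.pos_of_ne_zero (hm j hjN),
    (isPartition_equipartition (ht.lt_succ hjN) (hm j hjN)).left⟩

theorem IsPartition.compliance_sdiff_refinedGrid (ht : IsPartition a b N t)
    (hf : MemLp f 2 (volume.restrict (Set.Ioo a b))) (hm : ∀ j < N, m j ≠ 0) :
    compliance (Set.Ioo a b \ refinedGrid t N m) f
      = ENNReal.ofReal (∑ j ∈ Finset.range N, ∑ i ∈ Finset.range (m j),
          gapEnergy f (equipartition (t j) (t (j + 1)) (m j) i)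
            (equipartition (t j) (t (j + 1)) (m j) (i + 1))) := by
  have he {j : ℕ} (hj : j < N) := isPartition_equipartition (ht.lt_succ hj) (hm j hj)
  rw [← ht.Ioo_sdiff_refinedGrid_union hm, ← ht.sum_compliance_sdiff hf (Finset.finite_toSet _),
    ENNReal.ofReal_sum_of_nonneg fun j hj => Finset.sum_nonneg fun i hi => gapEnergy_nonneg
      ((he (Finset.mem_range.1 hj)).lt_succ (Finset.mem_range.1 hi)).le]
  refine Finset.sum_congr rfl fun j hj => ?_
  have hj := Finset.mem_range.1 hj
  rw [ht.Ioo_sdiff_refinedGrid hj (hm j hj), (he hj).compliance_sdiff (hf.mono_measure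
    (Measure.restrict_mono (ht.Ioo_subset hj) le_rfl))]

theorem IsPartition.exists_finset_pointCompliance_eq (ht : IsPartition a b N t)
    (hf : MemLp f 2 (volume.restrict (Set.Ioo a b))) (hm : ∀ j < N, m j ≠ 0) :
    ∃ S : Finset (Set.Icc a b), (∀ j < N, {x ∈ S | cellIndex t N x.1 = j}.card = m j) ∧
      pointCompliance a b f S = ENNReal.ofReal (∑ j ∈ Finset.range N, ∑ i ∈ Finset.range (m j),
        gapEnergy f (equipartition (t j) (t (j + 1)) (m j) i)
          (equipartition (t j) (t (j + 1)) (m j) (i + 1))) := by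
  classical
  set S := (refinedGrid t N m).subtype (· ∈ Set.Icc a b)
  have hS : S.map (.subtype _) = refinedGrid t N m :=
    Finset.subtype_map_of_mem fun x hx => ht.refinedGrid_subset hx
  refine ⟨S, fun j hj => ?_, ?_⟩
  · rw [← ht.card_filter_refinedGrid (m := m) hj, ← hS, Finset.filter_map, Finset.card_map]
    rfl
  · rw [← ht.compliance_sdiff_refinedGrid hf hm, ← hS, Finset.coe_map]
    rfl

end RefinedGrid

/-- `n² · compliance of (a, b) \ S`, minimized over the sets `S ⊆ [a, b]` with exactly `n` points
whose uniform probability measure is `μ`. It majorizes both `pointFunctional` and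
`multiPointFunctional`. -/
noncomputable def distinctPointFunctional (a b : ℝ) (f : ℝ → ℝ) (n : ℕ)
    (μ : ProbabilityMeasure (Set.Icc a b)) : ℝ≥0∞ :=
  ⨅ (S : Finset (Set.Icc a b))
    (_ : S.card = n ∧ (μ : Measure (Set.Icc a b)) = (n : ℝ≥0∞)⁻¹ • ∑ x ∈ S, Measure.dirac x),
    (n : ℝ≥0∞) ^ 2 * pointCompliance a b f (S : Set (Set.Icc a b))

section Distinct

variable {a b : ℝ} {f : ℝ → ℝ} {n : ℕ} {μ : ProbabilityMeasure (Set.Icc a b)}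

theorem pointFunctional_le_distinctPointFunctional :
    pointFunctional a b f n μ ≤ distinctPointFunctional a b f n μ :=
  le_iInf₂ fun S hS => iInf₂_le S ⟨hS.1.le, by rw [hS.1, hS.2]⟩

theorem multiPointFunctional_le_distinctPointFunctional :
    multiPointFunctional a b f n μ ≤ distinctPointFunctional a b f n μ := by
  refine le_iInf₂ fun S hS => ?_
  let e : Fin n ≃ S := (S.equivFinOfCardEq hS.1).symm
  refine (iInf₂_le (fun i => (e i).1) ?_).trans_eq ?_
  · rw [hS.2, e.sum_comp (fun x : S => Measure.dirac x.1), Finset.sum_coe_sort S Measure.dirac]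
  · rw [show Set.range (fun i => (e i).1) = S from
      (e.surjective.range_comp Subtype.val).trans Subtype.range_coe]

theorem exists_probabilityMeasure_eq_smul_sum_dirac {X : Type*} [MeasurableSpace X] {S : Finset X}
    (hS : S.Nonempty) :
    ∃ y : ProbabilityMeasure X, (y : Measure X) = (S.card : ℝ≥0∞)⁻¹ • ∑ x ∈ S, Measure.dirac x :=
  ⟨⟨_, ⟨by simp [ENNReal.inv_mul_cancel, hS.ne_empty]⟩⟩, rfl⟩

theorem exists_distinctPointFunctional_le {N : ℕ} {t : ℕ → ℝ} {m : ℕ → ℕ}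
    (ht : IsPartition a b N t) (hf : MemLp f 2 (volume.restrict (Set.Ioo a b)))
    (hm : ∀ j < N, m j ≠ 0) (hN : N ≠ 0) (hn : ∑ j ∈ Finset.range N, m j = n) :
    ∃ y : ProbabilityMeasure (Set.Icc a b),
      (∀ j < N, (y : Measure (Set.Icc a b)).real {x | cellIndex t N x = j} = m j / n) ∧
      distinctPointFunctional a b f n y
        ≤ ENNReal.ofReal (n ^ 2 * ∑ j ∈ Finset.range N, ∑ i ∈ Finset.range (m j),
            gapEnergy f (equipartition (t j) (t (j + 1)) (m j) i)
              (equipartition (t j) (t (j + 1)) (m j) (i + 1))) := by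
  obtain ⟨S, hcard, hcompl⟩ := ht.exists_finset_pointCompliance_eq hf hm
  have hSn : S.card = n := by
    rw [← hn, Finset.card_eq_sum_card_fiberwise (f := fun x => cellIndex t N x.1)
      (t := Finset.range N) fun x _ => Finset.mem_coe.2 (Finset.mem_range.2 (cellIndex_lt hN))]
    exact Finset.sum_congr rfl fun j hj => hcard j (Finset.mem_range.1 hj)
  have hS : S.Nonempty := Finset.card_pos.1 <| hSn ▸ hn ▸ (Nat.pos_of_ne_zero (hm 0
    (Nat.pos_of_ne_zero hN))).trans_le (Finset.single_le_sum_of_canonicallyOrdered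
      (Finset.mem_range.2 (Nat.pos_of_ne_zero hN)))
  obtain ⟨y, hy⟩ := exists_probabilityMeasure_eq_smul_sum_dirac hS
  rw [hSn] at hy
  refine ⟨y, fun j hj => ?_, (iInf₂_le S ⟨hSn, hy⟩).trans_eq ?_⟩
  · have hmeas : MeasurableSet {x : Set.Icc a b | cellIndex t N x = j} :=
      (measurable_cellIndex.comp measurable_subtype_coe) (measurableSet_singleton j)
    have hmass : (∑ x ∈ S, Measure.dirac x) {x : Set.Icc a b | cellIndex t N x = j} = m j := by
      simp [← hcard j hj, Measure.dirac_apply' _ hmeas, Set.indicator_apply]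
    rw [measureReal_def, hy, Measure.smul_apply, smul_eq_mul, hmass, ENNReal.toReal_mul,
      ENNReal.toReal_inv, ENNReal.toReal_natCast, ENNReal.toReal_natCast, inv_mul_eq_div]
  · rw [hcompl, ENNReal.ofReal_mul (by positivity), ENNReal.ofReal_pow n.cast_nonneg,
      ENNReal.ofReal_natCast]

theorem exists_distinctPointFunctional_le_tendsto {N : ℕ} {t : ℕ → ℝ} (ht : IsPartition a b N t)
    (hf : MemLp f 2 (volume.restrict (Set.Ioo a b))) (hN : N ≠ 0) {w : ℕ → ℝ} (hw0 : ∀ j, 0 ≤ w j)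
    (hw : ∀ j < N, 0 < w j) (hw1 : ∑ j ∈ Finset.range N, w j = 1) {C : ℝ}
    (hC : ∑ j ∈ Finset.range N,
      (t (j + 1) - t j) ^ 2 * ((∫ x in t j..t (j + 1), f x ^ 2) / 12) / w j ^ 2 < C) :
    ∃ y : ℕ → ProbabilityMeasure (Set.Icc a b),
      (∀ j < N, Tendsto (fun n =>
        (y n : Measure (Set.Icc a b)).real {x | cellIndex t N x = j}) atTop (𝓝 (w j))) ∧
      ∀ᶠ n in atTop, distinctPointFunctional a b f n (y n) ≤ ENNReal.ofReal C := by
  obtain ⟨m, hmn, hmw⟩ := exists_sum_eq_tendsto_div hw0 hw1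
  have hm0 : ∀ᶠ n in atTop, ∀ j ∈ Set.Iio N, m n j ≠ 0 :=
    (Set.finite_Iio N).eventually_all.2 fun j hj =>
      ((hmw j).eventually_const_lt (hw j hj)).mono fun n hn h => by simp [h] at hn
  have hex : ∀ᶠ n in atTop, ∃ y : ProbabilityMeasure (Set.Icc a b),
      (∀ j < N, (y : Measure (Set.Icc a b)).real {x | cellIndex t N x = j} = m n j / n) ∧
      distinctPointFunctional a b f n y ≤ ENNReal.ofReal C := by
    filter_upwards [hm0, eventually_sum_gapEnergy_lt ht hf hw (fun j _ => hmw j) hC]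
      with n hn hlt
    obtain ⟨y, hy, hle⟩ := exists_distinctPointFunctional_le ht hf hn hN (hmn n)
    exact ⟨y, hy, hle.trans (ENNReal.ofReal_le_ofReal hlt.le)⟩
  have : Nonempty (ProbabilityMeasure (Set.Icc a b)) := hex.exists.elim fun _ ⟨y, _⟩ => ⟨y⟩
  obtain ⟨y, hy⟩ := hex.choice
  exact ⟨y, fun j hj => (hmw j).congr' (hy.mono fun n hn => (hn.1 j hj).symm),
    hy.mono fun n hn => hn.2⟩

end Distinct

section WeakConvergence

variable {a b : ℝ}

theorem sum_measureReal_cellIndex_mul {t : ℕ → ℝ} {N : ℕ} (hN : N ≠ 0)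
    (y : ProbabilityMeasure (Set.Icc a b)) (g : ℕ → ℝ) :
    Integrable (fun x : Set.Icc a b => g (cellIndex t N x)) (y : Measure (Set.Icc a b)) ∧
      ∑ j ∈ Finset.range N, (y : Measure (Set.Icc a b)).real {x | cellIndex t N x = j} * g j
        = ∫ x, g (cellIndex t N x) ∂(y : Measure (Set.Icc a b)) := by
  have hmeas : ∀ j, MeasurableSet {x : Set.Icc a b | cellIndex t N x = j} := fun j =>
    (measurable_cellIndex.comp measurable_subtype_coe) (measurableSet_singleton j)
  have hsum : (fun x : Set.Icc a b => g (cellIndex t N x)) = fun x => ∑ j ∈ Finset.range N,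
      {x : Set.Icc a b | cellIndex t N x = j}.indicator (fun _ => g j) x := by
    ext x
    simp [Set.indicator_apply, cellIndex_lt hN]
  have hint : ∀ j ∈ Finset.range N, Integrable
      ({x : Set.Icc a b | cellIndex t N x = j}.indicator fun _ => g j)
      (y : Measure (Set.Icc a b)) := fun j _ => (integrable_const _).indicator (hmeas j)
  rw [hsum]
  refine ⟨integrable_finsetSum _ hint, ?_⟩
  rw [integral_finsetSum _ hint]
  simp only [integral_indicator_const _ (hmeas _), smul_eq_mul]

theorem eventually_forall_abs_integral_sub_sum_le (hab : a < b) {g : ℝ → ℝ} (hg : Continuous g)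
    {η : ℝ} (hη : 0 < η) :
    ∀ᶠ M : ℕ in atTop, ∀ y : ProbabilityMeasure (Set.Icc a b),
      |∫ x : Set.Icc a b, g x ∂(y : Measure (Set.Icc a b)) - ∑ j ∈ Finset.range M,
        (y : Measure (Set.Icc a b)).real {x | cellIndex (equipartition a b M) M x = j} *
          g (equipartition a b M j)| ≤ η := by
  filter_upwards [exists_forall_abs_sub_equipartition_le hab hg hη, eventually_ne_atTop 0]
    with M hosc hM y
  have ht := isPartition_equipartition hab hM
  obtain ⟨hint, hsum⟩ := sum_measureReal_cellIndex_mul (t := equipartition a b M) hM y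
    fun j => g (equipartition a b M j)
  have hgi : Integrable (fun x : Set.Icc a b => g x) (y : Measure (Set.Icc a b)) :=
    (hg.comp continuous_subtype_val).integrable_of_hasCompactSupport
      (HasCompactSupport.of_compactSpace _)
  rw [hsum, ← integral_sub hgi hint, ← Real.norm_eq_abs]
  refine (norm_integral_le_of_norm_le_const (.of_forall fun x => ?_)).trans_eq
    (by rw [probReal_univ, mul_one])
  exact hosc _ (cellIndex_lt hM) x (ht.mem_Icc_cellIndex hM x.2)

theorem eventually_forall_eventually_mem_of_tendsto_cellIndex (hab : a < b)
    {μ : ProbabilityMeasure (Set.Icc a b)} {U : Set (ProbabilityMeasure (Set.Icc a b))}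
    (hU : U ∈ 𝓝 μ) :
    ∀ᶠ M : ℕ in atTop, ∀ y : ℕ → ProbabilityMeasure (Set.Icc a b),
      (∀ j < M, Tendsto (fun n => (y n : Measure (Set.Icc a b)).real
          {x | cellIndex (equipartition a b M) M x = j}) atTop
        (𝓝 ((μ : Measure (Set.Icc a b)).real {x | cellIndex (equipartition a b M) M x = j}))) →
      ∀ᶠ n in atTop, y n ∈ U := by
  let mass : ℕ → ℕ → ProbabilityMeasure (Set.Icc a b) → ℝ := fun M j y =>
    (y : Measure (Set.Icc a b)).real {x | cellIndex (equipartition a b M) M x = j}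
  let L : ℕ → Filter (ProbabilityMeasure (Set.Icc a b)) := fun M =>
    ⨅ j : Fin M, comap (mass M j) (𝓝 (mass M j μ))
  have hlim : Tendsto id (atTop.bind L) (𝓝 μ) := by
    refine ProbabilityMeasure.tendsto_iff_forall_integral_tendsto.2 fun G =>
      Metric.tendsto_nhds.2 fun η hη => eventually_bind.2 ?_
    have hg : Continuous (Set.IccExtend hab.le G) := G.continuous.Icc_extend'
    have hGg : (fun x : Set.Icc a b => Set.IccExtend hab.le G x) = G :=
      funext (Set.IccExtend_val hab.le G)
    filter_upwards [eventually_forall_abs_integral_sub_sum_le hab hg (by positivity : 0 < η / 3)]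
      with M hM
    have hsum : Tendsto (fun y => ∑ j ∈ Finset.range M,
        mass M j y * Set.IccExtend hab.le G (equipartition a b M j)) (L M)
        (𝓝 (∑ j ∈ Finset.range M, mass M j μ * Set.IccExtend hab.le G (equipartition a b M j))) :=
      tendsto_finsetSum _ fun j hj => ((tendsto_comap (f := mass M j)).mono_left
        (iInf_le _ (⟨j, Finset.mem_range.1 hj⟩ : Fin M))).mul_const _
    filter_upwards [Metric.tendsto_nhds.1 hsum (η / 3) (by positivity)] with y hy
    have hyM := hM y
    have hμM := hM μ
    simp only [hGg] at hyM hμM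
    rw [Real.dist_eq] at hy ⊢
    simp only [mass, id_eq, abs_lt, abs_le] at hy hyM hμM ⊢
    constructor <;> linarith [hy.1, hy.2, hyM.1, hyM.2, hμM.1, hμM.2]
  filter_upwards [eventually_bind.1 (hlim hU)] with M hM y hy
  have hyL : Tendsto y atTop (L M) :=
    tendsto_iInf.2 fun j => tendsto_comap_iff.2 (hy j j.2)
  exact hyL hM

end WeakConvergence

section UpperBound

variable {a b ε : ℝ} {f : ℝ → ℝ} {M i : ℕ} {μ : ProbabilityMeasure (Set.Icc a b)} {ν : Measure ℝ}

theorem IsPartition.measure_Icc_le_measure_cellIndex {t : ℕ → ℝ} (ht : IsPartition a b M t)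
    (hi : i < M) (hac : ν ≪ volume) (hν : ν ≤ toReal μ) :
    ν (Set.Icc (t i) (t (i + 1))) ≤ (μ : Measure (Set.Icc a b)) {x | cellIndex t M x = i} := by
  rw [← measure_congr (hac.ae_eq Ico_ae_eq_Icc)]
  refine (hν _).trans ?_
  rw [toReal_apply μ measurableSet_Ico]
  exact measure_mono fun x hx => ht.cellIndex_eq hi hx

theorem sq_mul_div_le_lintegral_cellFunctional (hab : a < b)
    (hf : MemLp f 2 (volume.restrict (Set.Ioo a b))) (hi : i < M) {w : ℝ} (hw : 0 < w)
    (hνw : ν (Set.Icc (equipartition a b M i) (equipartition a b M (i + 1))) ≤ ENNReal.ofReal w) :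
    ENNReal.ofReal ((equipartition a b M (i + 1) - equipartition a b M i) ^ 2 *
        ((∫ x in equipartition a b M i..equipartition a b M (i + 1), f x ^ 2) / 12) / w ^ 2)
      ≤ 1 / 12 * ∫⁻ x in Set.Icc a b, cellFunctional a b f ν 0 M i x := by
  have ht := isPartition_equipartition hab (i.zero_le.trans_lt hi).ne'
  have hlen := sub_pos.2 (ht.lt_succ hi)
  have hsub := ht.Ioo_subset hi
  simp only [cellFunctional]
  rw [lintegral_indicator measurableSet_Ioo, Measure.restrict_restrict measurableSet_Ioo,
    Set.inter_eq_left.2 (hsub.trans Set.Ioo_subset_Icc_self)]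
  set p := equipartition a b M i
  set q := equipartition a b M (i + 1)
  have hf' := hf.mono_measure (Measure.restrict_mono hsub le_rfl)
  calc ENNReal.ofReal ((q - p) ^ 2 * ((∫ x in p..q, f x ^ 2) / 12) / w ^ 2)
      = ENNReal.ofReal (1 / 12) * ENNReal.ofReal ((∫ x in p..q, f x ^ 2) / (w / (q - p)) ^ 2) := by
        rw [← ENNReal.ofReal_mul (by norm_num)]
        congr 1
        field_simp
    _ = 1 / 12 * ∫⁻ x in Set.Ioo p q, ENNReal.ofReal (f x ^ 2) /
          ENNReal.ofReal (w / (q - p)) ^ 2 := by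
        rw [setLIntegral_ofReal_sq_div (ht.lt_succ hi).le hf' (by positivity),
          ENNReal.ofReal_div_of_pos (by norm_num), ENNReal.ofReal_one, ENNReal.ofReal_ofNat]
    _ ≤ _ := by
        rw [ENNReal.ofReal_zero, add_zero, ENNReal.ofReal_div_of_pos hlen]
        gcongr

theorem IsPartition.mul_length_le_measure_Icc {t : ℕ → ℝ} (ht : IsPartition a b M t)
    (hε : ENNReal.ofReal ε • volume.restrict (Set.Icc a b) ≤ ν) (hi : i < M) :
    ENNReal.ofReal ε * ENNReal.ofReal (t (i + 1) - t i) ≤ ν (Set.Icc (t i) (t (i + 1))) := by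
  refine Eq.trans_le ?_ (hε _)
  rw [Measure.smul_apply, smul_eq_mul, Measure.restrict_apply measurableSet_Icc,
    Set.inter_eq_left.2 (Set.Icc_subset_Icc (ht.mem_Icc hi.le).1 (ht.mem_Icc hi).2),
    Real.volume_Icc]

theorem sum_cellFunctional_le (hab : a < b)
    (hε : ENNReal.ofReal ε • volume.restrict (Set.Icc a b) ≤ ν) (x : ℝ) :
    ∑ i ∈ Finset.range M, cellFunctional a b f ν 0 M i x
      ≤ ENNReal.ofReal (f x ^ 2) / ENNReal.ofReal ε ^ 2 := by
  by_cases hx : ∃ i < M, x ∈ Set.Ioo (equipartition a b M i) (equipartition a b M (i + 1))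
  · obtain ⟨i, hi, hxi⟩ := hx
    have ht := isPartition_equipartition hab (i.zero_le.trans_lt hi).ne'
    have hlen := sub_pos.2 (ht.lt_succ hi)
    rw [sum_cellFunctional_eq hab hi hxi, ENNReal.ofReal_zero, add_zero]
    gcongr
    rw [ENNReal.le_div_iff_mul_le (.inl (ENNReal.ofReal_pos.2 hlen).ne')
      (.inl ENNReal.ofReal_ne_top)]
    exact ht.mul_length_le_measure_Icc hε hi
  · push Not at hx
    exact (Finset.sum_eq_zero fun i hi =>
      Set.indicator_of_notMem (hx i (Finset.mem_range.1 hi)) _).trans_le zero_le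

theorem tendsto_sum_lintegral_cellFunctional (hab : a < b)
    (hf : MemLp f 2 (volume.restrict (Set.Icc a b))) [IsLocallyFiniteMeasure ν] (hε0 : 0 < ε)
    (hε : ENNReal.ofReal ε • volume.restrict (Set.Icc a b) ≤ ν) :
    Tendsto (fun M => ∑ i ∈ Finset.range (M + 1),
        ∫⁻ x in Set.Icc a b, cellFunctional a b f ν 0 (M + 1) i x) atTop
      (𝓝 (∫⁻ x in Set.Icc a b, ENNReal.ofReal (f x ^ 2) / ν.rnDeriv volume x ^ 2)) := by
  have hmeas (M : ℕ) : ∀ i ∈ Finset.range (M + 1), AEMeasurable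
      (cellFunctional a b f ν 0 (M + 1) i) (volume.restrict (Set.Icc a b)) :=
    fun i _ => aemeasurable_cellFunctional hf.1.aemeasurable i
  have hbound : ∫⁻ x in Set.Icc a b, ENNReal.ofReal (f x ^ 2) / ENNReal.ofReal ε ^ 2 ≠ ∞ := by
    rw [← restrict_Ioo_eq_restrict_Icc] at hf ⊢
    rw [setLIntegral_ofReal_sq_div hab.le hf hε0]
    exact ENNReal.ofReal_ne_top
  simp only [← lintegral_finsetSum' _ (hmeas _)]
  refine tendsto_lintegral_of_dominated_convergence' _
    (fun M => Finset.aemeasurable_fun_sum _ (hmeas M))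
    (fun M => .of_forall (sum_cellFunctional_le hab hε)) hbound ?_
  filter_upwards [ae_tendsto_sum_cellFunctional hab f ν (tendsto_const_nhds (x := (0 : ℝ)))
    (tendsto_add_atTop_nat 1) Nat.succ_ne_zero] with x hx
  rwa [ENNReal.ofReal_zero, add_zero] at hx

theorem exists_distinctPointFunctional_le_of_lintegral_cellFunctional_lt (hab : a < b)
    (hf : MemLp f 2 (volume.restrict (Set.Icc a b))) (hac : ν ≪ volume) (hν : ν ≤ toReal μ)
    (hε0 : 0 < ε) (hε : ENNReal.ofReal ε • volume.restrict (Set.Icc a b) ≤ ν) (hM : M ≠ 0)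
    {c : ℝ≥0∞} (hc : 1 / 12 *
      ∑ i ∈ Finset.range M, ∫⁻ x in Set.Icc a b, cellFunctional a b f ν 0 M i x < c) :
    ∃ y : ℕ → ProbabilityMeasure (Set.Icc a b),
      (∀ j < M, Tendsto (fun n => (y n : Measure (Set.Icc a b)).real
          {x | cellIndex (equipartition a b M) M x = j}) atTop
        (𝓝 ((μ : Measure (Set.Icc a b)).real {x | cellIndex (equipartition a b M) M x = j}))) ∧
      ∀ᶠ n in atTop, distinctPointFunctional a b f n (y n) ≤ c := by
  obtain ⟨C, hC, hCc⟩ := ENNReal.lt_iff_exists_nnreal_btwn.1 hc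
  have ht := isPartition_equipartition hab hM
  let w : ℕ → ℝ := fun j =>
    (μ : Measure (Set.Icc a b)).real {x | cellIndex (equipartition a b M) M x = j}
  have hνw : ∀ j < M, ν (Set.Icc (equipartition a b M j) (equipartition a b M (j + 1)))
      ≤ ENNReal.ofReal (w j) := fun j hj => by
    rw [ofReal_measureReal]
    exact ht.measure_Icc_le_measure_cellIndex hj hac hν
  have hw : ∀ j < M, 0 < w j := fun j hj => ENNReal.ofReal_pos.1 <| lt_of_lt_of_le
    (ENNReal.mul_pos (ENNReal.ofReal_pos.2 hε0).ne'
      (ENNReal.ofReal_pos.2 (sub_pos.2 (ht.lt_succ hj))).ne')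
    ((ht.mul_length_le_measure_Icc hε hj).trans (hνw j hj))
  have hw1 : ∑ j ∈ Finset.range M, w j = 1 := by
    have hsum := (sum_measureReal_cellIndex_mul (t := equipartition a b M) hM μ fun _ => 1).2
    simpa only [mul_one, integral_const, probReal_univ, one_smul] using hsum
  rw [← restrict_Ioo_eq_restrict_Icc] at hf
  have henergy : ∑ j ∈ Finset.range M,
      (equipartition a b M (j + 1) - equipartition a b M j) ^ 2 *
        ((∫ x in equipartition a b M j..equipartition a b M (j + 1), f x ^ 2) / 12) /
        w j ^ 2 < (C : ℝ) := by
    have h0 : ∀ j ∈ Finset.range M, 0 ≤ (equipartition a b M (j + 1) - equipartition a b M j) ^ 2 *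
        ((∫ x in equipartition a b M j..equipartition a b M (j + 1), f x ^ 2) / 12) / w j ^ 2 :=
      fun j hj => by
        have := intervalIntegral.integral_nonneg (f := fun x => f x ^ 2) (μ := volume)
          (ht.lt_succ (Finset.mem_range.1 hj)).le fun x _ => sq_nonneg _
        positivity
    rw [← ENNReal.ofReal_lt_ofReal_iff_of_nonneg (Finset.sum_nonneg h0), ENNReal.ofReal_coe_nnreal,
      ENNReal.ofReal_sum_of_nonneg h0]
    rw [Finset.mul_sum] at hC
    refine lt_of_le_of_lt (Finset.sum_le_sum fun j hj => ?_) hC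
    have hj := Finset.mem_range.1 hj
    exact sq_mul_div_le_lintegral_cellFunctional hab hf hj (hw j hj) (hνw j hj)
  obtain ⟨y, hy, hle⟩ := exists_distinctPointFunctional_le_tendsto ht hf hM
    (fun j => measureReal_nonneg) hw hw1 henergy
  exact ⟨y, hy, hle.mono fun n hn => hn.trans (ENNReal.ofReal_coe_nnreal.trans_le hCc.le)⟩

theorem eventually_exists_mem_distinctPointFunctional_le_of_le (hab : a < b)
    (hf : MemLp f 2 (volume.restrict (Set.Icc a b))) (hac : ν ≪ volume) (hν : ν ≤ toReal μ)
    (hε0 : 0 < ε) (hε : ENNReal.ofReal ε • volume.restrict (Set.Icc a b) ≤ ν) {c : ℝ≥0∞}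
    (hc : 1 / 12 * ∫⁻ x in Set.Icc a b, ENNReal.ofReal (f x ^ 2) / ν.rnDeriv volume x ^ 2 < c)
    {U : Set (ProbabilityMeasure (Set.Icc a b))} (hU : U ∈ 𝓝 μ) :
    ∀ᶠ n in atTop, ∃ y ∈ U, distinctPointFunctional a b f n y ≤ c := by
  have : IsFiniteMeasure ν := isFiniteMeasure_of_le _ hν
  have henergy := (ENNReal.Tendsto.const_mul (a := 1 / 12)
    (tendsto_sum_lintegral_cellFunctional hab hf hε0 hε) (.inr (by simp))).eventually_lt_const hc
  obtain ⟨M, hMc, hMU⟩ := (henergy.and ((tendsto_add_atTop_nat 1).eventually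
    (eventually_forall_eventually_mem_of_tendsto_cellIndex hab hU))).exists
  obtain ⟨y, hy, hle⟩ := exists_distinctPointFunctional_le_of_lintegral_cellFunctional_lt hab hf hac
    hν hε0 hε M.succ_ne_zero hMc
  filter_upwards [hMU y hy, hle] with n hn hn'
  exact ⟨y n, hn, hn'⟩

end UpperBound

theorem exists_toReal_eq {a b : ℝ} {ν : Measure ℝ} [IsProbabilityMeasure ν]
    (hν : ν (Set.Icc a b)ᶜ = 0) : ∃ μ : ProbabilityMeasure (Set.Icc a b), toReal μ = ν := by
  have hemb := MeasurableEmbedding.subtype_coe (measurableSet_Icc (a := a) (b := b))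
  have hone : ν (Set.Icc a b) = 1 := (prob_compl_eq_zero_iff measurableSet_Icc).1 hν
  refine ⟨⟨ν.comap Subtype.val, ⟨?_⟩⟩, ?_⟩
  · rw [hemb.comap_apply, Set.image_univ, Subtype.range_coe, hone]
  · refine (hemb.map_comap ν).trans ?_
    rw [Subtype.range_coe, Measure.restrict_eq_self_of_ae_mem (by rwa [ae_iff])]

theorem exists_tendsto_convexCombination {X : Type*} [TopologicalSpace X] [MeasurableSpace X]
    [OpensMeasurableSpace X] (μ κ : ProbabilityMeasure X) {s : ℕ → ℝ} (hs : ∀ k, s k ∈ Set.Icc 0 1)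
    (hs0 : Tendsto s atTop (𝓝 0)) :
    ∃ y : ℕ → ProbabilityMeasure X, Tendsto y atTop (𝓝 μ) ∧ ∀ k, (y k : Measure X)
      = ENNReal.ofReal (1 - s k) • (μ : Measure X) + ENNReal.ofReal (s k) • (κ : Measure X) := by
  have hprob (k : ℕ) : IsProbabilityMeasure (ENNReal.ofReal (1 - s k) • (μ : Measure X) +
      ENNReal.ofReal (s k) • (κ : Measure X)) := ⟨by
    rw [Measure.add_apply, Measure.smul_apply, Measure.smul_apply, measure_univ, measure_univ,
      smul_eq_mul, smul_eq_mul, mul_one, mul_one,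
      ← ENNReal.ofReal_add (sub_nonneg.2 (hs k).2) (hs k).1, sub_add_cancel, ENNReal.ofReal_one]⟩
  refine ⟨fun k => ⟨_, hprob k⟩, ?_, fun k => rfl⟩
  refine ProbabilityMeasure.tendsto_iff_forall_integral_tendsto.2 fun G => ?_
  have hG (ν : ProbabilityMeasure X) : Integrable G (ν : Measure X) := G.integrable _
  have hlim : Tendsto (fun k => (1 - s k) * ∫ x, G x ∂(μ : Measure X) +
      s k * ∫ x, G x ∂(κ : Measure X)) atTop (𝓝 (∫ x, G x ∂(μ : Measure X))) := by
    simpa using ((hs0.const_sub 1).mul_const _).add (hs0.mul_const _)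
  refine hlim.congr fun k => ?_
  simp only [ProbabilityMeasure.coe_mk]
  rw [integral_add_measure ((hG μ).smul_measure ENNReal.ofReal_ne_top)
    ((hG κ).smul_measure ENNReal.ofReal_ne_top), integral_smul_measure, integral_smul_measure,
    ENNReal.toReal_ofReal (sub_nonneg.2 (hs k).2), ENNReal.toReal_ofReal (hs k).1, smul_eq_mul,
    smul_eq_mul]

theorem exists_absolutelyContinuous_le {X : Type*} [MeasurableSpace X] (μ : Measure X)
    {κ m : Measure X} [IsFiniteMeasure μ] [IsFiniteMeasure κ] [SigmaFinite m] (hκ : κ ≪ m)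
    {r : ℝ≥0∞} (hr : r ≠ ∞) :
    ∃ ν : Measure X, ν ≪ m ∧ κ ≤ ν ∧ ν ≤ r • μ + κ ∧
      ∀ᵐ x ∂m, r * μ.rnDeriv m x ≤ ν.rnDeriv m x := by
  have hle := Measure.withDensity_rnDeriv_le μ m
  have := isFiniteMeasure_of_le _ hle
  have : IsFiniteMeasure (r • m.withDensity (μ.rnDeriv m)) := Measure.smul_finite _ hr
  refine ⟨r • m.withDensity (μ.rnDeriv m) + κ,
    ((withDensity_absolutelyContinuous _ _).smul_left _).add_left hκ, Measure.le_add_left le_rfl,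
    add_le_add (Measure.le_iff.2 fun s _ => mul_right_mono (hle s)) le_rfl, ?_⟩
  filter_upwards [Measure.rnDeriv_add (r • m.withDensity (μ.rnDeriv m)) κ m,
    Measure.rnDeriv_smul_left_of_ne_top (m.withDensity (μ.rnDeriv m)) m hr,
    Measure.rnDeriv_withDensity m (Measure.measurable_rnDeriv μ m)] with x hadd hsmul hdens
  rw [hadd, Pi.add_apply, hsmul, Pi.smul_apply, hdens, smul_eq_mul]
  exact le_self_add

section Recovery

variable {a b : ℝ} {f : ℝ → ℝ} {μ : ProbabilityMeasure (Set.Icc a b)}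
  {U : Set (ProbabilityMeasure (Set.Icc a b))} {c r : ℝ≥0∞}

theorem lintegral_sq_div_rnDeriv_le {ν : Measure ℝ} (hr0 : r ≠ 0) (hr : r ≠ ∞)
    (hν : ∀ᵐ x, r * (toReal μ).rnDeriv volume x ≤ ν.rnDeriv volume x) :
    1 / 12 * ∫⁻ x in Set.Icc a b, ENNReal.ofReal (f x ^ 2) / ν.rnDeriv volume x ^ 2
      ≤ (r ^ 2)⁻¹ * limitFunctional a b f μ := by
  have hr0' : r ^ 2 ≠ 0 := pow_ne_zero 2 hr0
  have hr' : r ^ 2 ≠ ∞ := ENNReal.pow_ne_top hr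
  rw [limitFunctional, mul_left_comm, ← lintegral_const_mul' _ _ (ENNReal.inv_ne_top.2 hr0')]
  gcongr 1 / 12 * ?_
  refine lintegral_mono_ae (ae_restrict_of_ae (hν.mono fun x hx => ?_))
  calc ENNReal.ofReal (f x ^ 2) / ν.rnDeriv volume x ^ 2
      ≤ ENNReal.ofReal (f x ^ 2) / (r * (toReal μ).rnDeriv volume x) ^ 2 := by gcongr
    _ = (r ^ 2)⁻¹ * (ENNReal.ofReal (f x ^ 2) / (toReal μ).rnDeriv volume x ^ 2) := by
        rw [mul_pow, div_eq_mul_inv, ENNReal.mul_inv (.inl hr0') (.inl hr'), mul_left_comm,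
          div_eq_mul_inv]

theorem exists_tendsto_uniformMixture (hab : a < b) (μ : ProbabilityMeasure (Set.Icc a b))
    {s : ℕ → ℝ} (hs : ∀ k, s k ∈ Set.Icc 0 1) (hs0 : Tendsto s atTop (𝓝 0)) :
    ∃ y : ℕ → ProbabilityMeasure (Set.Icc a b), Tendsto y atTop (𝓝 μ) ∧ ∀ k, toReal (y k)
      = ENNReal.ofReal (1 - s k) • toReal μ +
        ENNReal.ofReal (s k / (b - a)) • volume.restrict (Set.Icc a b) := by
  have hlen := sub_pos.2 hab
  have hprob : IsProbabilityMeasure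
      ((ENNReal.ofReal (b - a))⁻¹ • volume.restrict (Set.Icc a b)) := ⟨by
    rw [Measure.smul_apply, Measure.restrict_apply_univ, Real.volume_Icc, smul_eq_mul,
      ENNReal.inv_mul_cancel (ENNReal.ofReal_pos.2 hlen).ne' ENNReal.ofReal_ne_top]⟩
  obtain ⟨κ, hκ⟩ := exists_toReal_eq (a := a) (b := b)
    (ν := (ENNReal.ofReal (b - a))⁻¹ • volume.restrict (Set.Icc a b)) (by
      simp [Measure.restrict_apply measurableSet_Icc.compl])
  obtain ⟨y, hy, hys⟩ := exists_tendsto_convexCombination μ κ hs hs0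
  refine ⟨y, hy, fun k => ?_⟩
  rw [toReal, hys, Measure.map_add _ _ measurable_subtype_coe, Measure.map_smul, Measure.map_smul,
    ← toReal, ← toReal, hκ, smul_smul, ENNReal.ofReal_div_of_pos hlen, div_eq_mul_inv]

theorem eventually_exists_mem_distinctPointFunctional_le (hab : a < b)
    (hf : MemLp f 2 (volume.restrict (Set.Icc a b))) (hc : limitFunctional a b f μ < c)
    (hU : U ∈ 𝓝 μ) : ∀ᶠ n in atTop, ∃ y ∈ U, distinctPointFunctional a b f n y ≤ c := by
  let s : ℕ → ℝ := fun k => 1 / ((k + 1 : ℕ) + 1)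
  have hs0 : ∀ k, 0 < s k := fun k => Nat.one_div_pos_of_nat
  have hs1 : ∀ k, s k < 1 := fun k => by
    rw [div_lt_one (by positivity)]
    exact lt_add_of_pos_left _ (Nat.cast_pos.2 k.succ_pos)
  have hs : Tendsto s atTop (𝓝 0) :=
    tendsto_one_div_add_atTop_nhds_zero_nat.comp (tendsto_add_atTop_nat 1)
  obtain ⟨y, hy, hys⟩ := exists_tendsto_uniformMixture hab μ (fun k => ⟨(hs0 k).le, (hs1 k).le⟩) hs
  have hbound : Tendsto (fun k => (ENNReal.ofReal (1 - s k) ^ 2)⁻¹ * limitFunctional a b f μ) atTop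
      (𝓝 (limitFunctional a b f μ)) := by
    have hinv : Tendsto (fun k => (ENNReal.ofReal (1 - s k) ^ 2)⁻¹) atTop (𝓝 1) := by
      simpa using tendsto_inv_iff.2
        (ENNReal.Tendsto.pow (n := 2) (ENNReal.tendsto_ofReal (hs.const_sub 1)))
    simpa using ENNReal.Tendsto.mul_const hinv (.inl one_ne_zero)
  obtain ⟨k, hkc, hkU⟩ := ((hbound.eventually_lt_const hc).and
    (hy.eventually (eventually_mem_nhds_iff.2 hU))).exists
  have hδ : 0 < s k / (b - a) := div_pos (hs0 k) (sub_pos.2 hab)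
  have : IsFiniteMeasure (ENNReal.ofReal (s k / (b - a)) • volume.restrict (Set.Icc a b)) :=
    Measure.smul_finite _ ENNReal.ofReal_ne_top
  have huac : ENNReal.ofReal (s k / (b - a)) • volume.restrict (Set.Icc a b) ≪ volume :=
    (Measure.absolutelyContinuous_of_le Measure.restrict_le_self).smul_left _
  obtain ⟨ν, hac, hlow, hle, hρ⟩ := exists_absolutelyContinuous_le (toReal μ) huac
    (ENNReal.ofReal_ne_top (r := 1 - s k))
  have hνc : 1 / 12 * ∫⁻ x in Set.Icc a b, ENNReal.ofReal (f x ^ 2) / ν.rnDeriv volume x ^ 2 < c :=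
    (lintegral_sq_div_rnDeriv_le (ENNReal.ofReal_pos.2 (sub_pos.2 (hs1 k))).ne'
      ENNReal.ofReal_ne_top hρ).trans_lt hkc
  exact eventually_exists_mem_distinctPointFunctional_le_of_le hab hf hac
    (hle.trans_eq (hys k).symm) hδ hlow hνc hkU

end Recovery

theorem exists_tendsto_forall_eventually {X : Type*} {L : Filter X} [L.IsCountablyGenerated]
    {P : ℕ → X → Prop} (h : ∀ V ∈ L, ∀ᶠ n in atTop, ∃ y ∈ V, P n y) :
    ∃ y : ℕ → X, Tendsto y atTop L ∧ ∀ᶠ n in atTop, P n (y n) := by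
  classical
  obtain ⟨V, hV⟩ := L.exists_antitone_basis
  have hVn (k : ℕ) := h (V k) (hV.mem k)
  let κ : ℕ → ℕ := fun n => Nat.findGreatest (fun k => ∃ y ∈ V k, P n y) n
  have hκ : ∀ k, ∀ᶠ n in atTop, k ≤ κ n := fun k => by
    filter_upwards [hVn k, eventually_ge_atTop k] with n hn hkn
    exact Nat.le_findGreatest hkn hn
  have hspec : ∀ᶠ n in atTop, ∃ y ∈ V (κ n), P n y := (hVn 0).mono fun n hn =>
    Nat.findGreatest_spec (P := fun k => ∃ y ∈ V k, P n y) n.zero_le hn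
  have : Nonempty X := hspec.exists.elim fun _ ⟨y, _⟩ => ⟨y⟩
  obtain ⟨y, hy⟩ := hspec.choice
  refine ⟨y, hV.tendsto_right_iff.2 fun k _ => ?_, hy.mono fun n hn => hn.2⟩
  filter_upwards [hy, hκ k] with n hn hkn
  exact hV.antitone hkn hn.1

theorem exists_tendsto_limsup_le {X : Type*} [TopologicalSpace X] [FirstCountableTopology X]
    {F : ℕ → X → ℝ≥0∞} {x : X} {c : ℝ≥0∞}
    (h : ∀ U ∈ 𝓝 x, ∀ c' > c, ∀ᶠ n in atTop, ∃ y ∈ U, F n y ≤ c') :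
    ∃ y : ℕ → X, Tendsto y atTop (𝓝 x) ∧ limsup (fun n => F n (y n)) atTop ≤ c := by
  rcases eq_or_ne c ∞ with rfl | hc
  · exact ⟨fun _ => x, tendsto_const_nhds, le_top⟩
  have hc' : (𝓝[>] c).NeBot := nhdsGT_neBot_of_exists_gt ⟨∞, hc.lt_top⟩
  obtain ⟨z, hz, hFz⟩ := exists_tendsto_forall_eventually (L := 𝓝 x ×ˢ 𝓝[>] c)
    (P := fun n z => F n z.1 ≤ z.2) fun V hV => by
      obtain ⟨U, hU, W, hW, hUW⟩ := mem_prod_iff.1 hV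
      obtain ⟨c', hc'W, hc'⟩ := nonempty_of_mem (inter_mem hW self_mem_nhdsWithin)
      filter_upwards [h U hU c' hc'] with n ⟨y, hy, hle⟩
      exact ⟨(y, c'), hUW ⟨hy, hc'W⟩, hle⟩
  have hz2 : Tendsto (fun n => (z n).2) atTop (𝓝 c) :=
    tendsto_nhds_of_tendsto_nhdsWithin (tendsto_snd.comp hz)
  exact ⟨fun n => (z n).1, tendsto_fst.comp hz, (limsup_le_limsup hFz).trans_eq hz2.limsup_eq⟩

theorem gammaConverges_of_le_of_le {a b : ℝ} (hab : a < b) {f : ℝ → ℝ}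
    (hf : MemLp f 2 (volume.restrict (Set.Icc a b)))
    {F : ℕ → ProbabilityMeasure (Set.Icc a b) → ℝ≥0∞}
    (hlow : ∀ n μ, sparseFunctional a b f n μ ≤ F n μ)
    (hupp : ∀ n μ, F n μ ≤ distinctPointFunctional a b f n μ) :
    GammaConverges F (limitFunctional a b f) := fun μ =>
  ⟨fun y hy => (limitFunctional_le_liminf_sparseFunctional hab hf hy).trans
    (liminf_le_liminf (.of_forall fun n => hlow n (y n))),
  exists_tendsto_limsup_le fun U hU c hc =>
    (eventually_exists_mem_distinctPointFunctional_le hab hf hc hU).mono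
      fun n ⟨y, hy, hle⟩ => ⟨y, hy, (hupp n y).trans hle⟩⟩

section Young

variable {C t : ℝ} {ρ : ℝ≥0∞}

theorem ofReal_div_sq_add_mul_eq (hC : 0 < C) (ht : 0 ≤ t) {r : ℝ} (hr : 0 < r) :
    ENNReal.ofReal (t ^ 3) / ENNReal.ofReal r ^ 2 + ENNReal.ofReal (2 * C ^ 3) * ENNReal.ofReal r
      = ENNReal.ofReal (3 * C ^ 2 * t) +
        ENNReal.ofReal ((t - C * r) ^ 2 * (t + 2 * C * r) / r ^ 2) := by
  rw [← ENNReal.ofReal_pow hr.le, ← ENNReal.ofReal_div_of_pos (by positivity),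
    ← ENNReal.ofReal_mul (by positivity), ← ENNReal.ofReal_add (by positivity) (by positivity),
    ← ENNReal.ofReal_add (by positivity) (by positivity)]
  congr 1
  field_simp
  ring

theorem ofReal_le_div_sq_add_mul (hC : 0 < C) (ht : 0 ≤ t) (hρ : ρ ≠ ∞) :
    ENNReal.ofReal (3 * C ^ 2 * t)
      ≤ ENNReal.ofReal (t ^ 3) / ρ ^ 2 + ENNReal.ofReal (2 * C ^ 3) * ρ := by
  rcases eq_or_ne ρ 0 with rfl | hρ0
  · rcases ht.eq_or_lt with rfl | ht
    · simp
    · simp [ENNReal.div_zero (ENNReal.ofReal_pos.2 (pow_pos ht 3)).ne']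
  rw [← ENNReal.ofReal_toReal hρ,
    ofReal_div_sq_add_mul_eq hC ht (ENNReal.toReal_pos hρ0 hρ)]
  exact le_self_add

theorem eq_ofReal_of_div_sq_add_mul_eq (hC : 0 < C) (ht : 0 ≤ t) (hρ : ρ ≠ ∞)
    (h : ENNReal.ofReal (3 * C ^ 2 * t)
      = ENNReal.ofReal (t ^ 3) / ρ ^ 2 + ENNReal.ofReal (2 * C ^ 3) * ρ) :
    ρ = ENNReal.ofReal (C⁻¹ * t) := by
  rcases eq_or_ne ρ 0 with rfl | hρ0
  · rcases ht.eq_or_lt with rfl | ht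
    · simp
    · simp [ENNReal.div_zero (ENNReal.ofReal_pos.2 (pow_pos ht 3)).ne'] at h
  have hr := ENNReal.toReal_pos hρ0 hρ
  rw [← ENNReal.ofReal_toReal hρ] at h ⊢
  generalize ρ.toReal = r at h hr
  rw [ofReal_div_sq_add_mul_eq hC ht hr] at h
  have hgap : (t - C * r) ^ 2 * (t + 2 * C * r) / r ^ 2 = 0 :=
    (ENNReal.ofReal_eq_zero.1 (ENNReal.add_right_inj ENNReal.ofReal_ne_top |>.1
      ((add_zero _).trans h)).symm).antisymm (by positivity)
  have hne : t + 2 * C * r ≠ 0 := by positivity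
  have htr : t - C * r = 0 := by simpa [hr.ne', hne] using hgap
  rw [sub_eq_zero.1 htr, inv_mul_cancel_left₀ hC.ne']

end Young

section OptimalDensity

variable {X : Type*} [MeasurableSpace X] {m : Measure X} {g : X → ℝ} {ρ : X → ℝ≥0∞}

theorem lintegral_ofReal_const_mul (hg : Integrable g m) (hg0 : 0 ≤ g) {r : ℝ} (hr : 0 ≤ r) :
    ∫⁻ x, ENNReal.ofReal (r * g x) ∂m = ENNReal.ofReal (r * ∫ x, g x ∂m) := by
  rw [← integral_const_mul, ofReal_integral_eq_lintegral_ofReal (hg.const_mul r)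
    (ae_of_all _ fun x => mul_nonneg hr (hg0 x))]

theorem ae_ofReal_le_div_sq_add_mul (hg0 : 0 ≤ g) (hρ : AEMeasurable ρ m)
    (hρ1 : ∫⁻ x, ρ x ∂m ≤ 1) {C : ℝ} (hC : 0 < C) :
    ∀ᵐ x ∂m, ENNReal.ofReal (3 * C ^ 2 * g x)
      ≤ ENNReal.ofReal (g x ^ 3) / ρ x ^ 2 + ENNReal.ofReal (2 * C ^ 3) * ρ x :=
  (ae_lt_top' hρ (ne_top_of_le_ne_top ENNReal.one_ne_top hρ1)).mono fun x hx =>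
    ofReal_le_div_sq_add_mul hC (hg0 x) hx.ne

theorem lintegral_div_sq_add_mul_le (hρ : AEMeasurable ρ m) (hρ1 : ∫⁻ x, ρ x ∂m ≤ 1)
    {C : ℝ} :
    ∫⁻ x, (ENNReal.ofReal (g x ^ 3) / ρ x ^ 2 + ENNReal.ofReal (2 * C ^ 3) * ρ x) ∂m
      ≤ ∫⁻ x, ENNReal.ofReal (g x ^ 3) / ρ x ^ 2 ∂m + ENNReal.ofReal (2 * C ^ 3) := by
  rw [lintegral_add_right' _ (hρ.const_mul _), lintegral_const_mul'' _ hρ]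
  gcongr
  exact mul_le_of_le_one_right' hρ1

theorem lintegral_ofReal_three_mul_sq_mul (hg : Integrable g m) (hg0 : 0 ≤ g) :
    ∫⁻ x, ENNReal.ofReal (3 * (∫ x, g x ∂m) ^ 2 * g x) ∂m
      = ENNReal.ofReal ((∫ x, g x ∂m) ^ 3) + ENNReal.ofReal (2 * (∫ x, g x ∂m) ^ 3) := by
  have hC : 0 ≤ ∫ x, g x ∂m := integral_nonneg hg0
  rw [lintegral_ofReal_const_mul hg hg0 (by positivity),
    ← ENNReal.ofReal_add (by positivity) (by positivity)]
  ring_nf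

theorem ofReal_integral_pow_three_le_lintegral_div_sq (hg : Integrable g m) (hg0 : 0 ≤ g)
    (hC : 0 < ∫ x, g x ∂m) (hρ : AEMeasurable ρ m) (hρ1 : ∫⁻ x, ρ x ∂m ≤ 1) :
    ENNReal.ofReal ((∫ x, g x ∂m) ^ 3) ≤ ∫⁻ x, ENNReal.ofReal (g x ^ 3) / ρ x ^ 2 ∂m := by
  refine (ENNReal.add_le_add_iff_right
    (ENNReal.ofReal_ne_top (r := 2 * (∫ x, g x ∂m) ^ 3))).1 ?_
  rw [← lintegral_ofReal_three_mul_sq_mul hg hg0]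
  exact (lintegral_mono_ae (ae_ofReal_le_div_sq_add_mul hg0 hρ hρ1 hC)).trans
    (lintegral_div_sq_add_mul_le hρ hρ1)

theorem ae_eq_of_lintegral_div_sq_le (hg : Integrable g m) (hg0 : 0 ≤ g)
    (hC : 0 < ∫ x, g x ∂m) (hρ : AEMeasurable ρ m) (hρ1 : ∫⁻ x, ρ x ∂m ≤ 1)
    (h : ∫⁻ x, ENNReal.ofReal (g x ^ 3) / ρ x ^ 2 ∂m ≤ ENNReal.ofReal ((∫ x, g x ∂m) ^ 3)) :
    ρ =ᵐ[m] fun x => ENNReal.ofReal ((∫ x, g x ∂m)⁻¹ * g x) := by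
  have hint := lintegral_ofReal_three_mul_sq_mul hg hg0
  have heq := ae_eq_of_ae_le_of_lintegral_le (ae_ofReal_le_div_sq_add_mul hg0 hρ hρ1 hC)
    (by rw [hint]; exact ENNReal.add_ne_top.2 ⟨ENNReal.ofReal_ne_top, ENNReal.ofReal_ne_top⟩)
    (((hg.aemeasurable.pow_const 3).ennreal_ofReal.div (hρ.pow_const 2)).add (hρ.const_mul _))
    ((lintegral_div_sq_add_mul_le hρ hρ1).trans (hint ▸ add_le_add_left h _))
  filter_upwards [heq, ae_lt_top' hρ (ne_top_of_le_ne_top ENNReal.one_ne_top hρ1)] with x hx hlt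
  exact eq_ofReal_of_div_sq_add_mul_eq hC (hg0 x) hlt.ne hx

theorem lintegral_div_sq_le_of_ae_eq (hg : Integrable g m) (hg0 : 0 ≤ g)
    (hC : 0 < ∫ x, g x ∂m) (hρ : ρ =ᵐ[m] fun x => ENNReal.ofReal ((∫ x, g x ∂m)⁻¹ * g x)) :
    ∫⁻ x, ENNReal.ofReal (g x ^ 3) / ρ x ^ 2 ∂m ≤ ENNReal.ofReal ((∫ x, g x ∂m) ^ 3) := by
  rw [pow_succ (∫ x, g x ∂m), ← lintegral_ofReal_const_mul hg hg0 (by positivity)]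
  refine lintegral_mono_ae (hρ.mono fun x hx => ?_)
  generalize ∫ x, g x ∂m = C at hC hx
  have hgx : 0 ≤ g x := hg0 x
  rcases hgx.eq_or_lt' with hx0 | hx0
  · simp [hx0]
  rw [hx, ← ENNReal.ofReal_pow (by positivity), ← ENNReal.ofReal_div_of_pos (by positivity)]
  refine ENNReal.ofReal_le_ofReal (le_of_eq ?_)
  field_simp

end OptimalDensity

section Minimizer

variable {a b : ℝ} {f : ℝ → ℝ}

theorem abs_rpow_two_thirds_pow_three (y : ℝ) : (|y| ^ (2 / 3 : ℝ)) ^ 3 = y ^ 2 := by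
  rw [← Real.rpow_mul_natCast (abs_nonneg y), ← sq_abs y, ← Real.rpow_natCast]
  norm_num

theorem integrable_abs_rpow_two_thirds {X : Type*} [MeasurableSpace X] {m : Measure X}
    [IsFiniteMeasure m] {f : X → ℝ} (hf : MemLp f 2 m) :
    Integrable (fun x => |f x| ^ (2 / 3 : ℝ)) m := by
  have hle : (2 / 3 : ℝ≥0∞) ≤ 2 := ENNReal.div_le_of_le_mul (by norm_num)
  simpa using (hf.mono_exponent hle).integrable_norm_rpow'

theorem integral_abs_rpow_two_thirds_pos {X : Type*} [MeasurableSpace X] {m : Measure X}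
    {f : X → ℝ} (hf : Integrable (fun x => |f x| ^ (2 / 3 : ℝ)) m) (hf0 : ¬ f =ᵐ[m] 0) :
    0 < ∫ x, |f x| ^ (2 / 3 : ℝ) ∂m := by
  have hnn : ∀ x, 0 ≤ |f x| ^ (2 / 3 : ℝ) := fun x => by positivity
  refine (integral_nonneg hnn).lt_of_ne' fun h => hf0 ?_
  filter_upwards [(integral_eq_zero_iff_of_nonneg hnn hf).1 h] with x hx
  have hsq : f x ^ 2 = 0 := by
    rw [← abs_rpow_two_thirds_pow_three]
    exact (pow_eq_zero_iff three_ne_zero).2 hx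
  exact sq_eq_zero_iff.1 hsq

theorem toReal_injective :
    Function.Injective (toReal : ProbabilityMeasure (Set.Icc a b) → Measure ℝ) := fun μ ν h => by
  have hcomap := (MeasurableEmbedding.subtype_coe (measurableSet_Icc (a := a) (b := b))).comap_map
  exact Subtype.ext ((hcomap μ).symm.trans ((congrArg _ h).trans (hcomap ν)))

theorem lintegral_rnDeriv_toReal_le_one (ν : ProbabilityMeasure (Set.Icc a b)) :
    ∫⁻ x in Set.Icc a b, (toReal ν).rnDeriv volume x ≤ 1 :=
  (Measure.setLIntegral_rnDeriv_le _).trans prob_le_one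

theorem limitFunctional_eq :
    limitFunctional a b f = fun ν => 1 / 12 * ∫⁻ x in Set.Icc a b,
      ENNReal.ofReal ((|f x| ^ (2 / 3 : ℝ)) ^ 3) / (toReal ν).rnDeriv volume x ^ 2 := by
  simp only [abs_rpow_two_thirds_pow_three]
  rfl

theorem exists_toReal_eq_withDensity_restrict {w : ℝ → ℝ≥0∞}
    (hw : AEMeasurable w (volume.restrict (Set.Icc a b)))
    (hw1 : ∫⁻ x in Set.Icc a b, w x = 1) :
    ∃ μ : ProbabilityMeasure (Set.Icc a b),
      toReal μ = (volume.restrict (Set.Icc a b)).withDensity w ∧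
      (toReal μ).rnDeriv volume =ᵐ[volume.restrict (Set.Icc a b)] w := by
  have : IsProbabilityMeasure ((volume.restrict (Set.Icc a b)).withDensity w) :=
    ⟨by rw [withDensity_apply _ .univ, Measure.restrict_univ, hw1]⟩
  obtain ⟨μ, hμ⟩ := exists_toReal_eq (a := a) (b := b)
    (ν := (volume.restrict (Set.Icc a b)).withDensity w)
    (withDensity_absolutelyContinuous _ _ (by
      simp [Measure.restrict_apply measurableSet_Icc.compl]))
  refine ⟨μ, hμ, ?_⟩
  rw [hμ, ← withDensity_indicator measurableSet_Icc]
  filter_upwards [ae_restrict_of_ae (Measure.rnDeriv_withDensity₀ volume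
    ((aemeasurable_indicator_iff measurableSet_Icc).2 hw)), ae_restrict_mem measurableSet_Icc]
    with x hx hxI
  rw [hx, Set.indicator_of_mem hxI]

theorem eq_of_rnDeriv_toReal_ae_eq {w : ℝ → ℝ≥0∞} {μ ν : ProbabilityMeasure (Set.Icc a b)}
    (hμ : toReal μ = (volume.restrict (Set.Icc a b)).withDensity w)
    (hν : (toReal ν).rnDeriv volume =ᵐ[volume.restrict (Set.Icc a b)] w) : ν = μ := by
  refine toReal_injective (Measure.eq_of_le_of_isProbabilityMeasure ?_).symm
  rw [hμ, ← withDensity_congr_ae hν, ← restrict_withDensity measurableSet_Icc]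
  exact Measure.restrict_le_self.trans (Measure.withDensity_rnDeriv_le _ _)

theorem exists_unique_minimizer (hf : MemLp f 2 (volume.restrict (Set.Icc a b)))
    (hf0 : ¬ f =ᵐ[volume.restrict (Set.Icc a b)] 0) :
    ∃ μopt : ProbabilityMeasure (Set.Icc a b),
      toReal μopt = (volume.restrict (Set.Icc a b)).withDensity (fun x =>
        ENNReal.ofReal ((∫ t in Set.Icc a b, |f t| ^ (2 / 3 : ℝ))⁻¹ * |f x| ^ (2 / 3 : ℝ))) ∧
      (∀ ν, limitFunctional a b f μopt ≤ limitFunctional a b f ν) ∧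
      (∀ ν, (∀ ν', limitFunctional a b f ν ≤ limitFunctional a b f ν') → ν = μopt) := by
  have hg := integrable_abs_rpow_two_thirds hf
  have hg0 : (0 : ℝ → ℝ) ≤ fun x => |f x| ^ (2 / 3 : ℝ) := fun x => by positivity
  have hC := integral_abs_rpow_two_thirds_pos hg hf0
  have hρ (ν : ProbabilityMeasure (Set.Icc a b)) := (Measure.measurable_rnDeriv (toReal ν)
    volume).aemeasurable (μ := volume.restrict (Set.Icc a b))
  obtain ⟨μ, hμ, hrn⟩ := exists_toReal_eq_withDensity_restrict
    (hg.aemeasurable.const_mul (∫ t in Set.Icc a b, |f t| ^ (2 / 3 : ℝ))⁻¹).ennreal_ofReal (by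
      rw [lintegral_ofReal_const_mul hg hg0 (inv_nonneg.2 hC.le), inv_mul_cancel₀ hC.ne',
        ENNReal.ofReal_one])
  have hval := lintegral_div_sq_le_of_ae_eq hg hg0 hC hrn
  simp only [limitFunctional_eq]
  refine ⟨μ, hμ, fun ν => ?_, fun ν hν => eq_of_rnDeriv_toReal_ae_eq hμ ?_⟩
  · exact mul_le_mul_right (hval.trans (ofReal_integral_pow_three_le_lintegral_div_sq hg hg0 hC
      (hρ ν) (lintegral_rnDeriv_toReal_le_one ν))) _
  · exact ae_eq_of_lintegral_div_sq_le hg hg0 hC (hρ ν) (lintegral_rnDeriv_toReal_le_one ν)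
      (((ENNReal.mul_le_mul_iff_right (by simp) (by simp)).1 (hν μ)).trans hval)

end Minimizer

end DirichletPoints

theorem theorem5p2 (a b : ℝ) (hab : a < b) (f : ℝ → ℝ)
    (hf : MemLp f 2 (volume.restrict (Set.Icc a b))) :
    DirichletPoints.GammaConverges (DirichletPoints.pointFunctional a b f)
      (DirichletPoints.limitFunctional a b f) ∧
    DirichletPoints.GammaConverges (DirichletPoints.multiPointFunctional a b f)
      (DirichletPoints.limitFunctional a b f) ∧
    (¬ f =ᵐ[volume.restrict (Set.Icc a b)] 0 →
      ∃ μopt : ProbabilityMeasure (Set.Icc a b),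
        DirichletPoints.toReal μopt =
          (volume.restrict (Set.Icc a b)).withDensity (fun x =>
            ENNReal.ofReal ((∫ t in Set.Icc a b, |f t| ^ (2 / 3 : ℝ))⁻¹ * |f x| ^ (2 / 3 : ℝ))) ∧
        (∀ ν, DirichletPoints.limitFunctional a b f μopt ≤
          DirichletPoints.limitFunctional a b f ν) ∧
        (∀ ν, (∀ ν', DirichletPoints.limitFunctional a b f ν ≤
          DirichletPoints.limitFunctional a b f ν') → ν = μopt)) :=
  ⟨DirichletPoints.gammaConverges_of_le_of_le hab hf
      (fun _ _ => DirichletPoints.sparseFunctional_le_pointFunctional)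
      fun _ _ => DirichletPoints.pointFunctional_le_distinctPointFunctional,
    DirichletPoints.gammaConverges_of_le_of_le hab hf
      (fun _ _ => DirichletPoints.sparseFunctional_le_multiPointFunctional)
      fun _ _ => DirichletPoints.multiPointFunctional_le_distinctPointFunctional,
    DirichletPoints.exists_unique_minimizer hf⟩
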